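/- **Setting.** Let $\mathcal M=\langle S,\bar s,A,E,\Delta\rangle$ be a finite Markov decision process: finite sets $S$ of states and $A$ of actions, an initial state $\bar s\in S$, a non-empty set $E(s)\subseteq A$ of enabled actions for every $s$ (with $E(s)\cap E(t)=\emptyset$ for $s\neq t$), and a probability distribution $\Delta(s,a)$ on $S$ for $a\in E(s)$. Let $S$ contain two distinct distinguished terminal states $1$ and $0$ (all their enabled actions are self-loops), and let $F\subseteq S$ be a set of target states with $1\in F$, $0\notin F$. For $s\in S$ let $V(s)=\sup_\sigma \Pr^\sigma_s(\text{reach }F)$, over all history-dependent randomised strategies $\sigma$, and $V(s,a)=\sum_{t}\Delta(s,a)(t)V(t)$. Assume that every $f\in F$ has an action $a\in E(f)$ with $V(f,a)=1$, i.e. that $V(s)=\max_{a\in E(s)}V(s,a)$ holds at target states too (this is automatic if $F=\{1\}$, or if all target states are absorbing or lie in end components). There is no restriction on end components. An *end component* (EC) is a pair $(R,B)$, $R\subseteq S$, $\emptyset\ne B\subseteq\bigcup_{s\in R}E(s)$, such that the actions of $B$ taken in $R$ never leave $R$, and any state of $R$ is reachable from any other one by actions of $B$. A *MEC* is an EC that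 is maximal for componentwise inclusion. *Collapsing* $(R,B)$ replaces the states of $R$ by one state $s_{(R,B)}$, which is initial if $\bar s\in R$, whose enabled actions are those of the states of $R$ except $B$, each with its former transition distribution; all transitions into $R$ are redirected to $s_{(R,B)}$. $\textsc{MakeTerminal}(s,z)$, for $z\in\{0,1\}$, collapses $(\{s,z\},E(s))$ and calls the new state $z$. **Algorithm OBRTDP** (parameters: $\varepsilon>0$ and integers $k_0,k_1,k_2,\dots$). It keeps a current MDP, initially $\mathcal M$, whose components are again denoted by $S,\bar s,E,\Delta$, and functions $U,L$ on state-action pairs. Initially $U=1$, $L=0$, except $U(0,\cdot)=0$ and $L(1,\cdot)=1$. Write $U(s)=\max_{a\in E(s)}U(s,a)$ and $L(s)=\max_{a\in E(s)}L(s,a)$. In iteration $i=0,1,2,\dots$: 1. *Explore.* Let $\omega=\bar s$. Repeat: choose $a$ uniformly from $\arg\max_{a\in E(\mathrm{last}(\omega))}U(\mathrm{last}(\omega),a)$, sample $s$ from $\Delta(\mathrm{last}(\omega),a)$, and append $a\,s$ to $\omega$; if $\omega$ now has $k_i$ states, carry out step 3 and go to iteration $i+1$ (without step 2); otherwise, if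 $s\in\{0,1\}$, go to step 2. 2. *Update.* For the state-action pairs $(s,a)$ along $\omega$, from the last to the first, set $U(s,a)\leftarrow\sum_t\Delta(s,a)(t)U(t)$ and $L(s,a)\leftarrow\sum_t\Delta(s,a)(t)L(t)$. Then terminate if $U(\bar s)-L(\bar s)<\varepsilon$; otherwise go to iteration $i+1$. 3. *On-the-fly ECs.* Let $T$ be the set of states $s$ of the pairs $(s,a)$ that occur in $\omega$. Let $\mathcal M^T$ be the MDP with the states of $T$ and their one-step successors, in which the states of $T$ behave as in the current MDP and every other state has a self-loop as its only action. For each MEC $(R,B)$ of $\mathcal M^T$ with $R\subseteq T$: collapse $(R,B)$ in the current MDP and set $U(s_{(R,B)},a)\leftarrow U(s,a)$, $L(s_{(R,B)},a)\leftarrow L(s,a)$ for $s\in R$, $a\in E(s)\setminus B$; if $R\cap F\neq\emptyset$, apply $\textsc{MakeTerminal}(s_{(R,B)},1)$; otherwise, if $s_{(R,B)}$ has no enabled action, apply $\textsc{MakeTerminal}(s_{(R,B)},0)$. **Theorem.** Suppose that $k_i\ge 3$ for all $i$ and $k_i\ge|S|^2$ for all sufficiently large $i$, where $|S|$ is the number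 of states of $\mathcal M$ (so any sequence of integers $k_i\geq 3$ with $k_i\to\infty$ is allowed). Then OBRTDP converges almost surely: for every $\varepsilon>0$ it terminates with probability $1$, and at termination, with $\bar s'$ and $E'$ the initial state and the enabled actions of the final MDP, * $\max_{a\in E'(\bar s')}L(\bar s',a)\le V(\bar s)\le\max_{a\in E'(\bar s')}U(\bar s',a)$; * for every $a\in E'(\bar s')$, $L(\bar s',a)\le V(s,a)\le U(\bar s',a)$, where $s$ is the state of $\mathcal M$ in which $a$ is enabled; * $\max_{a\in E'(\bar s')}U(\bar s',a)-\max_{a\in E'(\bar s')}L(\bar s',a)<\varepsilon$; here $V$ is the value function of the original MDP $\mathcal M$. -/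

import Mathlib

namespace OBRTDP

open MeasureTheory ProbabilityTheory

noncomputable section

open scoped Classical

universe u v

/-! ### Markov decision processes, strategies, reachability values -/

/-- The data of a finite MDP whose states and actions are taken from the types `S` and `A`. Values
of `enabled` and `trans` outside `states` and at actions that are not enabled carry no meaning. -/
structure MDP (S : Type u) (A : Type v) where
  states : Finset S
  start : S
  enabled : S → Finset A
  trans : S → A → PMF S

variable {S : Type u} {A : Type v}

/-- The laws of an MDP, including the convention that an action is enabled in at most one state. -/
structure MDP.IsValid (M : MDP S A) : Prop where
  start_mem : M.start ∈ M.states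
  enabled_nonempty : ∀ s ∈ M.states, (M.enabled s).Nonempty
  support_subset : ∀ s ∈ M.states, ∀ a ∈ M.enabled s, (M.trans s a).support ⊆ ↑M.states
  enabled_disjoint : ∀ s ∈ M.states, ∀ t ∈ M.states, s ≠ t →
    Disjoint (M.enabled s) (M.enabled t)

/-- All enabled actions of `s` are self-loops. -/
def MDP.IsTerminal (M : MDP S A) (s : S) : Prop :=
  ∀ a ∈ M.enabled s, M.trans s a s = 1

/-- One letter `s a` of a path `s₀ a₀ s₁ a₁ …`. -/
@[ext]
structure Move (S : Type u) (A : Type v) where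
  state : S
  action : A

instance : MeasurableSpace (Move S A) := ⊤

instance : DiscreteMeasurableSpace (Move S A) := ⟨fun _ => trivial⟩

instance [Countable S] [Countable A] : Countable (Move S A) :=
  Function.Injective.countable (f := fun m : Move S A => (m.state, m.action)) (by
    intro m m' h
    exact Move.ext (congrArg Prod.fst h) (congrArg Prod.snd h))

/-- A (history-dependent, randomised) strategy. The finite path `s₀ a₀ … sₙ₋₁ aₙ₋₁ sₙ` is given by
the list of its letters `(s₀, a₀), …, (sₙ₋₁, aₙ₋₁)` and its last state `sₙ`. -/
structure Strategy (M : MDP S A) where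
  choose : List (Move S A) → S → PMF A
  support_subset : ∀ w, ∀ s ∈ M.states, (choose w s).support ⊆ ↑(M.enabled s)

/-- The list of the letters `0, …, n` of a path. -/
def prefixList {n : ℕ} (h : (i : Finset.Iic n) → Move S A) : List (Move S A) :=
  List.ofFn fun j : Fin (n + 1) => h ⟨j, Finset.mem_Iic.2 (Nat.lt_succ_iff.1 j.2)⟩

/-- The conditional law of letter `n + 1` given the letters `0, …, n`: the successor state is drawn
from the transition function, the next action from the strategy. -/
def Strategy.kernel [Countable S] [Countable A] {M : MDP S A} (σ : Strategy M) (n : ℕ) :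
    Kernel ((i : Finset.Iic n) → Move S A) (Move S A) where
  toFun h :=
    ((M.trans (h ⟨n, Finset.mem_Iic.2 le_rfl⟩).state (h ⟨n, Finset.mem_Iic.2 le_rfl⟩).action).bind
      fun t => (σ.choose (prefixList h) t).map (Move.mk t)).toMeasure
  measurable' := Measurable.of_discrete

instance [Countable S] [Countable A] {M : MDP S A} (σ : Strategy M) (n : ℕ) :
    IsMarkovKernel (σ.kernel n) :=
  ⟨fun _ => PMF.toMeasure.isProbabilityMeasure _⟩

/-- The probability measure on infinite paths from `s` that the strategy `σ` induces. -/
def pathMeasure [Countable S] [Countable A] {M : MDP S A} (σ : Strategy M) (s : S) :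
    Measure (ℕ → Move S A) :=
  Kernel.trajMeasure (X := fun _ => Move S A)
    ((σ.choose [] s).map (Move.mk s)).toMeasure σ.kernel

/-- The infinite paths that reach `F`. -/
def reach (F : Set S) : Set (ℕ → Move S A) := {ω | ∃ n, (ω n).state ∈ F}

/-- The value `V(s)`: the supremum over all strategies of the probability of reaching `F`. -/
def value [Countable S] [Countable A] (M : MDP S A) (F : Set S) (s : S) : ℝ :=
  (⨆ σ : Strategy M, pathMeasure σ s (reach F)).toReal

/-- The value `V(s, a)` of a state-action pair. -/
def actionValue [Countable S] [Countable A] (M : MDP S A) (F : Set S) (s : S) (a : A) : ℝ :=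
  ∑ t ∈ M.states, (M.trans s a t).toReal * value M F t

/-! ### End components and collapsing -/

/-- `(R, B)` is an end component of `M`, with at least one action: the pairs `(∅, ∅)` and
`({s}, ∅)` are not counted as end components. -/
structure MDP.IsEC (M : MDP S A) (R : Finset S) (B : Finset A) : Prop where
  states_subset : R ⊆ M.states
  actions_subset : B ⊆ R.biUnion M.enabled
  nonempty : B.Nonempty
  closed : ∀ s ∈ R, ∀ a ∈ B, a ∈ M.enabled s → (M.trans s a).support ⊆ ↑R
  connected : ∀ s ∈ R, ∀ t ∈ R,
    Relation.ReflTransGen (fun x y => ∃ a ∈ B, a ∈ M.enabled x ∧ 0 < M.trans x a y) s t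

/-- Maximal end components. -/
def MDP.IsMEC (M : MDP S A) (R : Finset S) (B : Finset A) : Prop :=
  M.IsEC R B ∧ ∀ R' B', M.IsEC R' B' → R ⊆ R' → B ⊆ B' → R' = R ∧ B' = B

/-- The state of `R` in which `a` is enabled (`r` if there is none). -/
def MDP.owner (M : MDP S A) (R : Finset S) (r : S) (a : A) : S :=
  if h : ∃ s ∈ R, a ∈ M.enabled s then h.choose else r

/-- Collapsing `(R, B)`; the new state is called `r`, where `r` is an element of `R`. -/
def MDP.collapse (M : MDP S A) (R : Finset S) (B : Finset A) (r : S) : MDP S A where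
  states := insert r (M.states \ R)
  start := if M.start ∈ R then r else M.start
  enabled s := if s = r then R.biUnion M.enabled \ B else M.enabled s \ B
  trans s a := (M.trans (if s = r then M.owner R r a else s) a).map
    fun t => if t ∈ R then r else t

/-- Merging the state `s` into the terminal state `z`. -/
def MDP.makeTerminal (M : MDP S A) (s z : S) : MDP S A :=
  M.collapse {s, z} (M.enabled s) z

/-! ### The auxiliary MDP of an explored set, and the identification of end components -/

/-- The MDP `M^T`: the states of `T` behave as in `M`, and their successors outside `T` get a
self-loop, with the new action `none`, as their only action. -/
def MDP.explored (M : MDP S A) (T : Finset S) : MDP S (Option A) where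
  states := T ∪ M.states.filter fun t => ∃ s ∈ T, ∃ a ∈ M.enabled s, 0 < M.trans s a t
  start := M.start
  enabled s := if s ∈ T then (M.enabled s).map Function.Embedding.some else {none}
  trans s a := match a with
    | some a => M.trans s a
    | none => PMF.pure s

/-- The maximal end components of `M^T` that are contained in `T`. -/
def MDP.identifyECs (M : MDP S A) (T : Finset S) : Finset (Finset S × Finset A) :=
  ((T.powerset ×ˢ (T.biUnion (M.explored T).enabled).powerset).filter
    fun P => (M.explored T).IsMEC P.1 P.2).image fun P => (P.1, Finset.eraseNone P.2)

/-! ### The algorithm -/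

/-- The current MDP and the current upper and lower bounds on state-action pairs. -/
structure Bounds (S : Type u) (A : Type v) where
  mdp : MDP S A
  U : S → A → ℝ
  L : S → A → ℝ

/-- `max_{a ∈ E(s)} f(s, a)`. -/
def MDP.best (M : MDP S A) (f : S → A → ℝ) (s : S) : ℝ :=
  if h : (M.enabled s).Nonempty then (M.enabled s).sup' h (f s) else 0

/-- `argmax_{a ∈ E(s)} f(s, a)`. -/
def MDP.bestActions (M : MDP S A) (f : S → A → ℝ) (s : S) : Finset A :=
  (M.enabled s).filter fun a => f s a = M.best f s

/-- `f(s, a) ← ∑ₜ Δ(s, a)(t) · f(t)`, where `f(t) = max_{b ∈ E(t)} f(t, b)`. -/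
def MDP.backup (M : MDP S A) (f : S → A → ℝ) (s : S) (a : A) : S → A → ℝ :=
  Function.update f s (Function.update (f s) a
    (∑ t ∈ M.states, (M.trans s a t).toReal * M.best f t))

/-- The BRTDP update of a state-action pair. -/
def Bounds.update (c : Bounds S A) (m : Move S A) : Bounds S A where
  mdp := c.mdp
  U := c.mdp.backup c.U m.state m.action
  L := c.mdp.backup c.L m.state m.action

/-- Collapse one end component `(R, B)`, copy the bounds of the remaining actions, and merge the new
state into the terminal state `one` if `R` contains a target state, or else into the terminal state
`zero` if no action is left. -/
def Bounds.processEC (F : Set S) (one zero : S) (c : Bounds S A) (P : Finset S × Finset A) :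
    Bounds S A :=
  if hR : P.1.Nonempty then
    let r := hR.choose
    let M := c.mdp.collapse P.1 P.2 r
    { mdp :=
        if ∃ s ∈ P.1, s ∈ F then M.makeTerminal r one
        else if M.enabled r = ∅ then M.makeTerminal r zero
        else M
      U := fun s a => if s = r then c.U (c.mdp.owner P.1 r a) a else c.U s a
      L := fun s a => if s = r then c.L (c.mdp.owner P.1 r a) a else c.L s a }
  else c

/-- The on-the-fly processing of end components, for the set `T` of explored states. -/
def Bounds.onTheFlyEC (F : Set S) (one zero : S) (c : Bounds S A) (T : Finset S) : Bounds S A :=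
  (c.mdp.identifyECs T).toList.foldl (Bounds.processEC F one zero) c

/-- A configuration of the algorithm: the MDP and the bounds, the number `iter` of finished
iterations of the outer loop, the path `ω` of the current simulation (its state-action letters,
most recent first, and its last state), and whether the algorithm has terminated. -/
structure Config (S : Type u) (A : Type v) where
  bounds : Bounds S A
  iter : ℕ
  path : List (Move S A)
  last : S
  halted : Bool

instance : MeasurableSpace (Config S A) := ⊤

/-- The start of the simulation of iteration `i`. -/
def Config.begin (c : Bounds S A) (i : ℕ) (halted : Bool) : Config S A where
  bounds := c
  iter := i
  path := []
  last := c.mdp.start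
  halted := halted

/-- The upper minus the lower bound at the initial state. -/
def Bounds.gap (c : Bounds S A) : ℝ :=
  c.mdp.best c.U c.mdp.start - c.mdp.best c.L c.mdp.start

/-- What happens after the simulated path has been extended by the action `a` and the state `s`.
If the path has `k i` states in iteration `i`, end components are identified and processed, and the
next iteration starts. Otherwise, if `s` is one of the terminal states `one`, `zero`, the
state-action pairs of the path are updated backwards, and the termination criterion is tested.
Otherwise the simulation goes on. -/
def Config.advance (F : Set S) (one zero : S) (ε : ℝ) (k : ℕ → ℕ) (c : Config S A)
    (a : A) (s : S) : Config S A :=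
  let ω := Move.mk c.last a :: c.path
  if ω.length + 1 = k c.iter then
    Config.begin (c.bounds.onTheFlyEC F one zero (ω.map Move.state).toFinset) (c.iter + 1) false
  else if s = one ∨ s = zero then
    let b := ω.foldl Bounds.update c.bounds
    Config.begin b (c.iter + 1) (decide (b.gap < ε))
  else
    { c with path := ω, last := s }

/-- One step of the simulation: the action is uniform among the enabled actions with the greatest
upper bound, and the successor is drawn from the transition function. Terminated configurations do
not change. -/
def Config.next (F : Set S) (one zero : S) (ε : ℝ) (k : ℕ → ℕ) (c : Config S A) :
    PMF (Config S A) :=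
  if h : c.halted = false ∧ (c.bounds.mdp.bestActions c.bounds.U c.last).Nonempty then
    (PMF.uniformOfFinset (c.bounds.mdp.bestActions c.bounds.U c.last) h.2).bind fun a =>
      (c.bounds.mdp.trans c.last a).map fun s => c.advance F one zero ε k a s
  else PMF.pure c

/-- The bounds at the beginning: `U = 1` and `L = 0`, except that `U = 0` at the state `zero` and
`L = 1` at the state `one`. -/
def Bounds.first (M : MDP S A) (one zero : S) : Bounds S A where
  mdp := M
  U := fun s _ => if s = zero then 0 else 1
  L := fun s _ => if s = one then 1 else 0

/-- The conditional law of configuration `n + 1` given the configurations `0, …, n`. -/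
def runKernel (F : Set S) (one zero : S) (ε : ℝ) (k : ℕ → ℕ) (n : ℕ) :
    Kernel ((i : Finset.Iic n) → Config S A) (Config S A) where
  toFun h := (Config.next F one zero ε k (h ⟨n, Finset.mem_Iic.2 le_rfl⟩)).toMeasure
  measurable' :=
    (measurable_from_top
      (f := fun c : Config S A => (Config.next F one zero ε k c).toMeasure)).comp
        (measurable_pi_apply _)

instance (F : Set S) (one zero : S) (ε : ℝ) (k : ℕ → ℕ) (n : ℕ) :
    IsMarkovKernel (runKernel (A := A) F one zero ε k n) :=
  ⟨fun _ => PMF.toMeasure.isProbabilityMeasure _⟩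

/-- The law of the random sequence of configurations of the algorithm OBRTDP on the MDP `M` with
target set `F`, terminal states `one` and `zero`, precision `ε`, and path lengths `k i`. -/
def runMeasure (M : MDP S A) (F : Set S) (one zero : S) (ε : ℝ) (k : ℕ → ℕ) :
    Measure (ℕ → Config S A) :=
  Kernel.trajMeasure (X := fun _ => Config S A)
    (Measure.dirac (Config.begin (Bounds.first M one zero) 0 false))
    (runKernel F one zero ε k)

/-- The bounds of `c` are correct at its initial state, for the MDP `M` and the target set `F`, and
their distance there is less than `ε`. The bounds on pairs are compared with the value in `M` of
the action in the state of `M` that it belongs to. -/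
structure Bounds.IsCorrect [Countable S] [Countable A] (M : MDP S A) (F : Set S) (ε : ℝ)
    (c : Bounds S A) : Prop where
  pairs : ∀ a ∈ c.mdp.enabled c.mdp.start, ∃ s ∈ M.states, a ∈ M.enabled s ∧
    c.L c.mdp.start a ≤ actionValue M F s a ∧ actionValue M F s a ≤ c.U c.mdp.start a
  lower : c.mdp.best c.L c.mdp.start ≤ value M F M.start
  upper : value M F M.start ≤ c.mdp.best c.U c.mdp.start
  close : c.gap < ε

end

end OBRTDP

namespace OBRTDP

open MeasureTheory ProbabilityTheory

noncomputable section

open scoped Classical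

/-! ### Trajectories of Markov kernels and a conditional Borel–Cantelli lemma -/

section Trajectories

open Preorder Filter
open scoped ENNReal

variable {X : Type*} [MeasurableSpace X] (μ₀ : Measure X) [IsProbabilityMeasure μ₀]
  (κ : (n : ℕ) → Kernel ((i : Finset.Iic n) → X) X) [∀ n, IsMarkovKernel (κ n)]

/-! Everything is measured against one fixed function, the value V of the original MDP M. The
current MDP is always a quotient of M along a map `proj`: V is constant on the classes, and an
action of M that has disappeared either stays inside a class whose representative is not a target or
belongs to a state merged into `one`. V is the least pre-fixed point of the Bellman operator of M
(`value_le_of_supersolution`). Hence a target-free set with constant positive value must have an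
exit that loses nothing, and the Bellman equation for V survives in every quotient
(`IsQuotient.exists_mean_value_eq`). The assumption on target states enters only there.

Correctness is an invariant, `Bounds.IsSound`. Besides L ≤ V ≤ U it says that U is superharmonic and
L subharmonic. So backups are monotone, and U is constant on end components, which means that
merging one cannot raise U. The delicate point is L: the merged state keeps only the actions outside
B, and its lower bound might drop. The field `justified` excludes this: a positive maximum of L over
a set X without `one` is attained by an action that may leave X, and such an action is not in B when
X = R.

For termination, suppose that a run never halts. Every collapse removes an action, so from some time
on the MDP is fixed, no end component is found, and all `k i` are at least |S|² (`StableRun`). There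
are finitely many policies (families of argmax sets), so some policy ρ is in force at the start of
infinitely many iterations. By the conditional Borel–Cantelli lemma `ae_frequently_trajMeasure`,
every path of ρ with fewer than |S|² states through nonterminal states is then produced infinitely
often. If ρ could reach a state from which it reaches no terminal state, it would have a closed
strongly connected set R of nonterminal states. This R is an end component, some path with fewer
than |S|² states covers it, and the simulation then stays in R until the path is long enough, so
that an end component would be found (`StableRun.exists_reach_terminal`). Hence every pair reachable
under ρ lies on a short path to a terminal state and is updated infinitely often.

The bounds are monotone and converge. The difference D of the limits of U(s) and L(s) satisfies D(s)
≤ ∑ Δ(s,a)(t) D(t) for reachable nonterminal s and a in ρ(s), so its maximum over the reachable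
states propagates to a terminal state, where D = 0. But every update of a run that never halts
leaves a gap of at least ε at the initial state, a contradiction (`StableRun.false`). -/

/-- The coordinates `0, …, n` of a trajectory. -/
abbrev past (n : ℕ) (ω : ℕ → X) : (i : Finset.Iic n) → X :=
  frestrictLe (π := fun _ => X) n ω

/-- This is the tower property: coordinate `n + 1` is integrated out given the past. Together with
the law of coordinate 0 it is all that is used about `Kernel.trajMeasure`. -/
theorem lintegral_trajMeasure_succ (n : ℕ) {f : ((i : Finset.Iic n) → X) × X → ℝ≥0∞}
    (hf : Measurable f) :
    ∫⁻ ω, f (past n ω, ω (n + 1)) ∂(Kernel.trajMeasure (X := fun _ => X) μ₀ κ) =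
      ∫⁻ ω, ∫⁻ y, f (past n ω, y) ∂(κ n (past n ω))
        ∂(Kernel.trajMeasure (X := fun _ => X) μ₀ κ) := by
  have h := Kernel.map_frestrictLe_trajMeasure_compProd_eq_map_trajMeasure
    (X := fun _ => X) (μ₀ := μ₀) (κ := κ) (a := n)
  have h2 : ∫⁻ p, f p ∂((Kernel.trajMeasure (X := fun _ => X) μ₀ κ).map
      (fun x ↦ (past n x, x (n + 1)))) =
      ∫⁻ ω, f (past n ω, ω (n + 1)) ∂(Kernel.trajMeasure (X := fun _ => X) μ₀ κ) :=
    lintegral_map hf (by fun_prop)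
  rw [← h2, ← h, Measure.lintegral_compProd hf, lintegral_map _ (by fun_prop)]
  exact hf.lintegral_kernel_prod_right'

omit [IsProbabilityMeasure μ₀] in
theorem trajMeasure_map_zero :
    (Kernel.trajMeasure (X := fun _ => X) μ₀ κ).map (fun ω => ω 0) = μ₀ := by
  have h0 : (fun ω : ℕ → X => ω 0) = (fun h : (i : Finset.Iic 0) → X =>
      h ⟨0, Finset.mem_Iic.2 le_rfl⟩) ∘ frestrictLe (π := fun _ => X) 0 := rfl
  rw [h0, ← Measure.map_map (by fun_prop) (by fun_prop), Kernel.trajMeasure,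
    Measure.map_comp _ _ (by fun_prop), Kernel.traj_map_frestrictLe, Kernel.partialTraj_self,
    Measure.id_comp, Measure.map_map (by fun_prop) (by fun_prop)]
  convert! Measure.map_id

omit [IsProbabilityMeasure μ₀] in
theorem ae_trajMeasure_zero {p : X → Prop} (hp : ∀ᵐ x ∂μ₀, p x) :
    ∀ᵐ ω ∂(Kernel.trajMeasure (X := fun _ => X) μ₀ κ), p (ω 0) := by
  rw [← trajMeasure_map_zero μ₀ κ] at hp
  exact ae_of_ae_map (f := fun ω : ℕ → X => ω 0) (measurable_pi_apply 0).aemeasurable hp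

theorem ae_trajMeasure_succ (n : ℕ) {E : Set (((i : Finset.Iic n) → X) × X)}
    (hE : MeasurableSet E)
    (h : ∀ᵐ ω ∂(Kernel.trajMeasure (X := fun _ => X) μ₀ κ),
      ∀ᵐ y ∂(κ n (past n ω)), (past n ω, y) ∈ E) :
    ∀ᵐ ω ∂(Kernel.trajMeasure (X := fun _ => X) μ₀ κ), (past n ω, ω (n + 1)) ∈ E := by
  have hm : Measurable (Eᶜ.indicator (1 : ((i : Finset.Iic n) → X) × X → ℝ≥0∞)) :=
    measurable_one.indicator hE.compl
  have h1 := lintegral_trajMeasure_succ μ₀ κ n hm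
  have h2 : ∫⁻ ω, ∫⁻ y, Eᶜ.indicator (1 : ((i : Finset.Iic n) → X) × X → ℝ≥0∞)
      (past n ω, y) ∂(κ n (past n ω))
        ∂(Kernel.trajMeasure (X := fun _ => X) μ₀ κ) = 0 := by
    rw [lintegral_eq_zero_of_ae_eq_zero]
    filter_upwards [h] with ω hω
    rw [Pi.zero_apply]
    rw [lintegral_eq_zero_of_ae_eq_zero]
    filter_upwards [hω] with y hy
    simp [hy]
  rw [h2, lintegral_eq_zero_iff (by fun_prop)] at h1
  filter_upwards [h1] with ω hω
  by_contra hc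
  simp [hc] at hω

/-- Conditional Borel–Cantelli lemma for trajectories. -/
theorem ae_frequently_trajMeasure (D : (n : ℕ) → Set ((i : Finset.Iic n) → X))
    (hD : ∀ n, MeasurableSet (D n)) (E : (n : ℕ) → Set (((i : Finset.Iic n) → X) × X))
    (hE : ∀ n, MeasurableSet (E n)) (δ : ℝ≥0∞) (hδ : 0 < δ)
    (h : ∀ n, ∀ x ∈ D n, δ ≤ κ n x {y | (x, y) ∈ E n}) :
    ∀ᵐ ω ∂(Kernel.trajMeasure (X := fun _ => X) μ₀ κ),
      (∃ᶠ n in atTop, past n ω ∈ D n) →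
        ∃ᶠ n in atTop, (past n ω, ω (n + 1)) ∈ E n := by
  -- A visit to `D` without `E` has conditional probability at most 1 - δ. The factor `r`
  -- compensates for this; it is `⊤` when δ = 1.
  set r : ℝ≥0∞ := (1 - δ)⁻¹ with hr
  have hr1 : 1 < r := by
    rw [hr, ENNReal.one_lt_inv]
    exact ENNReal.sub_lt_self ENNReal.one_ne_top one_ne_zero hδ.ne'
  let g : (n : ℕ) → ((i : Finset.Iic n) → X) × X → ℝ≥0∞ := fun n p =>
    (E n)ᶜ.indicator 1 p * (if p.1 ∈ D n then r else 1)
  have hg : ∀ n, Measurable (g n) := fun n =>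
    (measurable_one.indicator (hE n).compl).mul
      (Measurable.ite (measurable_fst (hD n)) measurable_const measurable_const)
  have hgint : ∀ n x, ∫⁻ y, g n (x, y) ∂(κ n x) ≤ 1 := by
    intro n x
    have hmx : Measurable fun y : X => ((E n)ᶜ.indicator
        (1 : ((i : Finset.Iic n) → X) × X → ℝ≥0∞) (x, y)) :=
      (measurable_one.indicator (hE n).compl).comp (by fun_prop)
    have hsec : MeasurableSet {y | (x, y) ∈ E n} := measurable_prodMk_left (hE n)
    have hmul : ∫⁻ y, g n (x, y) ∂(κ n x) = (∫⁻ y, (E n)ᶜ.indicator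
        (1 : ((i : Finset.Iic n) → X) × X → ℝ≥0∞) (x, y) ∂(κ n x)) *
          (if x ∈ D n then r else 1) := lintegral_mul_const (if x ∈ D n then r else 1) hmx
    rw [hmul]
    have hi : ∫⁻ y, (E n)ᶜ.indicator (1 : ((i : Finset.Iic n) → X) × X → ℝ≥0∞) (x, y) ∂(κ n x)
        = κ n x {y | (x, y) ∈ E n}ᶜ := by
      rw [← lintegral_indicator_one hsec.compl]
      rfl
    rw [hi]
    by_cases hx : x ∈ D n
    · rw [if_pos hx, prob_compl_eq_one_sub hsec]
      calc (1 - κ n x {y | (x, y) ∈ E n}) * r ≤ (1 - δ) * r := by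
            gcongr
            exact h n x hx
        _ ≤ 1 := ENNReal.mul_inv_le_one _
    · rw [if_neg hx, mul_one]
      exact prob_le_one
  have key : ∀ m : ℕ, ∀ᵐ ω ∂(Kernel.trajMeasure (X := fun _ => X) μ₀ κ),
      (∃ᶠ n in atTop, past n ω ∈ D n) →
        ∃ n, m ≤ n ∧ (past n ω, ω (n + 1)) ∈ E n := by
    intro m
    -- A nonnegative supermartingale with initial value 1: it is multiplied by `r` at each visit to
    -- `D` from time `m` on, and killed by the first `E`.
    let G : ℕ → (ℕ → X) → ℝ≥0∞ := fun N ω =>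
      ∏ i ∈ Finset.range N, g (m + i) (past (m + i) ω, ω (m + i + 1))
    have hGm : ∀ N, Measurable (G N) := fun N =>
      Finset.measurable_prod _ fun i _ => (hg (m + i)).comp (by fun_prop)
    -- `G N` depends on the coordinates up to `m + N` only, so it is a constant when the next factor
    -- is integrated against the kernel.
    have hGH : ∀ N, ∃ H : ((i : Finset.Iic (m + N)) → X) → ℝ≥0∞, Measurable H ∧
        ∀ ω, G N ω = H (past (m + N) ω) := by
      intro N
      induction N with
      | zero => exact ⟨fun _ => 1, measurable_const, fun ω => by simp [G]⟩
      | succ N ih =>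
        obtain ⟨H, hH, hGH⟩ := ih
        have hres : Measurable (frestrictLe₂ (π := fun _ => X) (Nat.le_succ (m + N))) :=
          measurable_frestrictLe₂ _
        refine ⟨fun x => H (frestrictLe₂ (π := fun _ => X) (Nat.le_succ (m + N)) x) *
          g (m + N) (frestrictLe₂ (π := fun _ => X) (Nat.le_succ (m + N)) x,
            x ⟨m + N + 1, Finset.mem_Iic.2 le_rfl⟩), ?_, ?_⟩
        · exact (hH.comp hres).mul ((hg (m + N)).comp (hres.prodMk (measurable_pi_apply _)))
        · intro ω
          simp only [G] at hGH ⊢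
          rw [Finset.prod_range_succ, hGH]
          rfl
    have hGint : ∀ N, ∫⁻ ω, G N ω ∂(Kernel.trajMeasure (X := fun _ => X) μ₀ κ) ≤ 1 := by
      intro N
      induction N with
      | zero => simp [G]
      | succ N ih =>
        obtain ⟨H, hH, hGH'⟩ := hGH N
        have e : ∀ ω, G (N + 1) ω =
            (fun p : ((i : Finset.Iic (m + N)) → X) × X => H p.1 * g (m + N) p)
              (past (m + N) ω, ω (m + N + 1)) := by
          intro ω
          simp only [G] at hGH' ⊢
          rw [Finset.prod_range_succ, hGH']
        simp_rw [e]
        have hmeas : Measurable (fun p : ((i : Finset.Iic (m + N)) → X) × X =>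
          H p.1 * g (m + N) p) := (hH.comp measurable_fst).mul (hg (m + N))
        refine (lintegral_trajMeasure_succ μ₀ κ (m + N) hmeas).trans_le ?_
        refine le_trans (lintegral_mono fun ω => ?_) ih
        have hsec : Measurable fun y => g (m + N) (past (m + N) ω, y) :=
          (hg (m + N)).comp measurable_prodMk_left
        simp only
        rw [lintegral_const_mul _ hsec, hGH']
        exact mul_le_of_le_one_right' (hgint _ _)
    -- By Fatou the liminf of `G` is finite almost surely, whereas infinitely many visits to `D`
    -- without any `E` after `m` would make it at least `r ^ j` for every `j`.
    have hfat : ∫⁻ ω, liminf (fun N => G N ω) atTop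
        ∂(Kernel.trajMeasure (X := fun _ => X) μ₀ κ) ≤ 1 :=
      (lintegral_liminf_le hGm).trans
        (liminf_le_of_le (by isBoundedDefault) fun b hb => by
          obtain ⟨N, hN⟩ := (hb).exists
          exact hN.trans (hGint N))
    have hfin := ae_lt_top (Measurable.liminf hGm) (hfat.trans_lt ENNReal.one_lt_top).ne
    filter_upwards [hfin] with ω hω hfreq
    by_contra hcon
    push Not at hcon
    have hstep : ∀ N, G (N + 1) ω =
        G N ω * (if past (m + N) ω ∈ D (m + N) then r else 1) := by
      intro N
      simp only [G]
      rw [Finset.prod_range_succ]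
      congr 1
      have := hcon (m + N) (Nat.le_add_right _ _)
      simp [g, this]
    have hmono : Monotone fun N => G N ω := monotone_nat_of_le_succ fun N => by
      rw [hstep]
      refine le_mul_of_one_le_right' ?_
      split_ifs
      · exact hr1.le
      · exact le_rfl
    have hgrow : ∀ j : ℕ, ∃ N, r ^ j ≤ G N ω := by
      intro j
      induction j with
      | zero => exact ⟨0, by simp [G]⟩
      | succ j ih =>
        obtain ⟨N, hN⟩ := ih
        obtain ⟨n, hn, hnD⟩ := (frequently_atTop.1 hfreq) (m + N)
        obtain ⟨i, rfl⟩ := Nat.exists_eq_add_of_le (le_trans (Nat.le_add_right m N) hn)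
        refine ⟨i + 1, ?_⟩
        rw [hstep, if_pos hnD, pow_succ]
        gcongr
        exact hN.trans (hmono (by omega))
    have htop : liminf (fun N => G N ω) atTop = ⊤ := by
      refine Tendsto.liminf_eq ?_
      rw [ENNReal.tendsto_nhds_top_iff_nnreal]
      intro x
      have := ENNReal.tendsto_pow_atTop_nhds_top_iff.2 hr1
      obtain ⟨j, hj⟩ := ((ENNReal.tendsto_nhds_top_iff_nnreal.1 this) x).exists
      obtain ⟨N, hN⟩ := hgrow j
      filter_upwards [eventually_ge_atTop N] with N' hN'
      exact hj.trans_le (hN.trans (hmono hN'))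
    exact absurd htop hω.ne
  filter_upwards [ae_all_iff.2 key] with ω hω hfreq
  rw [frequently_atTop]
  intro m
  obtain ⟨n, hn, h⟩ := hω m hfreq
  exact ⟨n, hn, h⟩

end Trajectories

/-! ### The value as the limit of value iteration and as a least pre-fixed point -/

section Value

open scoped ENNReal

universe u v
variable {S : Type u} {A : Type v}

/-- Value iteration for the probability of reaching `F`. -/
def valueIter (M : MDP S A) (F : Set S) : ℕ → S → ℝ≥0∞
  | 0, s => if s ∈ F then 1 else 0
  | n + 1, s => if s ∈ F then 1 else ⨆ a ∈ M.enabled s, ∑' t, M.trans s a t * valueIter M F n t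

theorem valueIter_of_mem (M : MDP S A) {F : Set S} {s : S} (hs : s ∈ F) (n : ℕ) :
    valueIter M F n s = 1 := by
  cases n <;> simp [valueIter, hs]

theorem valueIter_le_one (M : MDP S A) (F : Set S) (n : ℕ) (s : S) : valueIter M F n s ≤ 1 := by
  induction n generalizing s with
  | zero => simp only [valueIter]; split_ifs <;> simp
  | succ n ih =>
    simp only [valueIter]
    split_ifs
    · exact le_rfl
    · refine iSup₂_le fun a _ => ?_
      calc ∑' t, M.trans s a t * valueIter M F n t ≤ ∑' t, M.trans s a t := by
            exact ENNReal.tsum_le_tsum fun t => mul_le_of_le_one_right' (ih t)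
        _ = 1 := PMF.tsum_coe _

theorem valueIter_le_succ (M : MDP S A) (F : Set S) (n : ℕ) (s : S) :
    valueIter M F n s ≤ valueIter M F (n + 1) s := by
  induction n generalizing s with
  | zero =>
    by_cases hs : s ∈ F
    · rw [valueIter_of_mem M hs, valueIter_of_mem M hs]
    · simp [valueIter, hs]
  | succ n ih =>
    by_cases hs : s ∈ F
    · rw [valueIter_of_mem M hs, valueIter_of_mem M hs]
    · rw [valueIter, valueIter, if_neg hs, if_neg hs]
      exact iSup₂_mono fun a _ => ENNReal.tsum_le_tsum fun t => by gcongr; exact ih t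

theorem valueIter_monotone (M : MDP S A) (F : Set S) (s : S) :
    Monotone fun n => valueIter M F n s :=
  monotone_nat_of_le_succ fun n => valueIter_le_succ M F n s

/-- The limit of value iteration. -/
def valueLim (M : MDP S A) (F : Set S) (s : S) : ℝ≥0∞ := ⨆ n, valueIter M F n s

theorem valueLim_of_mem (M : MDP S A) {F : Set S} {s : S} (hs : s ∈ F) : valueLim M F s = 1 := by
  simp [valueLim, valueIter_of_mem M hs]

theorem valueLim_le_one (M : MDP S A) (F : Set S) (s : S) : valueLim M F s ≤ 1 :=
  iSup_le fun n => valueIter_le_one M F n s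

theorem tsum_trans_mul_valueLim [Finite S] (M : MDP S A) (F : Set S) (p : PMF S) :
    ∑' t, p t * valueLim M F t = ⨆ n, ∑' t, p t * valueIter M F n t := by
  have := Fintype.ofFinite S
  simp_rw [tsum_fintype, valueLim, ENNReal.mul_iSup]
  refine ENNReal.finsetSum_iSup_of_monotone fun t i j hij => ?_
  gcongr
  exact valueIter_monotone M F t hij

theorem tsum_trans_mul_valueLim_le [Finite S] (M : MDP S A) {F : Set S} {s : S} (hs : s ∉ F)
    {a : A} (ha : a ∈ M.enabled s) : ∑' t, M.trans s a t * valueLim M F t ≤ valueLim M F s := by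
  rw [tsum_trans_mul_valueLim]
  refine iSup_le fun n => le_trans ?_ (le_iSup _ (n + 1))
  rw [valueIter, if_neg hs]
  exact le_iSup₂ (f := fun a _ => ∑' t, M.trans s a t * valueIter M F n t) a ha

/-- The pre-fixed points of the Bellman operator bound the value from above. -/
theorem valueIter_le_of_supersolution {M : MDP S A} (hM : M.IsValid) {F : Set S} {W : S → ℝ≥0∞}
    (hF : ∀ s ∈ M.states, s ∈ F → 1 ≤ W s)
    (hW : ∀ s ∈ M.states, s ∉ F → ∀ a ∈ M.enabled s, ∑' t, M.trans s a t * W t ≤ W s)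
    (n : ℕ) : ∀ s ∈ M.states, valueIter M F n s ≤ W s := by
  induction n with
  | zero =>
    intro s hs
    by_cases hsF : s ∈ F
    · rw [valueIter_of_mem M hsF]; exact hF s hs hsF
    · simp [valueIter, hsF]
  | succ n ih =>
    intro s hs
    by_cases hsF : s ∈ F
    · rw [valueIter_of_mem M hsF]; exact hF s hs hsF
    · rw [valueIter, if_neg hsF]
      refine iSup₂_le fun a ha => le_trans (ENNReal.tsum_le_tsum fun t => ?_) (hW s hs hsF a ha)
      by_cases ht : M.trans s a t = 0
      · simp [ht]
      · gcongr
        exact ih t (hM.support_subset s hs a ha ((PMF.mem_support_iff _ _).2 ht))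

theorem lintegral_toMeasure {Y : Type*} [Countable Y] [MeasurableSpace Y]
    [MeasurableSingletonClass Y] (p : PMF Y) (f : Y → ℝ≥0∞) :
    ∫⁻ y, f y ∂p.toMeasure = ∑' y, p y * f y := by
  rw [lintegral_countable']
  refine tsum_congr fun y => ?_
  rw [PMF.toMeasure_apply_singleton _ _ (measurableSet_singleton y), mul_comm]

theorem tsum_bind_mul {Y Z : Type*} (p : PMF Y) (q : Y → PMF Z) (f : Z → ℝ≥0∞) :
    ∑' z, p.bind q z * f z = ∑' y, p y * ∑' z, q y z * f z := by
  simp_rw [PMF.bind_apply, ← ENNReal.tsum_mul_right, ← ENNReal.tsum_mul_left]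
  rw [ENNReal.tsum_comm]
  simp_rw [mul_assoc]

theorem tsum_map_mul {Y Z : Type*} (p : PMF Y) (g : Y → Z) (f : Z → ℝ≥0∞) :
    ∑' z, p.map g z * f z = ∑' y, p y * f (g y) := by
  rw [PMF.map, tsum_bind_mul]
  refine tsum_congr fun y => ?_
  congr 1
  rw [tsum_eq_single (g y)]
  · simp
  · intro z hz
    simp [PMF.pure_apply, hz]

variable [Finite S] [Finite A]

theorem lintegral_kernel {M : MDP S A} (σ : Strategy M) (n : ℕ)
    (h : (i : Finset.Iic n) → Move S A) (f : Move S A → ℝ≥0∞) :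
    ∫⁻ m, f m ∂(σ.kernel n h) =
      ∑' t, M.trans (h ⟨n, Finset.mem_Iic.2 le_rfl⟩).state (h ⟨n, Finset.mem_Iic.2 le_rfl⟩).action t
        * ∑' b, σ.choose (prefixList h) t b * f ⟨t, b⟩ := by
  change ∫⁻ m, f m ∂(PMF.toMeasure _) = _
  rw [lintegral_toMeasure, tsum_bind_mul]
  simp_rw [tsum_map_mul]

/-- The history `h` has visited `F`. -/
def Hit (F : Set S) {n : ℕ} (h : (i : Finset.Iic n) → Move S A) : Prop := ∃ i, (h i).state ∈ F

omit [Finite S] [Finite A] in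
theorem hit_succ (F : Set S) (n : ℕ) (ω : ℕ → Move S A) :
    Hit F (past (n + 1) ω) ↔ Hit F (past n ω) ∨ (ω (n + 1)).state ∈ F := by
  constructor
  · rintro ⟨⟨i, hi⟩, h⟩
    rcases Nat.lt_or_ge n i with hlt | hle
    · have : i = n + 1 := by have := Finset.mem_Iic.1 hi; omega
      subst this
      exact Or.inr h
    · exact Or.inl ⟨⟨i, Finset.mem_Iic.2 hle⟩, h⟩
  · rintro (⟨⟨i, hi⟩, h⟩ | h)
    · exact ⟨⟨i, Finset.mem_Iic.2 (by have := Finset.mem_Iic.1 hi; omega)⟩, h⟩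
    · exact ⟨⟨n + 1, Finset.mem_Iic.2 le_rfl⟩, h⟩

/-- A letter contains a state and the action played there, so letter `n + 1` is integrated by
drawing the state from the MDP and then the action from the strategy. If the state is a target, the
action no longer matters. -/
theorem lintegral_hit_succ {M : MDP S A} (σ : Strategy M) (s : S) (F : Set S) (n : ℕ)
    (g : Move S A → ℝ≥0∞) :
    ∫⁻ ω, (if Hit F (past (n + 1) ω) then 1 else g (ω (n + 1))) ∂(pathMeasure σ s) =
      ∫⁻ ω, (if Hit F (past n ω) then 1 else
        ∑' t, M.trans (ω n).state (ω n).action t * ∑' b, σ.choose (prefixList (past n ω)) t b *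
          (if t ∈ F then 1 else g ⟨t, b⟩)) ∂(pathMeasure σ s) := by
  have h1 := lintegral_trajMeasure_succ ((σ.choose [] s).map (Move.mk s)).toMeasure σ.kernel n
    (f := fun p : ((i : Finset.Iic n) → Move S A) × Move S A =>
      if Hit F p.1 ∨ p.2.state ∈ F then 1 else g p.2) Measurable.of_discrete
  have h2 : ∀ ω : ℕ → Move S A, (if Hit F (past (n + 1) ω) then 1 else g (ω (n + 1))) =
      (if Hit F (past n ω) ∨ (ω (n + 1)).state ∈ F then (1 : ℝ≥0∞) else g (ω (n + 1))) := by
    intro ω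
    simp only [hit_succ]
  simp_rw [h2]
  refine h1.trans (lintegral_congr fun ω => ?_)
  by_cases hh : Hit F (past n ω)
  · simp [hh]
  · simp only [hh, false_or, if_false]
    rw [lintegral_kernel]
    rfl

theorem lintegral_hit_zero {M : MDP S A} (σ : Strategy M) (s : S) (F : Set S)
    (g : Move S A → ℝ≥0∞) :
    ∫⁻ ω, (if Hit F (past 0 ω) then 1 else g (ω 0)) ∂(pathMeasure σ s) =
      ∑' b, σ.choose [] s b * (if s ∈ F then 1 else g ⟨s, b⟩) := by
  have h1 := trajMeasure_map_zero ((σ.choose [] s).map (Move.mk s)).toMeasure σ.kernel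
  have h2 : ∀ ω : ℕ → Move S A, (if Hit F (past 0 ω) then 1 else g (ω 0)) =
      (if (ω 0).state ∈ F then (1 : ℝ≥0∞) else g (ω 0)) := by
    intro ω
    have : Hit F (past 0 ω) ↔ (ω 0).state ∈ F := by
      constructor
      · rintro ⟨⟨i, hi⟩, h⟩
        have : i = 0 := by simpa using hi
        subst this
        exact h
      · exact fun h => ⟨⟨0, Finset.mem_Iic.2 le_rfl⟩, h⟩
    simp only [this]
  simp_rw [h2]
  have h3 := lintegral_map (μ := pathMeasure σ s)
    (f := fun m : Move S A => if m.state ∈ F then (1 : ℝ≥0∞) else g m)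
    (g := fun ω : ℕ → Move S A => ω 0) Measurable.of_discrete (measurable_pi_apply 0)
  rw [← h3, pathMeasure, h1, lintegral_toMeasure, tsum_map_mul]

/-- The data of an MDP are meaningless outside its states and enabled actions. This confines the
path measure to where the Bellman inequalities are available. -/
theorem ae_valid {M : MDP S A} (hM : M.IsValid) (σ : Strategy M) {s : S} (hs : s ∈ M.states) :
    ∀ᵐ ω ∂(pathMeasure σ s), ∀ n, (ω n).state ∈ M.states ∧ (ω n).action ∈ M.enabled (ω n).state := by
  rw [ae_all_iff]
  intro n
  induction n with
  | zero =>
    refine ae_trajMeasure_zero _ _ (p := fun m : Move S A =>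
      m.state ∈ M.states ∧ m.action ∈ M.enabled m.state) ?_
    rw [ae_iff, PMF.toMeasure_apply_eq_zero_iff _ (MeasurableSet.of_discrete), Set.disjoint_left]
    intro m hm hm'
    rw [PMF.mem_support_map_iff] at hm
    obtain ⟨b, hb, rfl⟩ := hm
    exact hm' ⟨hs, σ.support_subset _ _ hs hb⟩
  | succ n ih =>
    let E : Set (((i : Finset.Iic n) → Move S A) × Move S A) :=
      {p | p.2.state ∈ M.states ∧ p.2.action ∈ M.enabled p.2.state}
    have hE : MeasurableSet E := MeasurableSet.of_discrete
    have hstep : ∀ᵐ ω ∂(pathMeasure σ s), ∀ᵐ y ∂(σ.kernel n (past n ω)), (past n ω, y) ∈ E := ?_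
    · have := ae_trajMeasure_succ ((σ.choose [] s).map (Move.mk s)).toMeasure σ.kernel n hE hstep
      change ∀ᵐ ω ∂(pathMeasure σ s), _ at this
      filter_upwards [this] with ω hω using hω
    filter_upwards [ih] with ω hω
    change ∀ᵐ y ∂(PMF.toMeasure _), _
    rw [ae_iff, PMF.toMeasure_apply_eq_zero_iff _ (MeasurableSet.of_discrete), Set.disjoint_left]
    intro m hm hm'
    rw [PMF.mem_support_bind_iff] at hm
    obtain ⟨t, ht, hm⟩ := hm
    rw [PMF.mem_support_map_iff] at hm
    obtain ⟨b, hb, rfl⟩ := hm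
    have hts := hM.support_subset _ hω.1 _ hω.2 ht
    exact hm' ⟨hts, σ.support_subset _ _ hts hb⟩

theorem tsum_mul_le_of_forall {Y : Type*} (p : PMF Y) {f : Y → ℝ≥0∞} {c : ℝ≥0∞}
    (h : ∀ y ∈ p.support, f y ≤ c) : ∑' y, p y * f y ≤ c := by
  calc ∑' y, p y * f y ≤ ∑' y, p y * c := ENNReal.tsum_le_tsum fun y => by
        by_cases hy : p y = 0
        · simp [hy]
        · gcongr
          exact h y ((PMF.mem_support_iff _ _).2 hy)
    _ = c := by rw [ENNReal.tsum_mul_right, PMF.tsum_coe, one_mul]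

omit [Finite S] [Finite A] in
theorem reach_eq_iUnion (F : Set S) :
    (reach F : Set (ℕ → Move S A)) = ⋃ n, {ω | Hit F (past n ω)} := by
  ext ω
  simp only [reach, Set.mem_ofPred_eq, Set.mem_iUnion]
  constructor
  · rintro ⟨n, hn⟩
    exact ⟨n, ⟨n, Finset.mem_Iic.2 le_rfl⟩, hn⟩
  · rintro ⟨n, i, hi⟩
    exact ⟨i, hi⟩

omit [Finite S] [Finite A] in
theorem hit_mono (F : Set S) (ω : ℕ → Move S A) {m n : ℕ} (h : m ≤ n)
    (hm : Hit F (past m ω)) : Hit F (past n ω) := by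
  obtain ⟨⟨i, hi⟩, hi'⟩ := hm
  exact ⟨⟨i, Finset.mem_Iic.2 ((Finset.mem_Iic.1 hi).trans h)⟩, hi'⟩

theorem measurableSet_hit (F : Set S) (n : ℕ) :
    MeasurableSet {ω : ℕ → Move S A | Hit F (past n ω)} :=
  (Preorder.measurable_frestrictLe (X := fun _ => Move S A) n)
    (MeasurableSet.of_discrete (s := {h : (i : Finset.Iic n) → Move S A | Hit F h}))

theorem lintegral_hit_indicator {M : MDP S A} (σ : Strategy M) (s : S) (F : Set S) (n : ℕ) :
    ∫⁻ ω, (if Hit F (past n ω) then 1 else 0) ∂(pathMeasure σ s) =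
      pathMeasure σ s {ω | Hit F (past n ω)} := by
  rw [← lintegral_indicator_one (measurableSet_hit F n)]
  rfl

/-- No strategy does better than a pre-fixed point of the Bellman operator. -/
theorem pathMeasure_reach_le {M : MDP S A} (hM : M.IsValid) {F : Set S} {W : S → ℝ≥0∞}
    (hF : ∀ s ∈ M.states, s ∈ F → 1 ≤ W s)
    (hW : ∀ s ∈ M.states, s ∉ F → ∀ a ∈ M.enabled s, ∑' t, M.trans s a t * W t ≤ W s)
    (σ : Strategy M) {s : S} (hs : s ∈ M.states) : pathMeasure σ s (reach F) ≤ W s := by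
  -- Letter `n` already contains its action, so the supermartingale is 1 after a hit and otherwise
  -- the mean of `W` after that action, not `W` at the state.
  let Q : Move S A → ℝ≥0∞ := fun m => ∑' t, M.trans m.state m.action t * W t
  have hQ : ∀ t ∈ M.states, ∀ w, ∑' b, σ.choose w t b * (if t ∈ F then 1 else Q ⟨t, b⟩) ≤ W t := by
    intro t ht w
    refine tsum_mul_le_of_forall _ fun b hb => ?_
    split_ifs with htF
    · exact hF t ht htF
    · exact hW t ht htF b (σ.support_subset w t ht hb)
  have hZ : ∀ n, ∫⁻ ω, (if Hit F (past n ω) then 1 else Q (ω n)) ∂(pathMeasure σ s) ≤ W s := by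
    intro n
    induction n with
    | zero => rw [lintegral_hit_zero]; exact hQ s hs []
    | succ n ih =>
      rw [lintegral_hit_succ]
      refine le_trans (lintegral_mono_ae ?_) ih
      filter_upwards [ae_valid hM σ hs] with ω hω
      split_ifs
      · exact le_rfl
      · refine ENNReal.tsum_le_tsum fun t => ?_
        by_cases ht : M.trans (ω n).state (ω n).action t = 0
        · simp [ht]
        · gcongr
          exact hQ t (hM.support_subset _ (hω n).1 _ (hω n).2 ((PMF.mem_support_iff _ _).2 ht)) _
  have hmono : Monotone fun n => {ω : ℕ → Move S A | Hit F (past n ω)} :=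
    fun m n hmn ω hω => hit_mono F ω hmn hω
  rw [reach_eq_iUnion, hmono.measure_iUnion]
  refine iSup_le fun n => ?_
  rw [← lintegral_hit_indicator]
  refine le_trans (lintegral_mono fun ω => ?_) (hZ n)
  dsimp only
  split_ifs <;> simp

/-- The `n`-step values of a state-action pair. -/
def actionIter (M : MDP S A) (F : Set S) : ℕ → Move S A → ℝ≥0∞
  | 0, _ => 0
  | n + 1, m => ∑' t, M.trans m.state m.action t * valueIter M F n t

omit [Finite S] [Finite A] in
-- The implications make the statement true for every `s`, so that a total choice function, and from
-- it a strategy, can be extracted.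
theorem exists_action_valueIter_le [Nonempty A] {M : MDP S A} (hM : M.IsValid) (F : Set S)
    (n : ℕ) (s : S) : ∃ a, (s ∈ M.states → a ∈ M.enabled s) ∧
      (s ∉ F → valueIter M F n s ≤ actionIter M F n ⟨s, a⟩) := by
  by_cases hE : (M.enabled s).Nonempty
  · cases n with
    | zero =>
      obtain ⟨a, ha⟩ := hE
      exact ⟨a, fun _ => ha, fun hs => by simp [valueIter, hs]⟩
    | succ n =>
      obtain ⟨a, ha, hmax⟩ := (M.enabled s).exists_max_image
        (fun a => actionIter M F (n + 1) ⟨s, a⟩) hE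
      refine ⟨a, fun _ => ha, fun hs => ?_⟩
      rw [valueIter, if_neg hs]
      exact iSup₂_le fun b hb => hmax b hb
  · refine ⟨Classical.arbitrary A, fun hs => absurd (hM.enabled_nonempty s hs) hE, fun hs => ?_⟩
    rw [Finset.not_nonempty_iff_eq_empty] at hE
    cases n with
    | zero => simp [valueIter, hs]
    | succ n => simp [valueIter, hs, hE]

omit [Finite S] [Finite A] in
theorem length_prefixList {n : ℕ} (h : (i : Finset.Iic n) → Move S A) :
    (prefixList h).length = n + 1 := by
  simp [prefixList]

/-- Some strategy attains the `N`-step value. -/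
theorem exists_valueIter_le_pathMeasure {M : MDP S A} (hM : M.IsValid) (F : Set S) (N : ℕ)
    (s : S) : ∃ σ : Strategy M, valueIter M F N s ≤ pathMeasure σ s (reach F) := by
  have : Nonempty A := ⟨(hM.enabled_nonempty _ hM.start_mem).choose⟩
  choose opt hopt hopt' using exists_action_valueIter_le hM F
  -- After `w.length` letters the strategy plays an optimal action for the remaining horizon.
  let σ : Strategy M :=
    { choose := fun w t => PMF.pure (opt (N - w.length) t)
      support_subset := fun w t ht => by
        rw [PMF.support_pure, Set.singleton_subset_iff]
        exact hopt _ t ht }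
  have hQ : ∀ t w, valueIter M F (N - w.length) t ≤
      ∑' b, σ.choose w t b * (if t ∈ F then 1 else actionIter M F (N - w.length) ⟨t, b⟩) := by
    intro t w
    rw [tsum_eq_single (opt (N - w.length) t)]
    · have : σ.choose w t (opt (N - w.length) t) = 1 := by simp [σ]
      rw [this, one_mul]
      split_ifs with ht
      · exact valueIter_le_one _ _ _ _
      · exact hopt' _ _ ht
    · intro b hb
      have : σ.choose w t b = 0 := by simp [σ, PMF.pure_apply, hb]
      rw [this, zero_mul]
  -- The expected remaining value does not decrease along the optimal actions. At `n = N` the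
  -- remainder `actionIter` is 0, and the integral is the probability of a hit.
  have hY : ∀ n, n ≤ N → valueIter M F N s ≤
      ∫⁻ ω, (if Hit F (past n ω) then 1 else actionIter M F (N - n) (ω n)) ∂(pathMeasure σ s) := by
    intro n
    induction n with
    | zero =>
      intro _
      rw [lintegral_hit_zero]
      exact hQ s []
    | succ n ih =>
      intro hn
      rw [lintegral_hit_succ]
      refine (ih (by omega)).trans (lintegral_mono fun ω => ?_)
      dsimp only
      split_ifs
      · exact le_rfl
      · obtain ⟨j, hj⟩ : ∃ j, N - n = j + 1 := ⟨N - n - 1, by omega⟩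
        have hj' : N - (n + 1) = j := by omega
        rw [hj, hj', actionIter]
        refine ENNReal.tsum_le_tsum fun t => ?_
        gcongr
        have := hQ t (prefixList (past n ω))
        rwa [length_prefixList, hj'] at this
  refine ⟨σ, (hY N le_rfl).trans ?_⟩
  rw [Nat.sub_self]
  simp only [actionIter]
  rw [lintegral_hit_indicator]
  refine measure_mono fun ω hω => ?_
  rw [reach_eq_iUnion]
  exact Set.mem_iUnion.2 ⟨N, hω⟩

/-- The limit of value iteration is itself a pre-fixed point, so no strategy beats it, and each of
its approximants is achieved by some strategy. -/
theorem value_eq {M : MDP S A} (hM : M.IsValid) (F : Set S) {s : S} (hs : s ∈ M.states) :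
    value M F s = (valueLim M F s).toReal := by
  rw [value]
  congr 1
  refine le_antisymm (iSup_le fun σ => ?_) (iSup_le fun n => ?_)
  · exact pathMeasure_reach_le hM (fun s _ hsF => (valueLim_of_mem M hsF).ge)
      (fun s _ hsF a ha => tsum_trans_mul_valueLim_le M hsF ha) σ hs
  · obtain ⟨σ, hσ⟩ := exists_valueIter_le_pathMeasure hM F n s
    exact hσ.trans (le_iSup (fun σ : Strategy M => pathMeasure σ s (reach F)) σ)

theorem value_nonneg (M : MDP S A) (F : Set S) (s : S) : 0 ≤ value M F s := ENNReal.toReal_nonneg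

theorem value_le_one {M : MDP S A} (hM : M.IsValid) (F : Set S) {s : S} (hs : s ∈ M.states) :
    value M F s ≤ 1 := by
  rw [value_eq hM F hs]
  exact ENNReal.toReal_le_of_le_ofReal zero_le_one (by simpa using valueLim_le_one M F s)

theorem value_of_mem {M : MDP S A} (hM : M.IsValid) {F : Set S} {s : S} (hs : s ∈ M.states)
    (hsF : s ∈ F) : value M F s = 1 := by
  rw [value_eq hM F hs, valueLim_of_mem M hsF, ENNReal.toReal_one]

omit [Finite S] [Finite A] in
theorem sum_trans_eq_toReal_tsum {M : MDP S A} (hM : M.IsValid) {s : S} (hs : s ∈ M.states) {a : A}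
    (ha : a ∈ M.enabled s) (W : S → ℝ≥0∞) (hW : ∀ t ∈ M.states, W t ≠ ⊤) :
    ∑ t ∈ M.states, (M.trans s a t).toReal * (W t).toReal = (∑' t, M.trans s a t * W t).toReal := by
  have h0 : ∀ t ∉ M.states, M.trans s a t * W t = 0 := by
    intro t ht
    have : M.trans s a t = 0 := by
      by_contra hc
      exact ht (hM.support_subset s hs a ha ((PMF.mem_support_iff _ _).2 hc))
    rw [this, zero_mul]
  rw [tsum_eq_sum (s := M.states) fun t ht => h0 t ht, ENNReal.toReal_sum]
  · simp_rw [ENNReal.toReal_mul]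
  · exact fun t ht => ENNReal.mul_ne_top (PMF.apply_ne_top _ _) (hW t ht)

theorem actionValue_le_value {M : MDP S A} (hM : M.IsValid) (F : Set S) {s : S}
    (hs : s ∈ M.states) {a : A} (ha : a ∈ M.enabled s) : actionValue M F s a ≤ value M F s := by
  have h1 : actionValue M F s a = (∑' t, M.trans s a t * valueLim M F t).toReal := by
    rw [← sum_trans_eq_toReal_tsum hM hs ha _
      fun t _ => ne_top_of_le_ne_top ENNReal.one_ne_top (valueLim_le_one M F t)]
    exact Finset.sum_congr rfl fun t ht => by rw [value_eq hM F ht]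
  rw [value_eq hM F hs, h1]
  refine ENNReal.toReal_mono
    (ne_top_of_le_ne_top ENNReal.one_ne_top (valueLim_le_one M F s)) ?_
  by_cases hsF : s ∈ F
  · rw [valueLim_of_mem M hsF]
    exact tsum_mul_le_of_forall _ fun t _ => valueLim_le_one M F t
  · exact tsum_trans_mul_valueLim_le M hsF ha

/-- The value is the least pre-fixed point of the Bellman operator. -/
theorem value_le_of_supersolution {M : MDP S A} (hM : M.IsValid) {F : Set S} {W : S → ℝ}
    (h0 : ∀ s ∈ M.states, 0 ≤ W s) (hF : ∀ s ∈ M.states, s ∈ F → 1 ≤ W s)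
    (hW : ∀ s ∈ M.states, s ∉ F → ∀ a ∈ M.enabled s,
      ∑ t ∈ M.states, (M.trans s a t).toReal * W t ≤ W s) {s : S} (hs : s ∈ M.states) :
    value M F s ≤ W s := by
  have key : valueLim M F s ≤ ENNReal.ofReal (W s) := by
    refine iSup_le fun n => valueIter_le_of_supersolution hM (W := fun s => ENNReal.ofReal (W s))
      (fun t ht htF => ?_) (fun t ht htF a ha => ?_) n s hs
    · simpa using hF t ht htF
    · have := sum_trans_eq_toReal_tsum hM ht ha (fun s => ENNReal.ofReal (W s))
        fun t _ => ENNReal.ofReal_ne_top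
      rw [← ENNReal.ofReal_toReal (a := ∑' t', M.trans t a t' * ENNReal.ofReal (W t')), ← this]
      · refine ENNReal.ofReal_le_ofReal (le_trans (le_of_eq ?_) (hW t ht htF a ha))
        exact Finset.sum_congr rfl fun t' ht' => by rw [ENNReal.toReal_ofReal (h0 t' ht')]
      · have := Fintype.ofFinite S
        rw [tsum_fintype]
        exact ENNReal.sum_ne_top.2 fun t' _ =>
          ENNReal.mul_ne_top (PMF.apply_ne_top _ _) ENNReal.ofReal_ne_top
  rw [value_eq hM F hs]
  exact ENNReal.toReal_le_of_le_ofReal (h0 s hs) key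

end Value

/-! ### Quotients by end components: the Bellman equation survives -/

section Quotient

open scoped ENNReal

universe u v
variable {S : Type u} {A : Type v}

/-! ### Expectations and maxima -/

/-- The expectation of `f` after the action `a` in the state `s`. -/
def MDP.mean (M : MDP S A) (s : S) (a : A) (f : S → ℝ) : ℝ :=
  ∑ t ∈ M.states, (M.trans s a t).toReal * f t

theorem MDP.IsValid.mem_states {M : MDP S A} (hM : M.IsValid) {s : S} (hs : s ∈ M.states) {a : A}
    (ha : a ∈ M.enabled s) {t : S} (ht : M.trans s a t ≠ 0) : t ∈ M.states :=
  hM.support_subset s hs a ha ((PMF.mem_support_iff _ _).2 ht)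

theorem MDP.mean_mono {M : MDP S A} {s : S} {a : A} {f g : S → ℝ}
    (h : ∀ t ∈ M.states, M.trans s a t ≠ 0 → f t ≤ g t) : M.mean s a f ≤ M.mean s a g := by
  refine Finset.sum_le_sum fun t ht => ?_
  by_cases h0 : M.trans s a t = 0
  · simp [h0]
  · exact mul_le_mul_of_nonneg_left (h t ht h0) ENNReal.toReal_nonneg

theorem MDP.mean_congr {M : MDP S A} {s : S} {a : A} {f g : S → ℝ}
    (h : ∀ t ∈ M.states, M.trans s a t ≠ 0 → f t = g t) : M.mean s a f = M.mean s a g :=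
  le_antisymm (MDP.mean_mono fun t ht h0 => (h t ht h0).le)
    (MDP.mean_mono fun t ht h0 => (h t ht h0).ge)

theorem MDP.IsValid.mean_const {M : MDP S A} (hM : M.IsValid) {s : S} (hs : s ∈ M.states) {a : A}
    (ha : a ∈ M.enabled s) (c : ℝ) : M.mean s a (fun _ => c) = c := by
  rw [MDP.mean, ← Finset.sum_mul]
  have h1 : ∑ t ∈ M.states, M.trans s a t = 1 := by
    rw [← PMF.tsum_coe (M.trans s a), tsum_eq_sum]
    intro t ht
    by_contra h
    exact ht (hM.mem_states hs ha h)
  rw [← ENNReal.toReal_sum fun t _ => PMF.apply_ne_top _ _, h1, ENNReal.toReal_one, one_mul]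

theorem MDP.IsValid.mean_le {M : MDP S A} (hM : M.IsValid) {s : S} (hs : s ∈ M.states) {a : A}
    (ha : a ∈ M.enabled s) {f : S → ℝ} {c : ℝ}
    (h : ∀ t ∈ M.states, M.trans s a t ≠ 0 → f t ≤ c) : M.mean s a f ≤ c :=
  (MDP.mean_mono h).trans_eq (hM.mean_const hs ha c)

theorem MDP.IsValid.le_mean {M : MDP S A} (hM : M.IsValid) {s : S} (hs : s ∈ M.states) {a : A}
    (ha : a ∈ M.enabled s) {f : S → ℝ} {c : ℝ}
    (h : ∀ t ∈ M.states, M.trans s a t ≠ 0 → c ≤ f t) : c ≤ M.mean s a f :=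
  (hM.mean_const hs ha c).symm.trans_le (MDP.mean_mono h)

theorem MDP.IsValid.mean_eq {M : MDP S A} (hM : M.IsValid) {s : S} (hs : s ∈ M.states) {a : A}
    (ha : a ∈ M.enabled s) {f : S → ℝ} {c : ℝ}
    (h : ∀ t ∈ M.states, M.trans s a t ≠ 0 → f t = c) : M.mean s a f = c :=
  le_antisymm (hM.mean_le hs ha fun t ht h0 => (h t ht h0).le)
    (hM.le_mean hs ha fun t ht h0 => (h t ht h0).ge)

theorem MDP.mean_sub (M : MDP S A) (s : S) (a : A) (f g : S → ℝ) :
    M.mean s a (fun t => f t - g t) = M.mean s a f - M.mean s a g := by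
  simp only [MDP.mean, mul_sub, Finset.sum_sub_distrib]

/-- If `f ≤ c` at all successors and the mean of `f` is at least `c`, then `f = c` at all
successors. -/
theorem MDP.IsValid.eq_of_le_mean {M : MDP S A} (hM : M.IsValid) {s : S} (hs : s ∈ M.states)
    {a : A} (ha : a ∈ M.enabled s) {f : S → ℝ} {c : ℝ}
    (h : ∀ t ∈ M.states, M.trans s a t ≠ 0 → f t ≤ c) (hc : c ≤ M.mean s a f) {t : S}
    (ht : M.trans s a t ≠ 0) : f t = c := by
  have h1 : M.mean s a (fun t => c - f t) = 0 := by
    rw [MDP.mean_sub, hM.mean_const hs ha]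
    linarith [hM.mean_le hs ha h]
  have h2 : ∀ t ∈ M.states, 0 ≤ (M.trans s a t).toReal * (c - f t) := by
    intro t ht
    by_cases h0 : M.trans s a t = 0
    · simp [h0]
    · exact mul_nonneg ENNReal.toReal_nonneg (sub_nonneg.2 (h t ht h0))
  have h3 := (Finset.sum_eq_zero_iff_of_nonneg h2).1 h1 t (hM.mem_states hs ha ht)
  rcases mul_eq_zero.1 h3 with h4 | h4
  · rw [ENNReal.toReal_eq_zero_iff] at h4
    exact absurd h4 (not_or.2 ⟨ht, PMF.apply_ne_top _ _⟩)
  · linarith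

theorem MDP.IsValid.eq_of_mean_le {M : MDP S A} (hM : M.IsValid) {s : S} (hs : s ∈ M.states)
    {a : A} (ha : a ∈ M.enabled s) {f : S → ℝ} {c : ℝ}
    (h : ∀ t ∈ M.states, M.trans s a t ≠ 0 → c ≤ f t) (hc : M.mean s a f ≤ c) {t : S}
    (ht : M.trans s a t ≠ 0) : f t = c := by
  have hneg : M.mean s a (fun t => - f t) = - M.mean s a f := by
    simp [MDP.mean]
  have := hM.eq_of_le_mean hs ha (f := fun t => - f t) (c := -c)
    (fun t ht h0 => neg_le_neg (h t ht h0)) (by rw [hneg]; linarith) ht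
  linarith

theorem pmf_map_apply_ne_zero_iff {Y Z : Type*} (p : PMF Y) (g : Y → Z) (z : Z) :
    p.map g z ≠ 0 ↔ ∃ y, p y ≠ 0 ∧ g y = z := by
  rw [← PMF.mem_support_iff, PMF.mem_support_map_iff]
  rfl

theorem sum_map_mul [Finite S] (p : PMF S) (g : S → S) (f : S → ℝ) (X Y : Finset S)
    (hX : ∀ x, p x ≠ 0 → x ∈ X) (hY : ∀ x, p x ≠ 0 → g x ∈ Y) :
    ∑ y ∈ Y, (p.map g y).toReal * f y = ∑ x ∈ X, (p x).toReal * f (g x) := by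
  have := Fintype.ofFinite S
  have h1 : ∑ y ∈ Y, (p.map g y).toReal * f y = ∑ y, (p.map g y).toReal * f y := by
    refine Finset.sum_subset (Finset.subset_univ _) fun y _ hy => ?_
    have : p.map g y = 0 := by
      by_contra h
      obtain ⟨x, hx, rfl⟩ := (pmf_map_apply_ne_zero_iff p g y).1 h
      exact hy (hY x hx)
    simp [this]
  have h2 : ∑ x ∈ X, (p x).toReal * f (g x) = ∑ x, (p x).toReal * f (g x) := by
    refine Finset.sum_subset (Finset.subset_univ _) fun x _ hx => ?_
    have : p x = 0 := by
      by_contra h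
      exact hx (hX x h)
    simp [this]
  rw [h1, h2]
  have h3 : ∀ y, (p.map g y).toReal = ∑ x, if y = g x then (p x).toReal else 0 := by
    intro y
    rw [PMF.map_apply, tsum_fintype, ENNReal.toReal_sum]
    · refine Finset.sum_congr rfl fun x _ => ?_
      split_ifs <;> simp
    · intro x _
      split_ifs
      · exact PMF.apply_ne_top _ _
      · simp
  simp_rw [h3, Finset.sum_mul]
  rw [Finset.sum_comm]
  refine Finset.sum_congr rfl fun x _ => ?_
  simp

theorem MDP.mean_of_map [Finite S] {M M' : MDP S A} {x y : S} {a : A} {g : S → S}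
    (h : M'.trans y a = (M.trans x a).map g) (hX : ∀ t, M.trans x a t ≠ 0 → t ∈ M.states)
    (hY : ∀ t ∈ M.states, g t ∈ M'.states) (f : S → ℝ) :
    M'.mean y a f = M.mean x a (fun t => f (g t)) := by
  rw [MDP.mean, h]
  exact sum_map_mul _ _ _ _ _ hX fun t ht => hY t (hX t ht)

theorem MDP.le_best (M : MDP S A) (f : S → A → ℝ) {s : S} {a : A} (ha : a ∈ M.enabled s) :
    f s a ≤ M.best f s := by
  rw [MDP.best, dif_pos ⟨a, ha⟩]
  exact Finset.le_sup' (f s) ha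

theorem MDP.exists_eq_best (M : MDP S A) (f : S → A → ℝ) {s : S} (h : (M.enabled s).Nonempty) :
    ∃ a ∈ M.enabled s, f s a = M.best f s := by
  obtain ⟨a, ha, hs⟩ := Finset.exists_mem_eq_sup' h (f s)
  exact ⟨a, ha, by rw [MDP.best, dif_pos h, hs]⟩

theorem MDP.best_le (M : MDP S A) {f : S → A → ℝ} {s : S} (h : (M.enabled s).Nonempty) {c : ℝ}
    (hc : ∀ a ∈ M.enabled s, f s a ≤ c) : M.best f s ≤ c := by
  obtain ⟨a, ha, hs⟩ := M.exists_eq_best f h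
  rw [← hs]
  exact hc a ha

theorem MDP.best_mono (M : MDP S A) {f g : S → A → ℝ} {s : S}
    (h : ∀ a ∈ M.enabled s, f s a ≤ g s a) : M.best f s ≤ M.best g s := by
  by_cases hE : (M.enabled s).Nonempty
  · exact M.best_le hE fun a ha => (h a ha).trans (M.le_best g ha)
  · rw [MDP.best, MDP.best, dif_neg hE, dif_neg hE]

/-! ### Quotients of an MDP -/

/-- The standing assumptions on the MDP, the target set and the two terminal states. -/
structure Setting [Finite S] [Finite A] (M : MDP S A) (F : Set S) (one zero : S) : Prop where
  valid : M.IsValid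
  one_mem : one ∈ M.states
  zero_mem : zero ∈ M.states
  ne : one ≠ zero
  one_terminal : M.IsTerminal one
  zero_terminal : M.IsTerminal zero
  one_target : one ∈ F
  zero_target : zero ∉ F
  target : ∀ s ∈ M.states, s ∈ F → ∃ a ∈ M.enabled s, actionValue M F s a = 1

/-- `M'` arises from `M` by successively collapsing end components; `proj` sends a state of `M` to
the state of `M'` that it has been merged into. -/
structure IsQuotient [Finite S] [Finite A] (M : MDP S A) (F : Set S) (one zero : S)
    (M' : MDP S A) (proj : S → S) : Prop where
  states_subset : M'.states ⊆ M.states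
  one_mem : one ∈ M'.states
  zero_mem : zero ∈ M'.states
  proj_mem : ∀ s ∈ M.states, proj s ∈ M'.states
  proj_self : ∀ s ∈ M'.states, proj s = s
  start_eq : M'.start = proj M.start
  exists_owner : ∀ s ∈ M'.states, ∀ a ∈ M'.enabled s, ∃ x ∈ M.states, proj x = s ∧
    a ∈ M.enabled x ∧ M'.trans s a = (M.trans x a).map proj
  removed : ∀ x ∈ M.states, ∀ a ∈ M.enabled x, a ∈ M'.enabled (proj x) ∨
    ((∀ t, M.trans x a t ≠ 0 → proj t = proj x) ∧ proj x ∉ F) ∨ proj x = one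
  value_proj : ∀ x ∈ M.states, value M F (proj x) = value M F x
  target : ∀ f ∈ M.states, f ∈ F → proj f = f ∨ proj f = one
  enabled_nonempty : ∀ s ∈ M'.states, (M'.enabled s).Nonempty
  one_enabled : ∀ a ∈ M'.enabled one, a ∈ M.enabled one
  zero_enabled : ∀ a ∈ M'.enabled zero, a ∈ M.enabled zero

variable [Finite S] [Finite A] {M M' : MDP S A} {F : Set S} {one zero : S} {proj : S → S}

theorem IsQuotient.refl (hS : Setting M F one zero) : IsQuotient M F one zero M id where
  states_subset := fun _ h => h
  one_mem := hS.one_mem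
  zero_mem := hS.zero_mem
  proj_mem := fun _ h => h
  proj_self := fun _ _ => rfl
  start_eq := rfl
  exists_owner := fun s hs _ ha => ⟨s, hs, rfl, ha, (PMF.map_id _).symm⟩
  removed := fun _ _ _ h => Or.inl h
  value_proj := fun _ _ => rfl
  target := fun _ _ _ => Or.inl rfl
  enabled_nonempty := hS.valid.enabled_nonempty
  one_enabled := fun _ h => h
  zero_enabled := fun _ h => h

namespace MDP.IsValid

omit [Finite S] [Finite A] in
theorem eq_of_mem_enabled (hM : M.IsValid) {s t : S} (hs : s ∈ M.states) (ht : t ∈ M.states)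
    {a : A} (has : a ∈ M.enabled s) (hat : a ∈ M.enabled t) : s = t := by
  by_contra h
  exact Finset.disjoint_left.1 (hM.enabled_disjoint s hs t ht h) has hat

end MDP.IsValid

namespace IsQuotient

theorem isValid (hS : Setting M F one zero) (hq : IsQuotient M F one zero M' proj) :
    M'.IsValid where
  start_mem := hq.start_eq ▸ hq.proj_mem _ hS.valid.start_mem
  enabled_nonempty := hq.enabled_nonempty
  support_subset := by
    intro s hs a ha t ht
    obtain ⟨x, hx, rfl, hax, htr⟩ := hq.exists_owner s hs a ha
    rw [htr, PMF.mem_support_map_iff] at ht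
    obtain ⟨t', ht', rfl⟩ := ht
    exact hq.proj_mem _ (hS.valid.support_subset x hx a hax ht')
  enabled_disjoint := by
    intro s hs t ht hst
    rw [Finset.disjoint_left]
    intro a has hat
    obtain ⟨x, hx, rfl, hax, -⟩ := hq.exists_owner s hs a has
    obtain ⟨y, hy, rfl, hay, -⟩ := hq.exists_owner t ht a hat
    exact hst (by rw [hS.valid.eq_of_mem_enabled hx hy hax hay])

/-- An action is enabled in only one state of M, so the owner that the quotient provides must be
`x`. -/
theorem trans_eq (hS : Setting M F one zero) (hq : IsQuotient M F one zero M' proj) {x : S}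
    (hx : x ∈ M.states) {a : A} (ha : a ∈ M.enabled x) (ha' : a ∈ M'.enabled (proj x)) :
    M'.trans (proj x) a = (M.trans x a).map proj := by
  obtain ⟨y, hy, hyx, hay, htr⟩ := hq.exists_owner _ (hq.proj_mem x hx) a ha'
  rw [hS.valid.eq_of_mem_enabled hx hy ha hay, ← htr, hyx]

theorem mean_eq (hS : Setting M F one zero) (hq : IsQuotient M F one zero M' proj) {x : S}
    (hx : x ∈ M.states) {a : A} (ha : a ∈ M.enabled x) (ha' : a ∈ M'.enabled (proj x))
    (f : S → ℝ) : M'.mean (proj x) a f = M.mean x a (fun t => f (proj t)) :=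
  MDP.mean_of_map (hq.trans_eq hS hx ha ha') (fun _ ht => hS.valid.mem_states hx ha ht)
    hq.proj_mem f

/-- Since V is constant on the classes, V(x, a) can be computed in the quotient. The quotient's own
value function is never needed. -/
theorem mean_value_eq (hS : Setting M F one zero) (hq : IsQuotient M F one zero M' proj) {x : S}
    (hx : x ∈ M.states) {a : A} (ha : a ∈ M.enabled x) (ha' : a ∈ M'.enabled (proj x)) :
    M'.mean (proj x) a (value M F) = actionValue M F x a := by
  rw [hq.mean_eq hS hx ha ha']
  exact MDP.mean_congr fun t ht _ => hq.value_proj t ht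

theorem value_le_one (hS : Setting M F one zero) (hq : IsQuotient M F one zero M' proj) {s : S}
    (hs : s ∈ M'.states) : value M F s ≤ 1 :=
  OBRTDP.value_le_one hS.valid F (hq.states_subset hs)

theorem mean_value_le (hS : Setting M F one zero) (hq : IsQuotient M F one zero M' proj) {s : S}
    (hs : s ∈ M'.states) {a : A} (ha : a ∈ M'.enabled s) :
    M'.mean s a (value M F) ≤ value M F s := by
  obtain ⟨x, hx, rfl, hax, -⟩ := hq.exists_owner s hs a ha
  rw [hq.mean_value_eq hS hx hax ha, hq.value_proj x hx]
  exact actionValue_le_value hS.valid F hx hax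

theorem value_one (hS : Setting M F one zero) : value M F one = 1 :=
  value_of_mem hS.valid hS.one_mem hS.one_target

/-- The indicator of the complement of `zero` is a pre-fixed point, because `zero` is absorbing and
not a target. -/
theorem value_zero (hS : Setting M F one zero) : value M F zero = 0 := by
  refine le_antisymm ?_ (value_nonneg _ _ _)
  have := value_le_of_supersolution hS.valid (F := F) (W := fun s => if s = zero then 0 else 1)
    (fun s _ => by split_ifs <;> norm_num)
    (fun s _ hs => by
      have : s ≠ zero := fun h => hS.zero_target (h ▸ hs)
      simp [this])
    (fun s hs _ a ha => by
      by_cases hsz : s = zero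
      · rw [if_pos hsz]
        refine hS.valid.mean_le hs ha fun t _ ht0 => ?_
        subst hsz
        have h1 := (PMF.apply_eq_one_iff _ _).1 (hS.zero_terminal a ha)
        have : t ∈ (M.trans s a).support := (PMF.mem_support_iff _ _).2 ht0
        rw [h1] at this
        rw [if_pos (Set.mem_singleton_iff.1 this)]
      · rw [if_neg hsz]
        refine hS.valid.mean_le hs ha fun t _ _ => ?_
        split_ifs <;> norm_num) hS.zero_mem
  simpa using this

/-- A set without target states in which the value is constant and which no action leaves without
loss has value zero. -/
theorem value_le_zero_of_closed (hS : Setting M F one zero) (hq : IsQuotient M F one zero M' proj)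
    {R : Finset S} (hR : R ⊆ M'.states) (hone : one ∉ R) (hRF : ∀ s ∈ R, s ∉ F) {v : ℝ}
    (hv : ∀ s ∈ R, value M F s = v)
    (hstep : ∀ s ∈ R, ∀ a ∈ M'.enabled s,
      (∀ t, M'.trans s a t ≠ 0 → t ∈ R) ∨ M'.mean s a (value M F) < v)
    {s : S} (hs : s ∈ R) : v ≤ 0 := by
  by_contra hpos
  push Not at hpos
  -- Only finitely many means lie strictly below `v`, so a single δ is lost by all of them; `δ ≤ v`
  -- keeps the function `W` below nonnegative.
  obtain ⟨δ, hδ, hδv, hδ'⟩ : ∃ δ : ℝ, 0 < δ ∧ δ ≤ v ∧ ∀ s ∈ R, ∀ a ∈ M'.enabled s,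
      M'.mean s a (value M F) < v → M'.mean s a (value M F) ≤ v - δ := by
    let P := (R.biUnion fun s => (M'.enabled s).image fun a => M'.mean s a (value M F)).filter
      (· < v)
    by_cases hP : P.Nonempty
    · have hm := P.max'_mem hP
      have hmv : P.max' hP < v := (Finset.mem_filter.1 hm).2
      refine ⟨min v (v - P.max' hP), lt_min hpos (by linarith), min_le_left _ _, ?_⟩
      intro s hs a ha hlt
      have : M'.mean s a (value M F) ≤ P.max' hP := P.le_max' _
        (Finset.mem_filter.2 ⟨Finset.mem_biUnion.2 ⟨s, hs, Finset.mem_image.2 ⟨a, ha, rfl⟩⟩, hlt⟩)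
      linarith [min_le_right v (v - P.max' hP)]
    · refine ⟨v, hpos, le_rfl, fun s hs a ha hlt => ?_⟩
      exact absurd ⟨_, Finset.mem_filter.2
        ⟨Finset.mem_biUnion.2 ⟨s, hs, Finset.mem_image.2 ⟨a, ha, rfl⟩⟩, hlt⟩⟩ hP
  -- Lowering V by δ on the classes of `R` gives a smaller pre-fixed point, against leastness. A
  -- surviving action stays in `R` or loses at least δ; an action that was removed as internal stays
  -- in its class; the class of `one` is not in `R`; no target is projected into `R`.
  let W : S → ℝ := fun x => if proj x ∈ R then value M F x - δ else value M F x
  have hWle : ∀ x, W x ≤ value M F x := by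
    intro x
    simp only [W]
    split_ifs
    · linarith
    · exact le_rfl
  have hWR : ∀ x ∈ M.states, proj x ∈ R → W x = v - δ := by
    intro x hx hxR
    simp only [W]
    rw [if_pos hxR, ← hq.value_proj x hx, hv _ hxR]
  have key := value_le_of_supersolution hS.valid (F := F) (W := W)
    (fun x hx => by
      by_cases hxR : proj x ∈ R
      · rw [hWR x hx hxR]; linarith
      · simp only [W]
        rw [if_neg hxR]
        exact value_nonneg _ _ _)
    (fun x hx hxF => by
      have hxR : proj x ∉ R := by
        rcases hq.target x hx hxF with h | h
        · rw [h]; exact fun hR' => hRF x hR' hxF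
        · rw [h]; exact hone
      simp only [W]
      rw [if_neg hxR, value_of_mem hS.valid hx hxF])
    (fun x hx _ a ha => by
      change M.mean x a W ≤ W x
      by_cases hxR : proj x ∈ R
      · rw [hWR x hx hxR]
        have hin : (∀ t, M.trans x a t ≠ 0 → proj t ∈ R) → M.mean x a W ≤ v - δ := fun h =>
          hS.valid.mean_le hx ha fun t ht ht0 => (hWR t ht (h t ht0)).le
        rcases hq.removed x hx a ha with h | h | h
        · rcases hstep _ hxR a h with h' | h'
          · refine hin fun t ht => h' _ ?_
            rw [hq.trans_eq hS hx ha h, pmf_map_apply_ne_zero_iff]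
            exact ⟨t, ht, rfl⟩
          · calc M.mean x a W ≤ M.mean x a (value M F) := MDP.mean_mono fun t _ _ => hWle t
              _ = M'.mean (proj x) a (value M F) := (hq.mean_value_eq hS hx ha h).symm
              _ ≤ v - δ := hδ' _ hxR a h h'
        · exact hin fun t ht => by rw [h.1 t ht]; exact hxR
        · exact absurd (h ▸ hxR) hone
      · calc M.mean x a W ≤ M.mean x a (value M F) := MDP.mean_mono fun t _ _ => hWle t
          _ ≤ value M F x := actionValue_le_value hS.valid F hx ha
          _ = W x := by simp only [W]; rw [if_neg hxR]) (hq.states_subset (hR hs))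
  rw [hWR s (hq.states_subset (hR hs)) (by rw [hq.proj_self s (hR hs)]; exact hs), hv s hs] at key
  linarith

/-- The Bellman equation in a quotient. -/
theorem exists_mean_value_eq (hS : Setting M F one zero) (hq : IsQuotient M F one zero M' proj)
    {s : S} (hs : s ∈ M'.states) :
    ∃ a ∈ M'.enabled s, M'.mean s a (value M F) = value M F s := by
  by_cases hs1 : s = one
  · obtain ⟨a, ha⟩ := hq.enabled_nonempty s hs
    refine ⟨a, ha, ?_⟩
    subst hs1
    have ha1 := hq.one_enabled a ha
    have hp : proj s = s := hq.proj_self s hs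
    have := hq.mean_value_eq hS hS.one_mem ha1 (by rw [hp]; exact ha)
    rw [hp] at this
    rw [this]
    refine hS.valid.mean_eq hS.one_mem ha1 fun t _ ht0 => ?_
    have h1 := (PMF.apply_eq_one_iff _ _).1 (hS.one_terminal a ha1)
    have ht : t ∈ (M.trans s a).support := (PMF.mem_support_iff _ _).2 ht0
    rw [h1] at ht
    rw [ht]
  · by_contra hcon
    push Not at hcon
    have hlt : ∀ a ∈ M'.enabled s, M'.mean s a (value M F) < value M F s := fun a ha =>
      lt_of_le_of_ne (hq.mean_value_le hS hs ha) (hcon a ha)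
    have hps : proj s = s := hq.proj_self s hs
    by_cases hsF : s ∈ F
    · have hsM := hq.states_subset hs
      obtain ⟨a, ha, hav⟩ := hS.target s hsM hsF
      -- The action that the hypothesis on targets provides is still there: an action is removed as
      -- internal only from a class whose representative is not a target.
      rcases hq.removed s hsM a ha with h | h | h
      · refine hcon a (hps ▸ h) ?_
        have := hq.mean_value_eq hS hsM ha h
        rw [hps] at this
        rw [this, hav, value_of_mem hS.valid hsM hsF]
      · exact h.2 (hps.symm ▸ hsF)
      · exact hs1 (hps ▸ h)
    -- If every action at `s` were strictly worse than V(s), the singleton would have value at most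
    -- 0, but the means are nonnegative.
    · have h0 := hq.value_le_zero_of_closed hS (R := {s}) (v := value M F s)
        (by simpa using hs) (by simpa using Ne.symm hs1) (by simpa using hsF) (by simp)
        (fun t ht a ha => by
          rw [Finset.mem_singleton] at ht
          subst ht
          exact Or.inr (hlt a ha)) (Finset.mem_singleton_self s)
      obtain ⟨a, ha⟩ := hq.enabled_nonempty s hs
      have h1 : 0 ≤ M'.mean s a (value M F) :=
        Finset.sum_nonneg fun t _ => mul_nonneg ENNReal.toReal_nonneg (value_nonneg _ _ _)
      linarith [hlt a ha]

end IsQuotient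

omit [Finite S] [Finite A] in
/-- A function that is superharmonic on an end component is constant there. -/
theorem MDP.IsEC.eq_of_mean_le (hM : M.IsValid) {R : Finset S} {B : Finset A} (hR : M.IsEC R B)
    {f : S → ℝ} (hf : ∀ s ∈ R, ∀ a ∈ M.enabled s, M.mean s a f ≤ f s) {s t : S} (hs : s ∈ R)
    (ht : t ∈ R) : f s = f t := by
  -- Minimum principle: a superharmonic function that is minimal at a state equals this minimum at
  -- all successors by actions of `B`, hence on all of `R`.
  obtain ⟨x, hx, hmin⟩ := R.exists_min_image f ⟨s, hs⟩
  have key : ∀ y, Relation.ReflTransGen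
      (fun x y => ∃ a ∈ B, a ∈ M.enabled x ∧ 0 < M.trans x a y) x y → y ∈ R ∧ f y = f x := by
    intro y hy
    induction hy with
    | refl => exact ⟨hx, rfl⟩
    | tail _ hstep ih =>
      obtain ⟨a, haB, ha, hpos⟩ := hstep
      have hsub := hR.closed _ ih.1 a haB ha
      refine ⟨hsub ((PMF.mem_support_iff _ _).2 hpos.ne'), ?_⟩
      refine hM.eq_of_mean_le (hR.states_subset ih.1) ha (fun t _ h0 => ?_)
        ((hf _ ih.1 a ha).trans_eq ih.2) hpos.ne'
      exact hmin t (hsub ((PMF.mem_support_iff _ _).2 h0))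
  rw [(key s (hR.connected x hx s hs)).2, (key t (hR.connected x hx t ht)).2]

end Quotient

/-! ### The invariant of the bounds and its preservation by backups -/

section Soundness

open scoped ENNReal

universe u v
variable {S : Type u} {A : Type v} [Finite S] [Finite A]

/-- The invariant of the algorithm: the current MDP is a quotient of `M`, `U` is a superharmonic
upper bound and `L` a subharmonic lower bound on the value, and a positive maximum of `L` on a set
`X` of states is due to some action that may leave `X`. -/
structure Bounds.IsSound (M : MDP S A) (F : Set S) (one zero : S) (b : Bounds S A)
    (proj : S → S) : Prop where
  quot : IsQuotient M F one zero b.mdp proj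
  lower_nonneg : ∀ s ∈ b.mdp.states, ∀ a ∈ b.mdp.enabled s, 0 ≤ b.L s a
  lower : ∀ s ∈ b.mdp.states, ∀ a ∈ b.mdp.enabled s, b.L s a ≤ b.mdp.mean s a (value M F)
  upper : ∀ s ∈ b.mdp.states, ∀ a ∈ b.mdp.enabled s, b.mdp.mean s a (value M F) ≤ b.U s a
  upper_le_one : ∀ s ∈ b.mdp.states, ∀ a ∈ b.mdp.enabled s, b.U s a ≤ 1
  super : ∀ s ∈ b.mdp.states, ∀ a ∈ b.mdp.enabled s,
    b.mdp.mean s a (b.mdp.best b.U) ≤ b.U s a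
  sub : ∀ s ∈ b.mdp.states, ∀ a ∈ b.mdp.enabled s,
    b.L s a ≤ b.mdp.mean s a (b.mdp.best b.L)
  justified : ∀ X ⊆ b.mdp.states, one ∉ X → ∀ l : ℝ, 0 < l →
    (∀ x ∈ X, b.mdp.best b.L x ≤ l) → (∃ x ∈ X, b.mdp.best b.L x = l) →
    ∃ x ∈ X, ∃ a ∈ b.mdp.enabled x, b.L x a = l ∧ ∃ t, b.mdp.trans x a t ≠ 0 ∧ t ∉ X
  upper_zero : ∀ a ∈ b.mdp.enabled zero, b.U zero a = 0
  lower_one : ∀ a ∈ b.mdp.enabled one, b.L one a = 1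

variable {M : MDP S A} {F : Set S} {one zero : S} {b : Bounds S A} {proj : S → S}

namespace Bounds.IsSound

theorem isValid (hS : Setting M F one zero) (hb : b.IsSound M F one zero proj) :
    b.mdp.IsValid := hb.quot.isValid hS

/-- Here the Bellman equation in the quotient is needed: some action that survived the collapses
still attains the value. -/
theorem value_le_best (hS : Setting M F one zero) (hb : b.IsSound M F one zero proj) {s : S}
    (hs : s ∈ b.mdp.states) : value M F s ≤ b.mdp.best b.U s := by
  obtain ⟨a, ha, hv⟩ := hb.quot.exists_mean_value_eq hS hs
  rw [← hv]
  exact (hb.upper s hs a ha).trans (b.mdp.le_best _ ha)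

theorem best_le_value (hS : Setting M F one zero) (hb : b.IsSound M F one zero proj) {s : S}
    (hs : s ∈ b.mdp.states) : b.mdp.best b.L s ≤ value M F s :=
  b.mdp.best_le (hb.quot.enabled_nonempty s hs) fun a ha =>
    (hb.lower s hs a ha).trans (hb.quot.mean_value_le hS hs ha)

theorem best_upper_le_one (hb : b.IsSound M F one zero proj) {s : S}
    (hs : s ∈ b.mdp.states) : b.mdp.best b.U s ≤ 1 :=
  b.mdp.best_le (hb.quot.enabled_nonempty s hs) fun a ha => hb.upper_le_one s hs a ha

theorem best_lower_nonneg (hb : b.IsSound M F one zero proj) {s : S}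
    (hs : s ∈ b.mdp.states) : 0 ≤ b.mdp.best b.L s := by
  obtain ⟨a, ha⟩ := hb.quot.enabled_nonempty s hs
  exact (hb.lower_nonneg s hs a ha).trans (b.mdp.le_best _ ha)

theorem best_upper_zero (hb : b.IsSound M F one zero proj) : b.mdp.best b.U zero = 0 := by
  obtain ⟨a, ha, h⟩ := b.mdp.exists_eq_best b.U (hb.quot.enabled_nonempty zero hb.quot.zero_mem)
  rw [← h, hb.upper_zero a ha]

theorem best_lower_one (hb : b.IsSound M F one zero proj) : b.mdp.best b.L one = 1 := by
  obtain ⟨a, ha, h⟩ := b.mdp.exists_eq_best b.L (hb.quot.enabled_nonempty one hb.quot.one_mem)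
  rw [← h, hb.lower_one a ha]

end Bounds.IsSound

/-- Merging into a terminal state never gives it foreign actions, so its actions remain self-loops
in every quotient. -/
theorem trans_terminal_eq_zero (hS : Setting M F one zero) {M' : MDP S A}
    (hq : IsQuotient M F one zero M' proj) {z : S} (hz : z = one ∨ z = zero) {a : A}
    (ha : a ∈ M'.enabled z) {t : S} (ht : M'.trans z a t ≠ 0) : t = z := by
  have h : z ∈ M.states ∧ a ∈ M.enabled z ∧ M.trans z a z = 1 ∧ proj z = z := by
    rcases hz with rfl | rfl
    · exact ⟨hS.one_mem, hq.one_enabled a ha, hS.one_terminal a (hq.one_enabled a ha),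
        hq.proj_self _ hq.one_mem⟩
    · exact ⟨hS.zero_mem, hq.zero_enabled a ha, hS.zero_terminal a (hq.zero_enabled a ha),
        hq.proj_self _ hq.zero_mem⟩
  obtain ⟨hzM, haM, h1, hp⟩ := h
  have htr := hq.trans_eq hS hzM haM (by rw [hp]; exact ha)
  rw [hp] at htr
  rw [htr, pmf_map_apply_ne_zero_iff] at ht
  obtain ⟨y, hy, rfl⟩ := ht
  have hys : y ∈ (M.trans z a).support := (PMF.mem_support_iff _ _).2 hy
  rw [(PMF.apply_eq_one_iff _ _).1 h1] at hys
  rw [Set.mem_singleton_iff.1 hys, hp]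

theorem isSound_first (hS : Setting M F one zero) :
    (Bounds.first M one zero).IsSound M F one zero id := by
  have hq := IsQuotient.refl hS
  have hV : M.IsValid := hS.valid
  have hself : ∀ z, z = one ∨ z = zero → ∀ a ∈ M.enabled z, ∀ t, M.trans z a t ≠ 0 → t = z :=
    fun z hz a ha t ht => trans_terminal_eq_zero hS hq hz ha ht
  have hbU : ∀ s ∈ M.states, M.best (fun s _ => if s = zero then (0 : ℝ) else 1) s =
      if s = zero then 0 else 1 := by
    intro s hs
    obtain ⟨a, ha, h⟩ := M.exists_eq_best (fun s _ => if s = zero then (0 : ℝ) else 1)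
      (hV.enabled_nonempty s hs)
    rw [← h]
  have hbL : ∀ s ∈ M.states, M.best (fun s _ => if s = one then (1 : ℝ) else 0) s =
      if s = one then 1 else 0 := by
    intro s hs
    obtain ⟨a, ha, h⟩ := M.exists_eq_best (fun s _ => if s = one then (1 : ℝ) else 0)
      (hV.enabled_nonempty s hs)
    rw [← h]
  have hmean1 : ∀ a ∈ M.enabled one, M.mean one a (value M F) = 1 := fun a ha =>
    hV.mean_eq hS.one_mem ha fun t _ ht => by
      rw [hself one (Or.inl rfl) a ha t ht, IsQuotient.value_one hS]
  have hmean0 : ∀ a ∈ M.enabled zero, M.mean zero a (value M F) = 0 := fun a ha =>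
    hV.mean_eq hS.zero_mem ha fun t _ ht => by
      rw [hself zero (Or.inr rfl) a ha t ht, IsQuotient.value_zero hS]
  refine ⟨hq, ?_, ?_, ?_, ?_, ?_, ?_, ?_, ?_, ?_⟩ <;> simp only [Bounds.first]
  · intro s _ a _
    split_ifs <;> norm_num
  · intro s hs a ha
    split_ifs with h
    · subst h
      exact (hmean1 a ha).ge
    · exact hV.le_mean hs ha fun t _ _ => value_nonneg M F t
  · intro s hs a ha
    split_ifs with h
    · subst h
      exact (hmean0 a ha).le
    · exact hV.mean_le hs ha fun t ht _ => value_le_one hV F ht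
  · intro s _ a _
    split_ifs <;> norm_num
  · intro s hs a ha
    split_ifs with h
    · subst h
      refine hV.mean_le hs ha fun t ht h0 => ?_
      rw [hbU t ht, hself s (Or.inr rfl) a ha t h0, if_pos rfl]
    · refine hV.mean_le hs ha fun t ht h0 => ?_
      rw [hbU t ht]
      split_ifs <;> norm_num
  · intro s hs a ha
    split_ifs with h
    · subst h
      refine hV.le_mean hs ha fun t ht h0 => ?_
      rw [hbL t ht, hself s (Or.inl rfl) a ha t h0, if_pos rfl]
    · refine hV.le_mean hs ha fun t ht h0 => ?_
      rw [hbL t ht]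
      split_ifs <;> norm_num
  -- `justified` is vacuous at the start: outside `one` the lower bound is 0, which is less than
  -- `l`.
  · rintro X hX hone l hl _ ⟨x, hx, hxl⟩
    rw [hbL x (hX hx), if_neg (fun h : x = one => hone (h ▸ hx))] at hxl
    exact absurd hxl hl.ne
  · intro a _
    rw [if_pos trivial]
  · intro a _
    rw [if_pos trivial]

omit [Finite S] [Finite A] in
theorem MDP.backup_apply (M : MDP S A) (f : S → A → ℝ) (s : S) (a : A) (x : S) (c : A) :
    M.backup f s a x c = if x = s ∧ c = a then M.mean s a (M.best f) else f x c := by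
  simp only [MDP.backup, MDP.mean]
  by_cases hx : x = s
  · subst hx
    by_cases hc : c = a
    · subst hc; simp
    · simp [hc]
  · simp [hx]

/-- Backups keep the invariant, lower `U` and raise `L`. -/
theorem Bounds.IsSound.update (hS : Setting M F one zero) (hb : b.IsSound M F one zero proj)
    {m : Move S A} (hm : m.state ∈ b.mdp.states) (hma : m.action ∈ b.mdp.enabled m.state) :
    (b.update m).IsSound M F one zero proj ∧
      (∀ s ∈ b.mdp.states, ∀ a ∈ b.mdp.enabled s, (b.update m).U s a ≤ b.U s a) ∧
      (∀ s ∈ b.mdp.states, ∀ a ∈ b.mdp.enabled s, b.L s a ≤ (b.update m).L s a) := by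
  obtain ⟨s, a⟩ := m
  dsimp only at hm hma
  have hV := hb.isValid hS
  have eU : ∀ x c, (b.update ⟨s, a⟩).U x c =
      if x = s ∧ c = a then b.mdp.mean s a (b.mdp.best b.U) else b.U x c :=
    fun x c => b.mdp.backup_apply b.U s a x c
  have eL : ∀ x c, (b.update ⟨s, a⟩).L x c =
      if x = s ∧ c = a then b.mdp.mean s a (b.mdp.best b.L) else b.L x c :=
    fun x c => b.mdp.backup_apply b.L s a x c
  have hmdp : (b.update ⟨s, a⟩).mdp = b.mdp := rfl
  have hUle : ∀ x ∈ b.mdp.states, ∀ c ∈ b.mdp.enabled x,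
      (b.update ⟨s, a⟩).U x c ≤ b.U x c := by
    intro x hx c hc
    rw [eU]
    split_ifs with h
    · obtain ⟨rfl, rfl⟩ := h
      exact hb.super x hx c hc
    · exact le_rfl
  have hLle : ∀ x ∈ b.mdp.states, ∀ c ∈ b.mdp.enabled x,
      b.L x c ≤ (b.update ⟨s, a⟩).L x c := by
    intro x hx c hc
    rw [eL]
    split_ifs with h
    · obtain ⟨rfl, rfl⟩ := h
      exact hb.sub x hx c hc
    · exact le_rfl
  have hbU : ∀ x ∈ b.mdp.states, b.mdp.best (b.update ⟨s, a⟩).U x ≤ b.mdp.best b.U x :=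
    fun x hx => b.mdp.best_mono fun c hc => hUle x hx c hc
  have hbL : ∀ x ∈ b.mdp.states, b.mdp.best b.L x ≤ b.mdp.best (b.update ⟨s, a⟩).L x :=
    fun x hx => b.mdp.best_mono fun c hc => hLle x hx c hc
  have hupper : ∀ x ∈ b.mdp.states, ∀ c ∈ b.mdp.enabled x,
      b.mdp.mean x c (value M F) ≤ (b.update ⟨s, a⟩).U x c := by
    intro x hx c hc
    rw [eU]
    split_ifs with h
    · obtain ⟨rfl, rfl⟩ := h
      exact MDP.mean_mono fun t ht _ => hb.value_le_best hS ht
    · exact hb.upper x hx c hc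
  have hlower : ∀ x ∈ b.mdp.states, ∀ c ∈ b.mdp.enabled x,
      (b.update ⟨s, a⟩).L x c ≤ b.mdp.mean x c (value M F) := by
    intro x hx c hc
    rw [eL]
    split_ifs with h
    · obtain ⟨rfl, rfl⟩ := h
      exact MDP.mean_mono fun t ht _ => hb.best_le_value hS ht
    · exact hb.lower x hx c hc
  refine ⟨⟨hb.quot, ?_, hlower, hupper, ?_, ?_, ?_, ?_, ?_, ?_⟩, hUle, hLle⟩
  · exact fun x hx c hc => (hb.lower_nonneg x hx c hc).trans (hLle x hx c hc)
  · exact fun x hx c hc => (hUle x hx c hc).trans (hb.upper_le_one x hx c hc)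
  · intro x hx c hc
    rw [hmdp] at hx hc ⊢
    have h1 : b.mdp.mean x c (b.mdp.best (b.update ⟨s, a⟩).U) ≤ b.mdp.mean x c (b.mdp.best b.U) :=
      MDP.mean_mono fun t ht _ => hbU t ht
    rw [eU]
    split_ifs with h
    · obtain ⟨rfl, rfl⟩ := h
      exact h1
    · exact h1.trans (hb.super x hx c hc)
  · intro x hx c hc
    rw [hmdp] at hx hc ⊢
    have h1 : b.mdp.mean x c (b.mdp.best b.L) ≤ b.mdp.mean x c (b.mdp.best (b.update ⟨s, a⟩).L) :=
      MDP.mean_mono fun t ht _ => hbL t ht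
    rw [eL]
    split_ifs with h
    · obtain ⟨rfl, rfl⟩ := h
      exact h1
    · exact (hb.sub x hx c hc).trans h1
  · rintro X hX hone l hl hle ⟨x, hx, hxl⟩
    rw [hmdp] at hX hle hxl ⊢
    obtain ⟨c, hc, hcl⟩ := b.mdp.exists_eq_best (b.update ⟨s, a⟩).L (hV.enabled_nonempty x (hX hx))
    rw [hxl] at hcl
    have hold : ∀ y ∈ X, b.mdp.best b.L y ≤ l := fun y hy => (hbL y (hX hy)).trans (hle y hy)
    -- If the old maximum over `X` was already `l`, the old witness remains: its bound can neither
    -- drop nor exceed `l`.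
    by_cases hex : ∃ y ∈ X, b.mdp.best b.L y = l
    · obtain ⟨y, hy, d, hd, hdl, ht⟩ := hb.justified X hX hone l hl hold hex
      refine ⟨y, hy, d, hd, le_antisymm ?_ ?_, ht⟩
      · exact (b.mdp.le_best _ hd).trans (hle y hy)
      · rw [← hdl]
        exact hLle y (hX hy) d hd
    · push Not at hex
      -- Now the old bounds are below `l` on all of `X`, so the maximal pair is the one just backed
      -- up, and a mean of values below `l` cannot equal `l`. Hence one of its successors is outside
      -- `X`.
      have hlt : ∀ y ∈ X, b.mdp.best b.L y < l := fun y hy => lt_of_le_of_ne (hold y hy) (hex y hy)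
      refine ⟨x, hx, c, hc, hcl, ?_⟩
      by_contra hno
      push Not at hno
      rw [eL] at hcl
      split_ifs at hcl with h
      · obtain ⟨rfl, rfl⟩ := h
        have hall : ∀ t, b.mdp.trans x c t ≠ 0 → b.mdp.best b.L t = l := fun t ht =>
          hV.eq_of_le_mean (hX hx) hc (fun t _ ht => hold t (hno t ht)) hcl.ge ht
        obtain ⟨t, ht⟩ := (b.mdp.trans x c).support_nonempty
        have ht := (PMF.mem_support_iff _ _).1 ht
        exact hex t (hno t ht) (hall t ht)
      · have := (b.mdp.le_best b.L hc).trans_lt (hlt x hx)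
        linarith
  · intro c hc
    rw [hmdp] at hc
    refine le_antisymm ((hUle zero hb.quot.zero_mem c hc).trans_eq (hb.upper_zero c hc)) ?_
    refine le_trans ?_ (hupper zero hb.quot.zero_mem c hc)
    exact hV.le_mean hb.quot.zero_mem hc fun t _ _ => value_nonneg M F t
  · intro c hc
    rw [hmdp] at hc
    refine le_antisymm ?_ ((hb.lower_one c hc).symm.trans_le (hLle one hb.quot.one_mem c hc))
    refine (hlower one hb.quot.one_mem c hc).trans ?_
    exact hV.mean_le hb.quot.one_mem hc fun t ht _ => hb.quot.value_le_one hS ht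

/-- After the update of a list of pairs, the bounds on each of these pairs are at least as good as
their backups for the old bounds. -/
theorem Bounds.IsSound.foldl_update (hS : Setting M F one zero)
    (hb : b.IsSound M F one zero proj) (w : List (Move S A))
    (hw : ∀ m ∈ w, m.state ∈ b.mdp.states ∧ m.action ∈ b.mdp.enabled m.state) :
    (w.foldl Bounds.update b).mdp = b.mdp ∧ (w.foldl Bounds.update b).IsSound M F one zero proj ∧
      (∀ s ∈ b.mdp.states, ∀ a ∈ b.mdp.enabled s, (w.foldl Bounds.update b).U s a ≤ b.U s a) ∧
      (∀ s ∈ b.mdp.states, ∀ a ∈ b.mdp.enabled s, b.L s a ≤ (w.foldl Bounds.update b).L s a) ∧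
      (∀ m ∈ w, (w.foldl Bounds.update b).U m.state m.action ≤
        b.mdp.mean m.state m.action (b.mdp.best b.U)) ∧
      (∀ m ∈ w, b.mdp.mean m.state m.action (b.mdp.best b.L) ≤
        (w.foldl Bounds.update b).L m.state m.action) := by
  induction w generalizing b with
  | nil => exact ⟨rfl, hb, fun _ _ _ _ => le_rfl, fun _ _ _ _ => le_rfl, by simp, by simp⟩
  | cons m w ih =>
    have hm := hw m (List.mem_cons_self)
    obtain ⟨h1, h2, h3⟩ := hb.update hS hm.1 hm.2
    obtain ⟨i1, i2, i3, i4, i5, i6⟩ := ih h1 fun m' hm' => hw m' (List.mem_cons_of_mem _ hm')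
    have hmdp : (b.update m).mdp = b.mdp := rfl
    rw [hmdp] at i1 i3 i4 i5 i6
    have eU : (b.update m).U m.state m.action = b.mdp.mean m.state m.action (b.mdp.best b.U) := by
      refine (b.mdp.backup_apply b.U m.state m.action m.state m.action).trans ?_
      rw [if_pos ⟨rfl, rfl⟩]
    have eL : (b.update m).L m.state m.action = b.mdp.mean m.state m.action (b.mdp.best b.L) := by
      refine (b.mdp.backup_apply b.L m.state m.action m.state m.action).trans ?_
      rw [if_pos ⟨rfl, rfl⟩]
    rw [List.foldl_cons]
    refine ⟨i1, i2, fun s hs a ha => (i3 s hs a ha).trans (h2 s hs a ha),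
      fun s hs a ha => (h3 s hs a ha).trans (i4 s hs a ha), ?_, ?_⟩
    -- The backup of `m'` is computed from bounds at least as good as the old ones, and later
    -- backups only improve the result, even if they hit the same pair.
    · intro m' hm'
      rcases List.mem_cons.1 hm' with rfl | hm'
      · exact (i3 _ hm.1 _ hm.2).trans_eq eU
      · refine (i5 m' hm').trans (MDP.mean_mono fun t ht _ => b.mdp.best_mono fun c hc => ?_)
        exact h2 t ht c hc
    · intro m' hm'
      rcases List.mem_cons.1 hm' with rfl | hm'
      · exact eL.symm.trans_le (i4 _ hm.1 _ hm.2)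
      · refine le_trans (MDP.mean_mono fun t ht _ => b.mdp.best_mono fun c hc => ?_) (i6 m' hm')
        exact h3 t ht c hc

end Soundness

/-! ### Merging one end component preserves the invariant -/

section Merging

open scoped ENNReal

universe u v
variable {S : Type u} {A : Type v}

/-- The map that merges `R` into the state `r`. -/
def mergeMap (R : Finset S) (r : S) (t : S) : S := if t ∈ R then r else t

theorem mergeMap_of_mem {R : Finset S} {r t : S} (h : t ∈ R) : mergeMap R r t = r := if_pos h

theorem mergeMap_of_notMem {R : Finset S} {r t : S} (h : t ∉ R) : mergeMap R r t = t := if_neg h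

/-- `c` arises from `b` by merging the states of the end component `(R, B)` into `r`, which is a
state of `R` or a terminal state. -/
structure IsMerge (F : Set S) (one zero : S) (b c : Bounds S A) (R : Finset S) (B : Finset A)
    (r : S) : Prop where
  mem_states : ∀ s, s ∈ c.mdp.states ↔ s = r ∨ s ∈ b.mdp.states ∧ s ∉ R
  start_eq : c.mdp.start = mergeMap R r b.mdp.start
  action : ∀ s ∈ c.mdp.states, ∀ a ∈ c.mdp.enabled s, ∃ y ∈ b.mdp.states, mergeMap R r y = s ∧
    a ∈ b.mdp.enabled y ∧ c.mdp.trans s a = (b.mdp.trans y a).map (mergeMap R r) ∧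
    c.U s a = b.U y a ∧ c.L s a = b.L y a ∧ (y ∈ R → r ∈ R ∧ a ∉ B)
  enabled_off : ∀ y ∈ b.mdp.states, y ∉ R → ∀ a ∈ b.mdp.enabled y, a ∈ c.mdp.enabled y
  enabled_in : r ∈ R → ∀ y ∈ R, ∀ a ∈ b.mdp.enabled y, a ∉ B → a ∈ c.mdp.enabled r
  cases : (r ∈ R ∧ (∀ s ∈ R, s ∉ F) ∧ (c.mdp.enabled r).Nonempty) ∨
    (r = one ∧ ∃ s ∈ R, s ∈ F) ∨
    (r = zero ∧ (∀ s ∈ R, s ∉ F) ∧ ∀ y ∈ R, ∀ a ∈ b.mdp.enabled y, a ∈ B)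

theorem MDP.owner_eq {M : MDP S A} (hM : M.IsValid) {R : Finset S} (hR : R ⊆ M.states) {r y : S}
    {a : A} (hy : y ∈ R) (ha : a ∈ M.enabled y) : M.owner R r a = y := by
  have h : ∃ s ∈ R, a ∈ M.enabled s := ⟨y, hy, ha⟩
  rw [MDP.owner, dif_pos h]
  exact hM.eq_of_mem_enabled (hR h.choose_spec.1) (hR hy) h.choose_spec.2 ha

theorem isMerge_collapse {F : Set S} {one zero : S} {b : Bounds S A} (hV : b.mdp.IsValid)
    {R : Finset S} {B : Finset A} (hR : b.mdp.IsEC R B) {r : S} (hr : r ∈ R)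
    (hRF : ∀ s ∈ R, s ∉ F) (hne : ((b.mdp.collapse R B r).enabled r).Nonempty) :
    IsMerge F one zero b { mdp := b.mdp.collapse R B r
                           U := fun s a => if s = r then b.U (b.mdp.owner R r a) a else b.U s a
                           L := fun s a => if s = r then b.L (b.mdp.owner R r a) a else b.L s a }
      R B r where
  mem_states := by simp [MDP.collapse]
  start_eq := rfl
  action := by
    intro s hs a ha
    simp only [MDP.collapse, Finset.mem_insert, Finset.mem_sdiff] at hs ha ⊢
    by_cases hsr : s = r
    · subst hsr
      simp only [if_true, Finset.mem_sdiff, Finset.mem_biUnion] at ha ⊢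
      obtain ⟨⟨y, hy, hay⟩, haB⟩ := ha
      have ho := b.mdp.owner_eq hV hR.states_subset (r := s) hy hay
      exact ⟨y, hR.states_subset hy, mergeMap_of_mem hy, hay, by rw [ho]; rfl, by rw [ho],
        by rw [ho], fun _ => ⟨hr, haB⟩⟩
    · simp only [hsr, if_false, false_or, Finset.mem_sdiff] at hs ha ⊢
      exact ⟨s, hs.1, mergeMap_of_notMem hs.2, ha.1, rfl, rfl, rfl, fun h => absurd h hs.2⟩
  enabled_off := by
    intro y hy hyR a ha
    have hyr : y ≠ r := fun h => hyR (h ▸ hr)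
    simp only [MDP.collapse, if_neg hyr, Finset.mem_sdiff]
    refine ⟨ha, fun haB => ?_⟩
    obtain ⟨z, hz, hza⟩ := Finset.mem_biUnion.1 (hR.actions_subset haB)
    exact hyR (hV.eq_of_mem_enabled hy (hR.states_subset hz) ha hza ▸ hz)
  enabled_in := by
    intro _ y hy a ha haB
    simp only [MDP.collapse, if_true, Finset.mem_sdiff, Finset.mem_biUnion]
    exact ⟨⟨y, hy, ha⟩, haB⟩
  cases := Or.inl ⟨hr, hRF, hne⟩

/-- Collapsing `R` into `r` and then `{r, z}` into `z` composes to merging `R` into `z`. The second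
collapse deletes whatever actions `R` had left, so `z` keeps exactly its own. -/
theorem isMerge_makeTerminal {F : Set S} {one zero : S} {b : Bounds S A} (hV : b.mdp.IsValid)
    {R : Finset S} {B : Finset A} (hR : b.mdp.IsEC R B) {r : S} (hr : r ∈ R) {z : S}
    (hz : z ∈ b.mdp.states) (hzR : z ∉ R)
    (hcases : (z = one ∧ ∃ s ∈ R, s ∈ F) ∨
      (z = zero ∧ (∀ s ∈ R, s ∉ F) ∧ ∀ y ∈ R, ∀ a ∈ b.mdp.enabled y, a ∈ B)) :
    IsMerge F one zero b { mdp := (b.mdp.collapse R B r).makeTerminal r z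
                           U := fun s a => if s = r then b.U (b.mdp.owner R r a) a else b.U s a
                           L := fun s a => if s = r then b.L (b.mdp.owner R r a) a else b.L s a }
      R B z := by
  have hrz : r ≠ z := fun h => hzR (h ▸ hr)
  have hB : ∀ y ∈ b.mdp.states, y ∉ R → ∀ a ∈ b.mdp.enabled y, a ∉ B ∧
      a ∉ R.biUnion b.mdp.enabled := by
    intro y hy hyR a ha
    have h2 : a ∉ R.biUnion b.mdp.enabled := by
      intro h
      obtain ⟨x, hx, hxa⟩ := Finset.mem_biUnion.1 h
      exact hyR (hV.eq_of_mem_enabled hy (hR.states_subset hx) ha hxa ▸ hx)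
    exact ⟨fun h => h2 (hR.actions_subset h), h2⟩
  have henr : (b.mdp.collapse R B r).enabled r = R.biUnion b.mdp.enabled \ B := by
    simp [MDP.collapse]
  have hen : ∀ y, y ≠ r → (b.mdp.collapse R B r).enabled y = b.mdp.enabled y \ B := by
    intro y hy
    simp [MDP.collapse, hy]
  have htr : ∀ y a, y ≠ r → (b.mdp.collapse R B r).trans y a =
      (b.mdp.trans y a).map (mergeMap R r) := by
    intro y a hy
    simp only [MDP.collapse, if_neg hy]
    rfl
  have hcomp : (fun t => if t ∈ ({r, z} : Finset S) then z else t) ∘ mergeMap R r =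
      mergeMap R z := by
    funext t
    simp only [Function.comp, mergeMap]
    by_cases ht : t ∈ R
    · simp [ht]
    · have : t ≠ r := fun h => ht (h ▸ hr)
      by_cases htz : t = z
      · simp [htz, hzR]
      · simp [ht, this, htz]
  have hmem : ∀ s, s ∈ ((b.mdp.collapse R B r).makeTerminal r z).states ↔
      s = z ∨ s ∈ b.mdp.states ∧ s ∉ R := by
    intro s
    simp only [MDP.makeTerminal, MDP.collapse, Finset.mem_insert, Finset.mem_sdiff,
      Finset.mem_singleton]
    by_cases h1 : s = z
    · simp [h1]
    · by_cases h2 : s = r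
      · simp [h2, hr, hrz]
      · simp [h1, h2]
  have hoff : ∀ y ∈ b.mdp.states, y ∉ R →
      ((b.mdp.collapse R B r).makeTerminal r z).enabled y = b.mdp.enabled y := by
    intro y hy hyR
    have hyr : y ≠ r := fun h => hyR (h ▸ hr)
    rw [MDP.makeTerminal, henr]
    ext a
    by_cases hyz : y = z
    · subst hyz
      rw [MDP.collapse]
      simp only [if_true, Finset.mem_sdiff, Finset.mem_biUnion, Finset.mem_insert,
        Finset.mem_singleton, exists_eq_or_imp, exists_eq_left, henr, hen y hyr]
      constructor
      · rintro ⟨h | h, h'⟩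
        · exact absurd h h'
        · exact h.1
      · intro h
        exact ⟨Or.inr ⟨h, (hB y hy hyR a h).1⟩, fun h' => (hB y hy hyR a h).2
          (Finset.mem_biUnion.2 h'.1)⟩
    · rw [MDP.collapse]
      simp only [if_neg hyz, hen y hyr, Finset.mem_sdiff]
      constructor
      · exact fun h => h.1.1
      · exact fun h => ⟨⟨h, (hB y hy hyR a h).1⟩, fun h' => (hB y hy hyR a h).2 h'.1⟩
  have htrans : ∀ y ∈ b.mdp.states, y ∉ R → ∀ a ∈ b.mdp.enabled y,
      ((b.mdp.collapse R B r).makeTerminal r z).trans y a =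
        (b.mdp.trans y a).map (mergeMap R z) := by
    intro y hy hyR a ha
    have hyr : y ≠ r := fun h => hyR (h ▸ hr)
    rw [← hcomp, ← PMF.map_comp, ← htr y a hyr, MDP.makeTerminal]
    rw [MDP.collapse]
    by_cases hyz : y = z
    · subst hyz
      have ho : (b.mdp.collapse R B r).owner {r, y} y a = y := by
        have h : ∃ s ∈ ({r, y} : Finset S), a ∈ (b.mdp.collapse R B r).enabled s :=
          ⟨y, by simp, by rw [hen y hyr]; exact Finset.mem_sdiff.2 ⟨ha, (hB y hy hyR a ha).1⟩⟩
        rw [MDP.owner, dif_pos h]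
        have hs := h.choose_spec
        rcases Finset.mem_insert.1 hs.1 with h' | h'
        · have h2 := hs.2
          rw [h', henr] at h2
          exact absurd (Finset.mem_sdiff.1 h2).1 (hB y hy hyR a ha).2
        · exact Finset.mem_singleton.1 h'
      simp only [if_true, ho]
    · simp only [if_neg hyz]
  refine ⟨hmem, ?_, ?_, ?_, ?_, Or.inr hcases⟩
  · rw [← hcomp]
    rfl
  · intro s hs a ha
    have hs' : s ∈ b.mdp.states ∧ s ∉ R := by
      rcases (hmem s).1 hs with rfl | h
      · exact ⟨hz, hzR⟩
      · exact h
    have ha' : a ∈ b.mdp.enabled s := by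
      rw [← hoff s hs'.1 hs'.2]; exact ha
    have hsr : s ≠ r := fun h => hs'.2 (h ▸ hr)
    exact ⟨s, hs'.1, mergeMap_of_notMem hs'.2, ha', htrans s hs'.1 hs'.2 a ha', if_neg hsr,
      if_neg hsr, fun h => absurd h hs'.2⟩
  · intro y hy hyR a ha
    dsimp only
    rw [hoff y hy hyR]
    exact ha
  · exact fun h => absurd h hzR

theorem MDP.IsEC.states_nonempty {M : MDP S A} {R : Finset S} {B : Finset A} (h : M.IsEC R B) :
    R.Nonempty := by
  obtain ⟨a, ha⟩ := h.nonempty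
  obtain ⟨s, hs, -⟩ := Finset.mem_biUnion.1 (h.actions_subset ha)
  exact ⟨s, hs⟩

/-- Processing an end component merges its states. -/
theorem isMerge_processEC {F : Set S} {one zero : S} {b : Bounds S A} (hV : b.mdp.IsValid)
    (h1 : one ∈ b.mdp.states) (h0 : zero ∈ b.mdp.states)
    {P : Finset S × Finset A} (hP : b.mdp.IsEC P.1 P.2) (h1P : one ∉ P.1) (h0P : zero ∉ P.1) :
    ∃ r, IsMerge F one zero b (b.processEC F one zero P) P.1 P.2 r := by
  have hne := hP.states_nonempty
  have hr := hne.choose_spec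
  rw [Bounds.processEC, dif_pos hne]
  dsimp only
  by_cases hF : ∃ s ∈ P.1, s ∈ F
  · simp only [if_pos hF]
    exact ⟨one, isMerge_makeTerminal hV hP hr h1 h1P (Or.inl ⟨rfl, hF⟩)⟩
  · simp only [if_neg hF]
    push Not at hF
    by_cases hE : (b.mdp.collapse P.1 P.2 hne.choose).enabled hne.choose = ∅
    · simp only [if_pos hE]
      refine ⟨zero, isMerge_makeTerminal hV hP hr h0 h0P (Or.inr ⟨rfl, hF, ?_⟩)⟩
      intro y hy a ha
      by_contra haB
      have : a ∈ (b.mdp.collapse P.1 P.2 hne.choose).enabled hne.choose := by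
        simp only [MDP.collapse, if_true, Finset.mem_sdiff, Finset.mem_biUnion]
        exact ⟨⟨y, hy, ha⟩, haB⟩
      rw [hE] at this
      exact absurd this (Finset.notMem_empty a)
    · simp only [if_neg hE]
      exact ⟨_, isMerge_collapse hV hP hr hF (Finset.nonempty_iff_ne_empty.2 hE)⟩

variable [Finite S] [Finite A] {M : MDP S A} {F : Set S} {one zero : S} {b c : Bounds S A}
  {proj : S → S} {R : Finset S} {B : Finset A} {r : S}

/-- V is superharmonic, hence constant on `R`. With a target in `R` the constant is 1; without
targets and without exits it is 0, by the least fixed point argument. -/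
theorem IsMerge.value_eq (hS : Setting M F one zero) (hb : b.IsSound M F one zero proj)
    (hR : b.mdp.IsEC R B) (h1R : one ∉ R) (hm : IsMerge F one zero b c R B r) {s : S}
    (hs : s ∈ R) : value M F r = value M F s := by
  have hconst : ∀ s ∈ R, ∀ t ∈ R, value M F s = value M F t := fun s hs t ht =>
    hR.eq_of_mean_le (hb.isValid hS)
      (fun x hx a ha => hb.quot.mean_value_le hS (hR.states_subset hx) ha) hs ht
  rcases hm.cases with h | h | h
  · exact hconst r h.1 s hs
  · obtain ⟨rfl, t, ht, htF⟩ := h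
    rw [hconst s hs t ht, IsQuotient.value_one hS,
      value_of_mem hS.valid (hb.quot.states_subset (hR.states_subset ht)) htF]
  · obtain ⟨rfl, hRF, hall⟩ := h
    rw [IsQuotient.value_zero hS]
    refine le_antisymm (value_nonneg _ _ _) ?_
    refine hb.quot.value_le_zero_of_closed hS hR.states_subset h1R hRF
      (fun t ht => hconst t ht s hs) (fun y hy a ha => Or.inl fun t ht => ?_) hs
    exact hR.closed y hy a (hall y hy a ha) ha ((PMF.mem_support_iff _ _).2 ht)

/-- Merging an end component keeps the invariant. -/
theorem IsMerge.isQuotient (hS : Setting M F one zero) (hb : b.IsSound M F one zero proj)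
    (hR : b.mdp.IsEC R B) (h1R : one ∉ R) (h0R : zero ∉ R) (hm : IsMerge F one zero b c R B r) :
    IsQuotient M F one zero c.mdp (mergeMap R r ∘ proj) := by
  have hq := hb.quot
  have hV := hb.isValid hS
  have hr : r ∈ b.mdp.states := by
    rcases hm.cases with h | h | h
    · exact hR.states_subset h.1
    · exact h.1 ▸ hq.one_mem
    · exact h.1 ▸ hq.zero_mem
  have hgr : mergeMap R r r = r := by
    by_cases h : r ∈ R
    · exact mergeMap_of_mem h
    · exact mergeMap_of_notMem h
  have hgmem : ∀ t ∈ b.mdp.states, mergeMap R r t ∈ c.mdp.states := by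
    intro t ht
    rw [hm.mem_states]
    by_cases h : t ∈ R
    · exact Or.inl (mergeMap_of_mem h)
    · rw [mergeMap_of_notMem h]
      exact Or.inr ⟨ht, h⟩
  have hsub : c.mdp.states ⊆ b.mdp.states := by
    intro s hs
    rcases (hm.mem_states s).1 hs with rfl | h
    · exact hr
    · exact h.1
  have hterm : ∀ z, z ∈ b.mdp.states → z ∉ R → ∀ a ∈ c.mdp.enabled z, a ∈ b.mdp.enabled z := by
    intro z hz hzR a ha
    obtain ⟨y, hy, hyz, hay, -, -, -, hyR⟩ :=
      hm.action z ((hm.mem_states z).2 (Or.inr ⟨hz, hzR⟩)) a ha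
    by_cases h : y ∈ R
    · rw [mergeMap_of_mem h] at hyz
      exact absurd (hyz ▸ (hyR h).1) hzR
    · rw [mergeMap_of_notMem h] at hyz
      exact hyz ▸ hay
  refine ⟨hsub.trans hq.states_subset, ?_, ?_, ?_, ?_, ?_, ?_, ?_, ?_, ?_, ?_, ?_, ?_⟩
  · exact (hm.mem_states _).2 (Or.inr ⟨hq.one_mem, h1R⟩)
  · exact (hm.mem_states _).2 (Or.inr ⟨hq.zero_mem, h0R⟩)
  · exact fun s hs => hgmem _ (hq.proj_mem s hs)
  · intro s hs
    simp only [Function.comp]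
    rw [hq.proj_self s (hsub hs)]
    rcases (hm.mem_states s).1 hs with rfl | h
    · exact hgr
    · exact mergeMap_of_notMem h.2
  · rw [hm.start_eq, hq.start_eq]
    rfl
  · intro s hs a ha
    obtain ⟨y, hy, hys, hay, htr, -⟩ := hm.action s hs a ha
    obtain ⟨x, hx, hxy, hax, htr'⟩ := hq.exists_owner y hy a hay
    refine ⟨x, hx, by simp only [Function.comp]; rw [hxy, hys], hax, ?_⟩
    rw [htr, htr', PMF.map_comp]
  -- For the field `removed`: actions of `B` become internal to the class of `r`. After a merge into
  -- `zero` all actions of `R` are of this kind; after a merge into `one` nothing about the action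
  -- needs to be known.
  · intro x hx a ha
    simp only [Function.comp]
    rcases hq.removed x hx a ha with h | h | h
    · by_cases hxR : proj x ∈ R
      · rw [mergeMap_of_mem hxR]
        have hin : a ∈ B → ∀ t, M.trans x a t ≠ 0 → mergeMap R r (proj t) = r := by
          intro haB t ht
          refine mergeMap_of_mem (hR.closed _ hxR a haB h ((PMF.mem_support_iff _ _).2 ?_))
          rw [hq.trans_eq hS hx ha h, pmf_map_apply_ne_zero_iff]
          exact ⟨t, ht, rfl⟩
        rcases hm.cases with h' | h' | h'
        · by_cases haB : a ∈ B
          · exact Or.inr (Or.inl ⟨hin haB, h'.2.1 r h'.1⟩)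
          · exact Or.inl (hm.enabled_in h'.1 _ hxR a h haB)
        · exact Or.inr (Or.inr h'.1)
        · exact Or.inr (Or.inl ⟨hin (h'.2.2 _ hxR a h), h'.1 ▸ hS.zero_target⟩)
      · rw [mergeMap_of_notMem hxR]
        exact Or.inl (hm.enabled_off _ (hq.proj_mem x hx) hxR a h)
    · have heq : ∀ t, M.trans x a t ≠ 0 → mergeMap R r (proj t) = mergeMap R r (proj x) :=
        fun t ht => by rw [h.1 t ht]
      by_cases hxR : proj x ∈ R
      · rw [mergeMap_of_mem hxR] at heq ⊢
        rcases hm.cases with h' | h' | h'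
        · exact Or.inr (Or.inl ⟨heq, h'.2.1 r h'.1⟩)
        · exact Or.inr (Or.inr h'.1)
        · exact Or.inr (Or.inl ⟨heq, h'.1 ▸ hS.zero_target⟩)
      · rw [mergeMap_of_notMem hxR] at heq ⊢
        exact Or.inr (Or.inl ⟨heq, h.2⟩)
    · refine Or.inr (Or.inr ?_)
      rw [h, mergeMap_of_notMem h1R]
  · intro x hx
    simp only [Function.comp]
    rw [← hq.value_proj x hx]
    by_cases hxR : proj x ∈ R
    · rw [mergeMap_of_mem hxR]
      exact hm.value_eq hS hb hR h1R hxR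
    · rw [mergeMap_of_notMem hxR]
  · intro f hf hfF
    simp only [Function.comp]
    rcases hq.target f hf hfF with h | h
    · rw [h]
      by_cases hfR : f ∈ R
      · rw [mergeMap_of_mem hfR]
        rcases hm.cases with h' | h' | h'
        · exact absurd hfF (h'.2.1 f hfR)
        · exact Or.inr h'.1
        · exact absurd hfF (h'.2.1 f hfR)
      · rw [mergeMap_of_notMem hfR]
        exact Or.inl rfl
    · rw [h, mergeMap_of_notMem h1R]
      exact Or.inr rfl
  · intro s hs
    have hoff : ∀ s ∈ b.mdp.states, s ∉ R → (c.mdp.enabled s).Nonempty := by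
      intro s hs hsR
      obtain ⟨a, ha⟩ := hq.enabled_nonempty s hs
      exact ⟨a, hm.enabled_off s hs hsR a ha⟩
    rcases (hm.mem_states s).1 hs with rfl | h
    · rcases hm.cases with h' | h' | h'
      · exact h'.2.2
      · exact hoff s hr (h'.1 ▸ h1R)
      · exact hoff s hr (h'.1 ▸ h0R)
    · exact hoff s h.1 h.2
  · exact fun a ha => hq.one_enabled a (hterm one hq.one_mem h1R a ha)
  · exact fun a ha => hq.zero_enabled a (hterm zero hq.zero_mem h0R a ha)

/-- The surviving pairs keep their bounds, so everything rests on comparing the maxima per state: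
under `mergeMap`, U does not rise and L does not fall. -/
theorem IsMerge.isSound (hS : Setting M F one zero) (hb : b.IsSound M F one zero proj)
    (hR : b.mdp.IsEC R B) (h1R : one ∉ R) (h0R : zero ∉ R) (hm : IsMerge F one zero b c R B r) :
    c.IsSound M F one zero (mergeMap R r ∘ proj) := by
  have hq := hb.quot
  have hV := hb.isValid hS
  have hqc := hm.isQuotient hS hb hR h1R h0R
  have hVc := hqc.isValid hS
  have hgmem : ∀ t ∈ b.mdp.states, mergeMap R r t ∈ c.mdp.states := by
    intro t ht
    rw [hm.mem_states]
    by_cases h : t ∈ R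
    · exact Or.inl (mergeMap_of_mem h)
    · rw [mergeMap_of_notMem h]
      exact Or.inr ⟨ht, h⟩
  have hval : ∀ t ∈ b.mdp.states, value M F (mergeMap R r t) = value M F t := by
    intro t ht
    by_cases h : t ∈ R
    · rw [mergeMap_of_mem h]
      exact hm.value_eq hS hb hR h1R h
    · rw [mergeMap_of_notMem h]
  have hact : ∀ s ∈ c.mdp.states, ∀ a ∈ c.mdp.enabled s, ∃ y ∈ b.mdp.states,
      mergeMap R r y = s ∧ a ∈ b.mdp.enabled y ∧ c.U s a = b.U y a ∧ c.L s a = b.L y a ∧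
      (∀ f, c.mdp.mean s a f = b.mdp.mean y a (fun t => f (mergeMap R r t))) ∧
      c.mdp.trans s a = (b.mdp.trans y a).map (mergeMap R r) ∧ (y ∈ R → r ∈ R ∧ a ∉ B) := by
    intro s hs a ha
    obtain ⟨y, hy, hys, hay, htr, hU, hL, hyR⟩ := hm.action s hs a ha
    exact ⟨y, hy, hys, hay, hU, hL, fun f => MDP.mean_of_map htr
      (fun _ ht => hV.mem_states hy hay ht) hgmem f, htr, hyR⟩
  have hmeanV : ∀ {s a y}, (∀ f, c.mdp.mean s a f =
      b.mdp.mean y a (fun t => f (mergeMap R r t))) →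
      c.mdp.mean s a (value M F) = b.mdp.mean y a (value M F) := by
    intro s a y h
    rw [h]
    exact MDP.mean_congr fun t ht _ => hval t ht
  have hlow : ∀ s ∈ c.mdp.states, ∀ a ∈ c.mdp.enabled s, 0 ≤ c.L s a := by
    intro s hs a ha
    obtain ⟨y, hy, -, hay, -, hL, -⟩ := hact s hs a ha
    rw [hL]
    exact hb.lower_nonneg y hy a hay
  have hU1 : ∀ s ∈ c.mdp.states, ∀ a ∈ c.mdp.enabled s, c.U s a ≤ 1 := by
    intro s hs a ha
    obtain ⟨y, hy, -, hay, hU, -⟩ := hact s hs a ha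
    rw [hU]
    exact hb.upper_le_one y hy a hay
  have hUle : ∀ s ∈ c.mdp.states, ∀ a ∈ c.mdp.enabled s,
      ∃ y ∈ b.mdp.states, mergeMap R r y = s ∧ c.U s a ≤ b.mdp.best b.U y ∧ (y ∈ R → r ∈ R) := by
    intro s hs a ha
    obtain ⟨y, hy, hys, hay, hU, -, -, -, hyR⟩ := hact s hs a ha
    exact ⟨y, hy, hys, hU.trans_le (b.mdp.le_best _ hay), fun h => (hyR h).1⟩
  have hLle : ∀ s ∈ c.mdp.states, ∀ y ∈ b.mdp.states, mergeMap R r y = s →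
      ∀ a ∈ b.mdp.enabled y, a ∈ c.mdp.enabled s → b.L y a = c.L s a ∧
        c.mdp.trans s a = (b.mdp.trans y a).map (mergeMap R r) := by
    intro s hs y hy hys a hay ha
    obtain ⟨y', hy', -, hay', -, hL, -, htr, -⟩ := hact s hs a ha
    rw [hV.eq_of_mem_enabled hy hy' hay hay']
    exact ⟨hL.symm, htr⟩
  have hupz : ∀ a ∈ c.mdp.enabled zero, c.U zero a = 0 := by
    intro a ha
    obtain ⟨y, hy, hyz, hay, hU, -, -, -, hyR⟩ := hact zero hqc.zero_mem a ha
    by_cases h : y ∈ R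
    · rw [mergeMap_of_mem h] at hyz
      exact absurd (hyz ▸ (hyR h).1) h0R
    · rw [mergeMap_of_notMem h] at hyz
      subst hyz
      rw [hU, hb.upper_zero a hay]
  have hlow1 : ∀ a ∈ c.mdp.enabled one, c.L one a = 1 := by
    intro a ha
    obtain ⟨y, hy, hyz, hay, -, hL, -, -, hyR⟩ := hact one hqc.one_mem a ha
    by_cases h : y ∈ R
    · rw [mergeMap_of_mem h] at hyz
      exact absurd (hyz ▸ (hyR h).1) h1R
    · rw [mergeMap_of_notMem h] at hyz
      subst hyz
      rw [hL, hb.lower_one a hay]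
  -- If `r` is in `R`, the maximum of U is the same at all states of `R`, being superharmonic, so
  -- `r` inherits at most that. At `one` the old bound on `R` was at least V = 1, and at `zero` the
  -- new bound is 0.
  have hbU : ∀ t ∈ b.mdp.states, c.mdp.best c.U (mergeMap R r t) ≤ b.mdp.best b.U t := by
    intro t ht
    obtain ⟨a, ha, hbest⟩ := c.mdp.exists_eq_best c.U (hqc.enabled_nonempty _ (hgmem t ht))
    obtain ⟨y, hy, hyt, hle, hyr⟩ := hUle _ (hgmem t ht) a ha
    rw [← hbest]
    by_cases h : t ∈ R
    · rw [mergeMap_of_mem h] at hyt ha hbest hle ⊢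
      rcases hm.cases with h' | h' | h'
      · refine hle.trans_eq ?_
        have hyR : y ∈ R := by
          by_contra hc
          rw [mergeMap_of_notMem hc] at hyt
          exact hc (hyt ▸ h'.1)
        exact hR.eq_of_mean_le hV (fun x hx d hd =>
          (hb.super x (hR.states_subset hx) d hd).trans (b.mdp.le_best _ hd)) hyR h
      · have hv := hval t ht
        rw [mergeMap_of_mem h, h'.1, IsQuotient.value_one hS] at hv
        have hrc := hgmem t ht
        rw [mergeMap_of_mem h] at hrc
        linarith [hU1 r hrc a ha, hb.value_le_best hS ht]
      · have hz : c.U r a = 0 := by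
          have := h'.1
          subst this
          exact hupz a ha
        rw [hz]
        exact (value_nonneg M F t).trans (hb.value_le_best hS ht)
    · rw [mergeMap_of_notMem h] at hyt ha hbest hle ⊢
      by_cases hyR : y ∈ R
      · rw [mergeMap_of_mem hyR] at hyt
        exact absurd (hyt ▸ hyr hyR) h
      · rw [mergeMap_of_notMem hyR] at hyt
        exact hyt ▸ hle
  have hbL : ∀ t ∈ b.mdp.states, b.mdp.best b.L t ≤ c.mdp.best c.L (mergeMap R r t) := by
    intro t ht
    have hnn : 0 ≤ c.mdp.best c.L (mergeMap R r t) := by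
      obtain ⟨a, ha⟩ := hqc.enabled_nonempty _ (hgmem t ht)
      exact (hlow _ (hgmem t ht) a ha).trans (c.mdp.le_best _ ha)
    by_cases h : t ∈ R
    · rcases hm.cases with h' | h' | h'
      -- The field `justified` with X = `R`: a positive maximum of L on `R` comes from an action
      -- that may leave `R`. It is not in `B` and survives the merge.
      · obtain ⟨x0, hx0, hmax⟩ := R.exists_max_image (b.mdp.best b.L) ⟨t, h⟩
        rcases le_or_gt (b.mdp.best b.L x0) 0 with hle | hlt
        · exact (hmax t h).trans (hle.trans hnn)
        · obtain ⟨x, hx, a, ha, hxa, u, hu, huR⟩ := hb.justified R hR.states_subset h1R _ hlt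
            hmax ⟨x0, hx0, rfl⟩
          have haB : a ∉ B := fun haB =>
            huR (hR.closed x hx a haB ha ((PMF.mem_support_iff _ _).2 hu))
          have hac := hm.enabled_in h'.1 x hx a ha haB
          refine (hmax t h).trans ?_
          have hrc := hgmem t ht
          rw [mergeMap_of_mem h] at hrc ⊢
          rw [← hxa, (hLle r hrc x (hR.states_subset hx) (mergeMap_of_mem hx) a ha hac).1]
          exact c.mdp.le_best _ hac
      · rw [mergeMap_of_mem h, h'.1]
        obtain ⟨a, ha⟩ := hqc.enabled_nonempty one hqc.one_mem
        have h1 := c.mdp.le_best c.L ha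
        rw [hlow1 a ha] at h1
        exact ((hb.best_le_value hS ht).trans (hq.value_le_one hS ht)).trans h1
      · have hv := hval t ht
        rw [mergeMap_of_mem h, h'.1, IsQuotient.value_zero hS] at hv
        have := hb.best_le_value hS ht
        linarith
    · have htc := hgmem t ht
      rw [mergeMap_of_notMem h] at htc ⊢
      obtain ⟨a, ha, hbest⟩ := b.mdp.exists_eq_best b.L (hq.enabled_nonempty t ht)
      have hac := hm.enabled_off t ht h a ha
      rw [← hbest, (hLle t htc t ht (mergeMap_of_notMem h) a ha hac).1]
      exact c.mdp.le_best _ hac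
  refine ⟨hqc, hlow, ?_, ?_, hU1, ?_, ?_, ?_, hupz, hlow1⟩
  · intro s hs a ha
    obtain ⟨y, hy, -, hay, -, hL, hmean, -⟩ := hact s hs a ha
    rw [hL, hmeanV hmean]
    exact hb.lower y hy a hay
  · intro s hs a ha
    obtain ⟨y, hy, -, hay, hU, -, hmean, -⟩ := hact s hs a ha
    rw [hU, hmeanV hmean]
    exact hb.upper y hy a hay
  · intro s hs a ha
    obtain ⟨y, hy, -, hay, hU, -, hmean, -⟩ := hact s hs a ha
    rw [hU, hmean]
    exact (MDP.mean_mono fun t ht _ => hbU t ht).trans (hb.super y hy a hay)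
  · intro s hs a ha
    obtain ⟨y, hy, -, hay, -, hL, hmean, -⟩ := hact s hs a ha
    rw [hL, hmean]
    exact (hb.sub y hy a hay).trans (MDP.mean_mono fun t ht _ => hbL t ht)
  · rintro X hX h1X l hl hle ⟨s, hs, hsl⟩
    -- The preimage of `X`: the old `justified` for `Y` gives an action that leaves `Y`, and its
    -- image leaves `X`.
    let Y := b.mdp.states.filter fun t => mergeMap R r t ∈ X
    have hY1 : one ∉ Y := by
      intro h
      have := (Finset.mem_filter.1 h).2
      rw [mergeMap_of_notMem h1R] at this
      exact h1X this
    have hYle : ∀ t ∈ Y, b.mdp.best b.L t ≤ l := fun t ht =>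
      (hbL t (Finset.mem_filter.1 ht).1).trans (hle _ (Finset.mem_filter.1 ht).2)
    have hYex : ∃ t ∈ Y, b.mdp.best b.L t = l := by
      obtain ⟨a, ha, hbest⟩ := c.mdp.exists_eq_best c.L (hqc.enabled_nonempty s (hX hs))
      obtain ⟨y, hy, hys, hay, -, hL, -⟩ := hact s (hX hs) a ha
      have hyY : y ∈ Y := Finset.mem_filter.2 ⟨hy, by rw [hys]; exact hs⟩
      refine ⟨y, hyY, le_antisymm (hYle y hyY) ?_⟩
      rw [← hsl, ← hbest, hL]
      exact b.mdp.le_best _ hay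
    obtain ⟨x, hx, a, ha, hxa, t, ht, htY⟩ :=
      hb.justified Y (Finset.filter_subset _ _) hY1 l hl hYle hYex
    obtain ⟨hxs, hxX⟩ := Finset.mem_filter.1 hx
    have hac : a ∈ c.mdp.enabled (mergeMap R r x) := by
      by_cases hxR : x ∈ R
      -- An action of `B` leads from `x` to a state with the same image, which would be in `Y` as
      -- well.
      · have haB : a ∉ B := by
          intro haB
          have htR : t ∈ R := hR.closed x hxR a haB ha ((PMF.mem_support_iff _ _).2 ht)
          refine htY (Finset.mem_filter.2 ⟨hR.states_subset htR, ?_⟩)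
          rw [mergeMap_of_mem htR, ← mergeMap_of_mem (r := r) hxR]
          exact hxX
        rw [mergeMap_of_mem hxR] at hxX ⊢
        rcases hm.cases with h' | h' | h'
        · exact hm.enabled_in h'.1 x hxR a ha haB
        · exact absurd (h'.1 ▸ hxX) h1X
        · exact absurd (h'.2.2 x hxR a ha) haB
      · rw [mergeMap_of_notMem hxR]
        exact hm.enabled_off x hxs hxR a ha
    obtain ⟨hLx, htr⟩ := hLle _ (hgmem x hxs) x hxs rfl a ha hac
    refine ⟨_, hxX, a, hac, hLx ▸ hxa, mergeMap R r t, ?_, fun h => htY ?_⟩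
    · rw [htr, pmf_map_apply_ne_zero_iff]
      exact ⟨t, ht, rfl⟩
    · exact Finset.mem_filter.2 ⟨hV.mem_states hxs ha ht, h⟩

end Merging

/-! ### Identification of end components in the explored part -/

section Identification

open scoped ENNReal

universe u v
variable {S : Type u} {A : Type v}

/-! ### End components of the explored part -/

theorem MDP.mem_explored_enabled {M : MDP S A} {T : Finset S} {s : S} (hs : s ∈ T)
    {a : Option A} : a ∈ (M.explored T).enabled s ↔ ∃ a' ∈ M.enabled s, some a' = a := by
  simp [MDP.explored, hs]

theorem MDP.IsEC.exists_enabled {M : MDP S A} {R : Finset S} {B : Finset A} (h : M.IsEC R B)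
    {a : A} (ha : a ∈ B) : ∃ s ∈ R, a ∈ M.enabled s :=
  Finset.mem_biUnion.1 (h.actions_subset ha)

theorem MDP.subset_biUnion_enabled {M : MDP S A} {R : Finset S} {B : Finset A}
    (h : ∀ a ∈ B, ∃ s ∈ R, a ∈ M.enabled s) : B ⊆ R.biUnion M.enabled :=
  fun a ha => Finset.mem_biUnion.2 (h a ha)

/-- The extra action `none` is enabled only outside `T`, so inside `R ⊆ T` nothing but actions of M
is seen. -/
theorem MDP.IsEC.of_explored {M : MDP S A} {T : Finset S} (hT : T ⊆ M.states) {R : Finset S}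
    (hRT : R ⊆ T) {B : Finset (Option A)} (h : (M.explored T).IsEC R B) :
    M.IsEC R (Finset.eraseNone B) where
  states_subset := hRT.trans hT
  actions_subset := by
    intro a ha
    obtain ⟨s, hs, hsa⟩ := h.exists_enabled (Finset.mem_eraseNone.1 ha)
    obtain ⟨a', ha', h'⟩ := (MDP.mem_explored_enabled (hRT hs)).1 hsa
    exact Finset.mem_biUnion.2 ⟨s, hs, Option.some_injective _ h' ▸ ha'⟩
  nonempty := by
    obtain ⟨a, ha⟩ := h.nonempty
    obtain ⟨s, hs, hsa⟩ := h.exists_enabled ha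
    obtain ⟨a', ha', rfl⟩ := (MDP.mem_explored_enabled (hRT hs)).1 hsa
    exact ⟨a', Finset.mem_eraseNone.2 ha⟩
  closed := fun s hs a haB ha => h.closed s hs (some a) (Finset.mem_eraseNone.1 haB)
    ((MDP.mem_explored_enabled (hRT hs)).2 ⟨a, ha, rfl⟩)
  connected := by
    intro s hs t ht
    have key : ∀ t, Relation.ReflTransGen (fun x y => ∃ a ∈ B, a ∈ (M.explored T).enabled x ∧
        0 < (M.explored T).trans x a y) s t → t ∈ R ∧ Relation.ReflTransGen
          (fun x y => ∃ a ∈ Finset.eraseNone B, a ∈ M.enabled x ∧ 0 < M.trans x a y) s t := by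
      intro t ht
      induction ht with
      | refl => exact ⟨hs, Relation.ReflTransGen.refl⟩
      | tail _ hstep ih =>
        obtain ⟨a, haB, ha, hpos⟩ := hstep
        obtain ⟨a', ha', rfl⟩ := (MDP.mem_explored_enabled (hRT ih.1)).1 ha
        exact ⟨h.closed _ ih.1 _ haB ha ((PMF.mem_support_iff _ _).2 hpos.ne'),
          ih.2.tail ⟨a', Finset.mem_eraseNone.2 haB, ha', hpos⟩⟩
    exact (key t (h.connected s hs t ht)).2

theorem MDP.IsEC.explored {M : MDP S A} {T R : Finset S} (hRT : R ⊆ T) {B : Finset A}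
    (h : M.IsEC R B) : (M.explored T).IsEC R (B.map Function.Embedding.some) where
  states_subset := fun s hs => Finset.mem_union_left _ (hRT hs)
  actions_subset := by
    refine MDP.subset_biUnion_enabled fun a ha => ?_
    obtain ⟨a', ha', rfl⟩ := Finset.mem_map.1 ha
    obtain ⟨s, hs, hsa⟩ := h.exists_enabled ha'
    exact ⟨s, hs, (MDP.mem_explored_enabled (hRT hs)).2 ⟨a', hsa, rfl⟩⟩
  nonempty := h.nonempty.map
  closed := by
    intro s hs a haB ha
    obtain ⟨a', ha', rfl⟩ := (MDP.mem_explored_enabled (hRT hs)).1 ha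
    exact h.closed s hs a' (by simpa using haB) ha'
  connected := by
    intro s hs t ht
    have key : ∀ t, Relation.ReflTransGen
          (fun x y => ∃ a ∈ B, a ∈ M.enabled x ∧ 0 < M.trans x a y) s t → t ∈ R ∧
        Relation.ReflTransGen (fun x y => ∃ a ∈ B.map Function.Embedding.some,
          a ∈ (M.explored T).enabled x ∧ 0 < (M.explored T).trans x a y) s t := by
      intro t ht
      induction ht with
      | refl => exact ⟨hs, Relation.ReflTransGen.refl⟩
      | tail _ hstep ih =>
        obtain ⟨a, haB, ha, hpos⟩ := hstep
        exact ⟨h.closed _ ih.1 a haB ha ((PMF.mem_support_iff _ _).2 hpos.ne'),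
          ih.2.tail ⟨some a, Finset.mem_map_of_mem _ haB,
            (MDP.mem_explored_enabled (hRT ih.1)).2 ⟨a, ha, rfl⟩, hpos⟩⟩
    exact (key t (h.connected s hs t ht)).2

/-- The union of two end components with a common state is an end component. -/
theorem MDP.IsEC.union {M : MDP S A} {R₁ R₂ : Finset S} {B₁ B₂ : Finset A}
    (hdisj : ∀ s ∈ R₁ ∪ R₂, ∀ t ∈ R₁ ∪ R₂, ∀ a ∈ M.enabled s, a ∈ M.enabled t → s = t)
    (h₁ : M.IsEC R₁ B₁) (h₂ : M.IsEC R₂ B₂) {x : S} (hx₁ : x ∈ R₁) (hx₂ : x ∈ R₂) :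
    M.IsEC (R₁ ∪ R₂) (B₁ ∪ B₂) where
  states_subset := Finset.union_subset h₁.states_subset h₂.states_subset
  actions_subset := by
    rw [Finset.union_biUnion]
    exact Finset.union_subset_union h₁.actions_subset h₂.actions_subset
  nonempty := h₁.nonempty.mono Finset.subset_union_left
  closed := by
    intro s hs a haB ha
    rw [Finset.coe_union]
    rcases Finset.mem_union.1 haB with haB | haB
    · obtain ⟨t, ht, hta⟩ := Finset.mem_biUnion.1 (h₁.actions_subset haB)
      rw [hdisj s hs t (Finset.mem_union_left _ ht) a ha hta]
      exact (h₁.closed t ht a haB hta).trans Set.subset_union_left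
    · obtain ⟨t, ht, hta⟩ := Finset.mem_biUnion.1 (h₂.actions_subset haB)
      rw [hdisj s hs t (Finset.mem_union_right _ ht) a ha hta]
      exact (h₂.closed t ht a haB hta).trans Set.subset_union_right
  connected := by
    have hmono₁ : ∀ s ∈ R₁, ∀ t ∈ R₁, Relation.ReflTransGen
        (fun x y => ∃ a ∈ B₁ ∪ B₂, a ∈ M.enabled x ∧ 0 < M.trans x a y) s t := fun s hs t ht =>
      Relation.ReflTransGen.mono (fun _ _ ⟨a, haB, h⟩ => ⟨a, Finset.mem_union_left _ haB, h⟩)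
        _ _ (h₁.connected s hs t ht)
    have hmono₂ : ∀ s ∈ R₂, ∀ t ∈ R₂, Relation.ReflTransGen
        (fun x y => ∃ a ∈ B₁ ∪ B₂, a ∈ M.enabled x ∧ 0 < M.trans x a y) s t := fun s hs t ht =>
      Relation.ReflTransGen.mono (fun _ _ ⟨a, haB, h⟩ => ⟨a, Finset.mem_union_right _ haB, h⟩)
        _ _ (h₂.connected s hs t ht)
    intro s hs t ht
    refine Relation.ReflTransGen.trans (b := x) ?_ ?_
    · rcases Finset.mem_union.1 hs with hs | hs
      · exact hmono₁ s hs x hx₁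
      · exact hmono₂ s hs x hx₂
    · rcases Finset.mem_union.1 ht with ht | ht
      · exact hmono₁ x hx₁ t ht
      · exact hmono₂ x hx₂ t ht

/-- Both are maximal, so each equals their union. This makes the identified components pairwise
disjoint. -/
theorem MDP.IsMEC.eq {M : MDP S A} {R₁ R₂ : Finset S} {B₁ B₂ : Finset A}
    (h₁ : M.IsMEC R₁ B₁) (h₂ : M.IsMEC R₂ B₂)
    (hdisj : ∀ s ∈ R₁ ∪ R₂, ∀ t ∈ R₁ ∪ R₂, ∀ a ∈ M.enabled s, a ∈ M.enabled t → s = t)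
    {x : S} (hx₁ : x ∈ R₁) (hx₂ : x ∈ R₂) : R₁ = R₂ ∧ B₁ = B₂ := by
  have hunion := MDP.IsEC.union hdisj h₁.1 h₂.1 hx₁ hx₂
  have e₁ := h₁.2 _ _ hunion Finset.subset_union_left Finset.subset_union_left
  have e₂ := h₂.2 _ _ hunion Finset.subset_union_right Finset.subset_union_right
  exact ⟨e₁.1.symm.trans e₂.1, e₁.2.symm.trans e₂.2⟩

theorem MDP.mem_identifyECs {M : MDP S A} {T : Finset S} {P : Finset S × Finset A} :
    P ∈ M.identifyECs T ↔ ∃ B, P.1 ⊆ T ∧ (M.explored T).IsMEC P.1 B ∧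
      P.2 = Finset.eraseNone B := by
  simp only [MDP.identifyECs, Finset.mem_image, Finset.mem_filter, Finset.mem_product,
    Finset.mem_powerset]
  constructor
  · rintro ⟨⟨R, B⟩, ⟨⟨hR, -⟩, hmec⟩, rfl⟩
    exact ⟨B, hR, hmec, rfl⟩
  · rintro ⟨B, hR, hmec, hB⟩
    refine ⟨(P.1, B), ⟨⟨hR, fun a ha => ?_⟩, hmec⟩, Prod.ext rfl hB.symm⟩
    obtain ⟨s, hs, hsa⟩ := hmec.1.exists_enabled ha
    exact Finset.mem_biUnion.2 ⟨s, hR hs, hsa⟩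

theorem MDP.IsValid.isEC_of_mem_identifyECs {M : MDP S A} {T : Finset S}
    (hT : T ⊆ M.states) {P : Finset S × Finset A} (hP : P ∈ M.identifyECs T) :
    M.IsEC P.1 P.2 ∧ P.1 ⊆ T := by
  obtain ⟨B, hR, hmec, hB⟩ := MDP.mem_identifyECs.1 hP
  rw [hB]
  exact ⟨hmec.1.of_explored hT hR, hR⟩

theorem MDP.IsValid.disjoint_of_mem_identifyECs {M : MDP S A} (hM : M.IsValid) {T : Finset S}
    (hT : T ⊆ M.states) {P Q : Finset S × Finset A} (hP : P ∈ M.identifyECs T)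
    (hQ : Q ∈ M.identifyECs T) (hPQ : P ≠ Q) : Disjoint P.1 Q.1 := by
  obtain ⟨B, hR, hmec, hB⟩ := MDP.mem_identifyECs.1 hP
  obtain ⟨C, hR', hmec', hC⟩ := MDP.mem_identifyECs.1 hQ
  rw [Finset.disjoint_left]
  intro x hx hx'
  have hdisj : ∀ s ∈ P.1 ∪ Q.1, ∀ t ∈ P.1 ∪ Q.1, ∀ a ∈ (M.explored T).enabled s,
      a ∈ (M.explored T).enabled t → s = t := by
    intro s hs t ht a hsa hta
    have hs' := Finset.union_subset hR hR' hs
    have ht' := Finset.union_subset hR hR' ht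
    obtain ⟨a₁, ha₁, rfl⟩ := (MDP.mem_explored_enabled hs').1 hsa
    obtain ⟨a₂, ha₂, h⟩ := (MDP.mem_explored_enabled ht').1 hta
    exact hM.eq_of_mem_enabled (hT hs') (hT ht') ha₁ (Option.some_injective _ h ▸ ha₂)
  obtain ⟨h1, h2⟩ := hmec.eq hmec' hdisj hx hx'
  exact hPQ (Prod.ext h1 (by rw [hB, hC, h2]))

/-- An end component inside the explored set is contained in an identified one. -/
theorem MDP.IsEC.identifyECs_nonempty [Finite S] [Finite A] {M : MDP S A} {T R : Finset S}
    (hRT : R ⊆ T) {B : Finset A} (h : M.IsEC R B) : (M.identifyECs T).Nonempty := by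
  have hE := h.explored hRT
  obtain ⟨⟨R', B'⟩, hle, hmax⟩ := Set.Finite.exists_le_maximal
    (s := {P : Finset S × Finset (Option A) | (M.explored T).IsEC P.1 P.2}) (Set.toFinite _)
    (a := (R, B.map Function.Embedding.some)) hE
  have hEC : (M.explored T).IsEC R' B' := hmax.prop
  obtain ⟨x, hx⟩ := h.states_nonempty
  -- A state outside `T` has only its self-loop, so it cannot be connected to the state `x` of `R'`
  -- that lies in `T`.
  have hR'T : R' ⊆ T := by
    intro y hy
    by_contra hyT
    have hstay : ∀ z, Relation.ReflTransGen (fun x y => ∃ a ∈ B', a ∈ (M.explored T).enabled x ∧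
        0 < (M.explored T).trans x a y) y z → z = y := by
      intro z hz
      induction hz with
      | refl => rfl
      | tail _ hstep ih =>
        subst ih
        obtain ⟨a, -, ha, hpos⟩ := hstep
        simp only [MDP.explored, if_neg hyT, Finset.mem_singleton] at ha hpos
        subst ha
        by_contra hne
        simp [PMF.pure_apply, hne] at hpos
    have := hstay x (hEC.connected y hy x (hle.1 hx))
    exact hyT (this ▸ hRT hx)
  refine ⟨(R', Finset.eraseNone B'), MDP.mem_identifyECs.2 ⟨B', hR'T, ⟨hEC, ?_⟩, rfl⟩⟩
  intro R'' B'' hEC'' hR hB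
  have := hmax.le_of_ge (y := (R'', B'')) hEC'' ⟨hR, hB⟩
  exact ⟨(this.1).antisymm hR, (this.2).antisymm hB⟩

/-! ### Processing a list of end components -/

/-- All enabled actions of an MDP. -/
def MDP.actions (M : MDP S A) : Finset A := M.states.biUnion M.enabled

variable {F : Set S} {one zero : S} {b c : Bounds S A} {R : Finset S} {B : Finset A} {r : S}

/-- The list of components is computed once, before any of them is processed. Those still to come
survive each merge because they are disjoint from the merged set. -/
theorem IsMerge.isEC (hm : IsMerge F one zero b c R B r) {Q : Finset S} {C : Finset A}
    (hQ : b.mdp.IsEC Q C) (hdisj : Disjoint R Q) : c.mdp.IsEC Q C := by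
  have hQR : ∀ q ∈ Q, q ∉ R := fun q hq hqR => Finset.disjoint_left.1 hdisj hqR hq
  have hmem : ∀ q ∈ Q, q ∈ c.mdp.states := fun q hq =>
    (hm.mem_states q).2 (Or.inr ⟨hQ.states_subset hq, hQR q hq⟩)
  have hact : ∀ q ∈ Q, ∀ a ∈ c.mdp.enabled q, a ∈ b.mdp.enabled q ∧
      c.mdp.trans q a = (b.mdp.trans q a).map (mergeMap R r) := by
    intro q hq a ha
    obtain ⟨y, hy, hyq, hay, htr, -, -, hyR⟩ := hm.action q (hmem q hq) a ha
    by_cases h : y ∈ R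
    · rw [mergeMap_of_mem h] at hyq
      exact absurd (hyq ▸ (hyR h).1) (hQR q hq)
    · rw [mergeMap_of_notMem h] at hyq
      subst hyq
      exact ⟨hay, htr⟩
  refine ⟨hmem, ?_, hQ.nonempty, ?_, ?_⟩
  · intro a ha
    obtain ⟨s, hs, hsa⟩ := Finset.mem_biUnion.1 (hQ.actions_subset ha)
    exact Finset.mem_biUnion.2
      ⟨s, hs, hm.enabled_off s (hQ.states_subset hs) (hQR s hs) a hsa⟩
  · intro s hs a haC ha t ht
    obtain ⟨hab, htr⟩ := hact s hs a ha
    rw [htr, PMF.mem_support_map_iff] at ht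
    obtain ⟨t', ht', rfl⟩ := ht
    have := hQ.closed s hs a haC hab ht'
    rw [mergeMap_of_notMem (hQR t' this)]
    exact this
  · intro s hs t ht
    have key : ∀ t, Relation.ReflTransGen
          (fun x y => ∃ a ∈ C, a ∈ b.mdp.enabled x ∧ 0 < b.mdp.trans x a y) s t → t ∈ Q ∧
        Relation.ReflTransGen
          (fun x y => ∃ a ∈ C, a ∈ c.mdp.enabled x ∧ 0 < c.mdp.trans x a y) s t := by
      intro t ht
      induction ht with
      | refl => exact ⟨hs, Relation.ReflTransGen.refl⟩
      | @tail x y _ hstep ih =>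
        obtain ⟨a, haC, ha, hpos⟩ := hstep
        have hyQ : y ∈ Q := hQ.closed x ih.1 a haC ha ((PMF.mem_support_iff _ _).2 hpos.ne')
        have hac := hm.enabled_off x (hQ.states_subset ih.1) (hQR x ih.1) a ha
        refine ⟨hyQ, ih.2.tail ⟨a, haC, hac, ?_⟩⟩
        rw [(hact x ih.1 a hac).2, pos_iff_ne_zero, pmf_map_apply_ne_zero_iff]
        exact ⟨y, hpos.ne', mergeMap_of_notMem (hQR y hyQ)⟩
    exact (key t (hQ.connected s hs t ht)).2

/-- The actions of the nonempty set `B` lose their owner and no action is created. The number of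
actions is thus a variant that bounds the number of collapses. -/
theorem IsMerge.card_actions_lt (hV : b.mdp.IsValid) (hR : b.mdp.IsEC R B)
    (hm : IsMerge F one zero b c R B r) : c.mdp.actions.card < b.mdp.actions.card := by
  refine Finset.card_lt_card (Finset.ssubset_iff_of_subset ?_ |>.2 ?_)
  · intro a ha
    obtain ⟨s, hs, hsa⟩ := Finset.mem_biUnion.1 ha
    obtain ⟨y, hy, -, hay, -⟩ := hm.action s hs a hsa
    exact Finset.mem_biUnion.2 ⟨y, hy, hay⟩
  · obtain ⟨a, ha⟩ := hR.nonempty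
    obtain ⟨x, hx, hxa⟩ := Finset.mem_biUnion.1 (hR.actions_subset ha)
    refine ⟨a, Finset.mem_biUnion.2 ⟨x, hR.states_subset hx, hxa⟩, fun h => ?_⟩
    obtain ⟨s, hs, hsa⟩ := Finset.mem_biUnion.1 h
    obtain ⟨y, hy, -, hay, -, -, -, hyR⟩ := hm.action s hs a hsa
    have hxy := hV.eq_of_mem_enabled hy (hR.states_subset hx) hay hxa
    exact (hyR (hxy ▸ hx)).2 ha

variable [Finite S] [Finite A] {M : MDP S A} {proj : S → S}

theorem Bounds.IsSound.foldl_processEC (hS : Setting M F one zero)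
    (l : List (Finset S × Finset A)) (hl : l.Pairwise fun P Q => Disjoint P.1 Q.1)
    {b : Bounds S A} {proj : S → S} (hb : b.IsSound M F one zero proj)
    (hEC : ∀ P ∈ l, b.mdp.IsEC P.1 P.2 ∧ one ∉ P.1 ∧ zero ∉ P.1) :
    ∃ proj', (l.foldl (Bounds.processEC F one zero) b).IsSound M F one zero proj' ∧
      (l ≠ [] → (l.foldl (Bounds.processEC F one zero) b).mdp.actions.card <
        b.mdp.actions.card) := by
  induction l generalizing b proj with
  | nil => exact ⟨proj, hb, fun h => absurd rfl h⟩
  | cons P l ih =>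
    rw [List.pairwise_cons] at hl
    obtain ⟨hP, h1, h0⟩ := hEC P List.mem_cons_self
    have hV := hb.isValid hS
    obtain ⟨r, hm⟩ := isMerge_processEC (F := F) hV hb.quot.one_mem hb.quot.zero_mem hP h1 h0
    obtain ⟨proj', hsound, hcard⟩ := ih hl.2 (hm.isSound hS hb hP h1 h0) fun Q hQ => by
      obtain ⟨hQ', hQ1, hQ0⟩ := hEC Q (List.mem_cons_of_mem _ hQ)
      exact ⟨hm.isEC hQ' (hl.1 Q hQ), hQ1, hQ0⟩
    refine ⟨proj', hsound, fun _ => ?_⟩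
    have hlt := hm.card_actions_lt hV hP
    rw [List.foldl_cons]
    by_cases hnil : l = []
    · subst hnil
      exact hlt
    · exact (hcard hnil).trans hlt

/-- The on-the-fly processing of end components keeps the invariant, and it either changes nothing
or removes some action. -/
theorem Bounds.IsSound.onTheFlyEC (hS : Setting M F one zero) (hb : b.IsSound M F one zero proj)
    {T : Finset S} (hT : T ⊆ b.mdp.states) (h1 : one ∉ T) (h0 : zero ∉ T) :
    (∃ proj', (b.onTheFlyEC F one zero T).IsSound M F one zero proj') ∧
      ((b.mdp.identifyECs T = ∅ ∧ b.onTheFlyEC F one zero T = b) ∨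
        (b.onTheFlyEC F one zero T).mdp.actions.card < b.mdp.actions.card) := by
  have hV := hb.isValid hS
  have hEC : ∀ P ∈ (b.mdp.identifyECs T).toList,
      b.mdp.IsEC P.1 P.2 ∧ one ∉ P.1 ∧ zero ∉ P.1 := by
    intro P hP
    obtain ⟨h, hPT⟩ := MDP.IsValid.isEC_of_mem_identifyECs hT (Finset.mem_toList.1 hP)
    exact ⟨h, fun h => h1 (hPT h), fun h => h0 (hPT h)⟩
  have hpw : (b.mdp.identifyECs T).toList.Pairwise fun P Q => Disjoint P.1 Q.1 := by
    refine List.Pairwise.imp_of_mem ?_ (Finset.nodup_toList (b.mdp.identifyECs T))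
    intro P Q hP hQ hne
    exact hV.disjoint_of_mem_identifyECs hT (Finset.mem_toList.1 hP) (Finset.mem_toList.1 hQ) hne
  obtain ⟨proj', hsound, hcard⟩ := hb.foldl_processEC hS _ hpw hEC
  refine ⟨⟨proj', hsound⟩, ?_⟩
  by_cases hE : b.mdp.identifyECs T = ∅
  · refine Or.inl ⟨hE, ?_⟩
    rw [Bounds.onTheFlyEC, hE, Finset.toList_empty, List.foldl_nil]
  · exact Or.inr (hcard fun h => hE (Finset.toList_eq_nil.1 h))

end Identification

/-! ### Invariants of configurations and almost sure properties of runs -/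

section Configurations

open scoped ENNReal

universe u v
variable {S : Type u} {A : Type v} [Finite S] [Finite A]

/-- The invariant of the configurations of the algorithm. -/
structure Config.IsSound (M : MDP S A) (F : Set S) (one zero : S) (ε : ℝ) (k : ℕ → ℕ)
    (c : Config S A) : Prop where
  bounds : ∃ proj, c.bounds.IsSound M F one zero proj
  halted : c.halted = true → c.bounds.gap < ε
  path : ∀ m ∈ c.path, m.state ∈ c.bounds.mdp.states ∧ m.action ∈ c.bounds.mdp.enabled m.state ∧
    m.state ≠ one ∧ m.state ≠ zero
  last_mem : c.last ∈ c.bounds.mdp.states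
  last : (c.path = [] ∧ c.last = c.bounds.mdp.start) ∨
    (c.path ≠ [] ∧ c.last ≠ one ∧ c.last ≠ zero)
  length : c.path.length + 1 < k c.iter

variable {M : MDP S A} {F : Set S} {one zero : S} {ε : ℝ} {k : ℕ → ℕ} {c : Config S A}

omit [Finite S] [Finite A] in
theorem MDP.mem_bestActions {M : MDP S A} {f : S → A → ℝ} {s : S} {a : A} :
    a ∈ M.bestActions f s ↔ a ∈ M.enabled s ∧ f s a = M.best f s := by
  simp [MDP.bestActions]

theorem Config.IsSound.begin (hk : ∀ i, 3 ≤ k i) {b : Bounds S A} {proj : S → S}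
    (hS : Setting M F one zero) (hb : b.IsSound M F one zero proj) (i : ℕ) (h : Bool)
    (hh : h = true → b.gap < ε) : (Config.begin b i h).IsSound M F one zero ε k where
  bounds := ⟨proj, hb⟩
  halted := hh
  path := by simp [Config.begin]
  last_mem := (hb.isValid hS).start_mem
  last := Or.inl ⟨rfl, rfl⟩
  length := by
    have := hk i
    simp only [Config.begin, List.length_nil]
    omega

omit [Finite S] [Finite A] in
theorem Config.mem_support_next (hc : c.halted = false)
    (hne : (c.bounds.mdp.bestActions c.bounds.U c.last).Nonempty) {d : Config S A} :
    d ∈ (c.next F one zero ε k).support ↔ ∃ a ∈ c.bounds.mdp.bestActions c.bounds.U c.last,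
      ∃ t, c.bounds.mdp.trans c.last a t ≠ 0 ∧ d = c.advance F one zero ε k a t := by
  rw [Config.next, dif_pos ⟨hc, hne⟩, PMF.mem_support_bind_iff]
  simp only [PMF.mem_support_uniformOfFinset_iff, PMF.mem_support_map_iff]
  refine exists_congr fun a => and_congr_right fun _ => exists_congr fun t => ?_
  rw [PMF.mem_support_iff, eq_comm (a := d)]

omit [Finite S] [Finite A] in
-- Only an inequality, because different moves may lead to the same configuration. The bound depends
-- only on the argmax set and the MDP, not on the real-valued bounds, so it stays fixed when a
-- policy recurs.
theorem Config.le_next_advance (hc : c.halted = false) {a : A}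
    (ha : a ∈ c.bounds.mdp.bestActions c.bounds.U c.last) (t : S) :
    ((c.bounds.mdp.bestActions c.bounds.U c.last).card : ℝ≥0∞)⁻¹ *
      c.bounds.mdp.trans c.last a t ≤
      c.next F one zero ε k (c.advance F one zero ε k a t) := by
  rw [Config.next, dif_pos ⟨hc, ⟨a, ha⟩⟩, PMF.bind_apply]
  refine le_trans ?_ (ENNReal.le_tsum a)
  rw [PMF.uniformOfFinset_apply_of_mem _ ha]
  gcongr
  rw [PMF.map_apply]
  refine le_trans ?_ (ENNReal.le_tsum t)
  rw [if_pos rfl]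

theorem Config.IsSound.bestActions_nonempty (hc : c.IsSound M F one zero ε k) {s : S}
    (hs : s ∈ c.bounds.mdp.states) : (c.bounds.mdp.bestActions c.bounds.U s).Nonempty := by
  obtain ⟨proj, hb⟩ := hc.bounds
  obtain ⟨a, ha, h⟩ := c.bounds.mdp.exists_eq_best c.bounds.U (hb.quot.enabled_nonempty _ hs)
  exact ⟨a, MDP.mem_bestActions.2 ⟨ha, h⟩⟩

/-- The three kinds of steps: the path is extended, or it is long enough and end components are
processed, or a terminal state has been reached and the bounds are updated. -/
inductive Config.Step (F : Set S) (one zero : S) (ε : ℝ) (k : ℕ → ℕ) (c : Config S A) (a : A)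
    (t : S) : Config S A → Prop
  | extend (hlen : c.path.length + 2 < k c.iter) (h1 : t ≠ one) (h0 : t ≠ zero) :
      Step F one zero ε k c a t { c with path := ⟨c.last, a⟩ :: c.path, last := t }
  | timeout (hlen : c.path.length + 2 = k c.iter) :
      Step F one zero ε k c a t (Config.begin (c.bounds.onTheFlyEC F one zero
        ((Move.mk c.last a :: c.path).map Move.state).toFinset) (c.iter + 1) false)
  | update (hlen : c.path.length + 2 < k c.iter) (ht : t = one ∨ t = zero) :
      Step F one zero ε k c a t (Config.begin
        ((Move.mk c.last a :: c.path).foldl Bounds.update c.bounds) (c.iter + 1)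
        (decide (((Move.mk c.last a :: c.path).foldl Bounds.update c.bounds).gap < ε)))

omit [Finite S] [Finite A] in
theorem Config.step_advance (h : c.path.length + 1 < k c.iter) (a : A) (t : S) :
    c.Step F one zero ε k a t (c.advance F one zero ε k a t) := by
  unfold Config.advance
  dsimp only
  split_ifs with h1 h2
  · exact Config.Step.timeout (by simpa using h1)
  · refine Config.Step.update ?_ h2
    simp only [List.length_cons] at h1
    omega
  · push Not at h2
    refine Config.Step.extend ?_ h2.1 h2.2
    simp only [List.length_cons] at h1
    omega

/-- The path of a configuration, extended by an enabled action, consists of enabled pairs. -/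
theorem Config.IsSound.mem_path_cons (hc : c.IsSound M F one zero ε k) {a : A}
    (ha : a ∈ c.bounds.mdp.bestActions c.bounds.U c.last) :
    ∀ m ∈ Move.mk c.last a :: c.path,
      m.state ∈ c.bounds.mdp.states ∧ m.action ∈ c.bounds.mdp.enabled m.state := by
  intro m hm
  rcases List.mem_cons.1 hm with rfl | hm
  · exact ⟨hc.last_mem, (MDP.mem_bestActions.1 ha).1⟩
  · exact ⟨(hc.path m hm).1, (hc.path m hm).2.1⟩

/-- The states of a path that has become too long are not terminal. -/
theorem Config.IsSound.explored (hk : ∀ i, 3 ≤ k i) (hc : c.IsSound M F one zero ε k) (a : A)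
    (hlen : c.path.length + 2 = k c.iter) :
    ((Move.mk c.last a :: c.path).map Move.state).toFinset ⊆ c.bounds.mdp.states ∧
      one ∉ ((Move.mk c.last a :: c.path).map Move.state).toFinset ∧
      zero ∉ ((Move.mk c.last a :: c.path).map Move.state).toFinset := by
  -- Only an empty path may end in a terminal state, namely the initial one. Then there are two
  -- states after the step, too few for a timeout as `k` is at least 3.
  have hlast : c.last ≠ one ∧ c.last ≠ zero := by
    rcases hc.last with h | h
    · have := hk c.iter
      rw [h.1, List.length_nil] at hlen
      omega
    · exact h.2
  have hall : ∀ s ∈ ((Move.mk c.last a :: c.path).map Move.state).toFinset,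
      s ∈ c.bounds.mdp.states ∧ s ≠ one ∧ s ≠ zero := by
    intro s hs
    rw [List.mem_toFinset, List.mem_map] at hs
    obtain ⟨m, hm, rfl⟩ := hs
    rcases List.mem_cons.1 hm with rfl | hm
    · exact ⟨hc.last_mem, hlast⟩
    · have := hc.path m hm
      exact ⟨this.1, this.2.2⟩
  exact ⟨fun s hs => (hall s hs).1, fun h => (hall _ h).2.1 rfl, fun h => (hall _ h).2.2 rfl⟩

theorem Config.IsSound.advance (hS : Setting M F one zero) (hk : ∀ i, 3 ≤ k i)
    (hc : c.IsSound M F one zero ε k) (hhalt : c.halted = false) {a : A}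
    (ha : a ∈ c.bounds.mdp.bestActions c.bounds.U c.last) {t : S}
    (ht : c.bounds.mdp.trans c.last a t ≠ 0) :
    (c.advance F one zero ε k a t).IsSound M F one zero ε k := by
  obtain ⟨proj, hb⟩ := hc.bounds
  have haE := (MDP.mem_bestActions.1 ha).1
  have hstep := Config.step_advance (F := F) (one := one) (zero := zero) (ε := ε) hc.length a t
  generalize c.advance F one zero ε k a t = d at hstep
  cases hstep with
  | extend hlen h1 h0 =>
    refine ⟨⟨proj, hb⟩, fun h => by simp [hhalt] at h, ?_,
      (hb.isValid hS).mem_states hc.last_mem haE ht, Or.inr ⟨by simp, h1, h0⟩, by simpa using hlen⟩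
    intro m hm
    rcases List.mem_cons.1 hm with rfl | hm
    -- A terminal last state would only loop to itself, but `t` is not terminal.
    · refine ⟨hc.last_mem, haE, fun h => h1 ?_, fun h => h0 ?_⟩
      · dsimp only at h
        rw [h] at ht haE
        exact trans_terminal_eq_zero hS hb.quot (Or.inl rfl) haE ht
      · dsimp only at h
        rw [h] at ht haE
        exact trans_terminal_eq_zero hS hb.quot (Or.inr rfl) haE ht
    · exact hc.path m hm
  | timeout hlen =>
    obtain ⟨h, h1, h0⟩ := hc.explored hk a hlen
    obtain ⟨⟨proj', hb'⟩, -⟩ := hb.onTheFlyEC hS h h1 h0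
    exact Config.IsSound.begin hk hS hb' _ _ (by simp)
  | update hlen ht =>
    obtain ⟨-, hb', -⟩ := hb.foldl_update hS _ (hc.mem_path_cons ha)
    exact Config.IsSound.begin hk hS hb' _ _ of_decide_eq_true

theorem Config.IsSound.next (hS : Setting M F one zero) (hk : ∀ i, 3 ≤ k i)
    (hc : c.IsSound M F one zero ε k) {d : Config S A}
    (hd : d ∈ (c.next F one zero ε k).support) : d.IsSound M F one zero ε k := by
  by_cases hhalt : c.halted = false
  · obtain ⟨a, ha, t, ht, rfl⟩ :=
      (Config.mem_support_next hhalt (hc.bestActions_nonempty hc.last_mem)).1 hd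
    exact hc.advance hS hk hhalt ha ht
  · rw [Config.next, dif_neg (fun h => hhalt h.1), PMF.support_pure, Set.mem_singleton_iff] at hd
    exact hd ▸ hc

theorem Config.IsSound.isCorrect (hS : Setting M F one zero)
    (hc : c.IsSound M F one zero ε k) (hhalt : c.halted = true) : c.bounds.IsCorrect M F ε := by
  obtain ⟨proj, hb⟩ := hc.bounds
  have hstart := (hb.isValid hS).start_mem
  have hv : value M F c.bounds.mdp.start = value M F M.start := by
    rw [hb.quot.start_eq, hb.quot.value_proj _ hS.valid.start_mem]
  refine ⟨fun a ha => ?_, ?_, ?_, hc.halted hhalt⟩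
  · obtain ⟨x, hx, hxs, hax, -⟩ := hb.quot.exists_owner _ hstart a ha
    have hmean := hb.quot.mean_value_eq hS hx hax (hxs ▸ ha)
    rw [hxs] at hmean
    refine ⟨x, hx, hax, ?_, ?_⟩
    · rw [← hmean]
      exact hb.lower _ hstart a ha
    · rw [← hmean]
      exact hb.upper _ hstart a ha
  · rw [← hv]
    exact hb.best_le_value hS hstart
  · rw [← hv]
    exact hb.value_le_best hS hstart

/-! ### Almost sure properties of runs -/

/-- The configurations that can occur at time `n`. -/
def reachable (M : MDP S A) (F : Set S) (one zero : S) (ε : ℝ) (k : ℕ → ℕ) :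
    ℕ → Set (Config S A)
  | 0 => {Config.begin (Bounds.first M one zero) 0 false}
  | n + 1 => ⋃ c ∈ reachable M F one zero ε k n, (c.next F one zero ε k).support

omit [Finite S] [Finite A] in
theorem countable_reachable (M : MDP S A) (F : Set S) (one zero : S) (ε : ℝ) (k : ℕ → ℕ) (n : ℕ) :
    (reachable M F one zero ε k n).Countable := by
  induction n with
  | zero => exact Set.countable_singleton _
  | succ n ih => exact ih.biUnion fun c _ => PMF.support_countable _

omit [Finite S] [Finite A] in
theorem measurableSet_config (X : Set (Config S A)) : MeasurableSet X := trivial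

omit [Finite S] [Finite A] in
-- There are uncountably many configurations, and the histories carry the product σ-algebra, where
-- an arbitrary relation need not be measurable. Restricting the current configuration to a
-- countable set makes it a countable union of rectangles.
theorem measurableSet_step {C : Set (Config S A)} (hC : C.Countable)
    (D : Config S A → Set (Config S A)) (n : ℕ) :
    MeasurableSet {p : ((i : Finset.Iic n) → Config S A) × Config S A |
      ∃ c ∈ C, p.1 ⟨n, Finset.mem_Iic.2 le_rfl⟩ = c ∧ p.2 ∈ D c} := by
  have h : {p : ((i : Finset.Iic n) → Config S A) × Config S A |
      ∃ c ∈ C, p.1 ⟨n, Finset.mem_Iic.2 le_rfl⟩ = c ∧ p.2 ∈ D c} =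
      ⋃ c ∈ C, (fun p : ((i : Finset.Iic n) → Config S A) × Config S A =>
        p.1 ⟨n, Finset.mem_Iic.2 le_rfl⟩) ⁻¹' {c} ∩ Prod.snd ⁻¹' D c := by
    ext p
    simp
  rw [h]
  refine MeasurableSet.biUnion hC fun c _ => ?_
  have hm : Measurable fun p : ((i : Finset.Iic n) → Config S A) × Config S A =>
      p.1 ⟨n, Finset.mem_Iic.2 le_rfl⟩ := (measurable_pi_apply _).comp measurable_fst
  exact (hm (measurableSet_config {c})).inter (measurable_snd (measurableSet_config (D c)))

omit [Finite S] [Finite A] in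
theorem ae_reachable (M : MDP S A) (F : Set S) (one zero : S) (ε : ℝ) (k : ℕ → ℕ) :
    ∀ᵐ run ∂(runMeasure M F one zero ε k),
      run 0 = Config.begin (Bounds.first M one zero) 0 false ∧
      ∀ n, run n ∈ reachable M F one zero ε k n ∧
        run (n + 1) ∈ ((run n).next F one zero ε k).support := by
  have h0 : ∀ᵐ run ∂(runMeasure M F one zero ε k),
      run 0 = Config.begin (Bounds.first M one zero) 0 false := by
    refine ae_trajMeasure_zero _ _ (p := fun c => c = Config.begin (Bounds.first M one zero) 0 false)
      ?_
    rw [ae_dirac_iff (measurableSet_config _)]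
  have hstep : ∀ n, (∀ᵐ run ∂(runMeasure M F one zero ε k), run n ∈ reachable M F one zero ε k n) →
      ∀ᵐ run ∂(runMeasure M F one zero ε k),
        run (n + 1) ∈ ((run n).next F one zero ε k).support := by
    intro n hn
    have hE := measurableSet_step (countable_reachable M F one zero ε k n)
      (fun c => (c.next F one zero ε k).support) n
    have := ae_trajMeasure_succ (Measure.dirac (Config.begin (Bounds.first M one zero) 0 false))
      (runKernel F one zero ε k) n hE ?_
    · change ∀ᵐ run ∂(runMeasure M F one zero ε k), _ at this
      filter_upwards [this] with run hrun
      obtain ⟨c, -, hc, h⟩ := hrun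
      rw [← hc] at h
      exact h
    · change ∀ᵐ run ∂(runMeasure M F one zero ε k), _
      filter_upwards [hn] with run hrun
      change ∀ᵐ y ∂(Config.next F one zero ε k (run n)).toMeasure, _
      rw [ae_iff, PMF.toMeasure_apply_eq_zero_iff _ (measurableSet_config _), Set.disjoint_left]
      intro y hy hy'
      exact hy' ⟨run n, hrun, rfl, hy⟩
  have hall : ∀ n, ∀ᵐ run ∂(runMeasure M F one zero ε k), run n ∈ reachable M F one zero ε k n := by
    intro n
    induction n with
    | zero => exact h0
    | succ n ih =>
      filter_upwards [ih, hstep n ih] with run h1 h2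
      exact Set.mem_biUnion h1 h2
  filter_upwards [h0, ae_all_iff.2 hall, ae_all_iff.2 fun n => hstep n (hall n)] with run h1 h2 h3
  exact ⟨h1, fun n => ⟨h2 n, h3 n⟩⟩

omit [Finite S] [Finite A] in
/-- A move that is possible infinitely often, with probability bounded away from zero, is made
infinitely often. -/
theorem ae_frequently_advance (M : MDP S A) (F : Set S) (one zero : S) (ε : ℝ) (k : ℕ → ℕ)
    (P : Config S A → Prop) (a : A) (t : S) {δ : ℝ≥0∞} (hδ : 0 < δ) :
    ∀ᵐ run ∂(runMeasure M F one zero ε k),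
      (∃ᶠ n in Filter.atTop, P (run n) ∧
        δ ≤ (run n).next F one zero ε k ((run n).advance F one zero ε k a t)) →
      ∃ᶠ n in Filter.atTop, P (run n) ∧ run (n + 1) = (run n).advance F one zero ε k a t := by
  have h := ae_frequently_trajMeasure
    (Measure.dirac (Config.begin (Bounds.first M one zero) 0 false)) (runKernel F one zero ε k)
    (fun n => {x | x ⟨n, Finset.mem_Iic.2 le_rfl⟩ ∈ {c : Config S A |
      c ∈ reachable M F one zero ε k n ∧ P c ∧
        δ ≤ c.next F one zero ε k (c.advance F one zero ε k a t)}})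
    (fun n => measurable_pi_apply _ (measurableSet_config _))
    (fun n => {p | ∃ c ∈ reachable M F one zero ε k n, p.1 ⟨n, Finset.mem_Iic.2 le_rfl⟩ = c ∧
      p.2 ∈ {d : Config S A | P c ∧ d = c.advance F one zero ε k a t}})
    (fun n => measurableSet_step (countable_reachable M F one zero ε k n) _ n) δ hδ ?_
  · change ∀ᵐ run ∂(runMeasure M F one zero ε k), _ at h
    filter_upwards [h, ae_reachable M F one zero ε k] with run h1 h2 hfreq
    refine (h1 (hfreq.mono fun n hn => ⟨(h2.2 n).1, hn⟩)).mono fun n hn => ?_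
    obtain ⟨c, -, hc, hP, had⟩ := hn
    rw [← hc] at hP had
    exact ⟨hP, had⟩
  · intro n x hx
    obtain ⟨hr, hP, hle⟩ := hx
    refine hle.trans ?_
    change _ ≤ (Config.next F one zero ε k (x ⟨n, Finset.mem_Iic.2 le_rfl⟩)).toMeasure _
    rw [← PMF.toMeasure_apply_singleton _ _ (measurableSet_config _)]
    refine measure_mono fun d hd => ?_
    exact ⟨_, hr, rfl, hP, hd⟩

end Configurations

/-! ### Fair runs, stable runs and paths of a policy -/

section Runs

open Filter
open scoped ENNReal

universe u v
variable {S : Type u} {A : Type v} [Finite S] [Finite A]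

/-- The sets of actions that the exploration chooses from. -/
def Config.policy (c : Config S A) : S → Finset A := c.bounds.mdp.bestActions c.bounds.U

/-- A run that never terminates and in which every move that is possible infinitely often with
probability bounded away from zero is made infinitely often. -/
structure FairRun (M : MDP S A) (F : Set S) (one zero : S) (ε : ℝ) (k : ℕ → ℕ)
    (run : ℕ → Config S A) : Prop where
  sound : ∀ n, (run n).IsSound M F one zero ε k
  halted : ∀ n, (run n).halted = false
  step : ∀ n, ∃ a ∈ (run n).policy (run n).last, ∃ t,
    (run n).bounds.mdp.trans (run n).last a t ≠ 0 ∧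
      run (n + 1) = (run n).advance F one zero ε k a t
  fair : ∀ (p : List (Move S A)) (s : S) (ρ : S → Finset A) (a : A) (t : S) (j : ℕ),
    (∃ᶠ n in atTop, ((run n).path = p ∧ (run n).last = s ∧ (run n).policy = ρ) ∧
      ((j : ℝ≥0∞) + 1)⁻¹ ≤ (run n).next F one zero ε k ((run n).advance F one zero ε k a t)) →
    ∃ᶠ n in atTop, ((run n).path = p ∧ (run n).last = s ∧ (run n).policy = ρ) ∧
      run (n + 1) = (run n).advance F one zero ε k a t

/-- A fair run in which no end components are found any more and all path lengths are large. -/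
structure StableRun (M : MDP S A) (F : Set S) (one zero : S) (ε : ℝ) (k : ℕ → ℕ)
    (run : ℕ → Config S A) (M' : MDP S A) : Prop extends FairRun M F one zero ε k run where
  mdp : ∀ n, (run n).bounds.mdp = M'
  long : ∀ n, M.states.card ^ 2 ≤ k (run n).iter
  quiet : ∀ n, (run n).path.length + 2 = k (run n).iter →
    M'.identifyECs ((run n).last :: (run n).path.map Move.state).toFinset = ∅ ∧
      run (n + 1) = Config.begin (run n).bounds ((run n).iter + 1) false

variable {M M' : MDP S A} {F : Set S} {one zero : S} {ε : ℝ} {k : ℕ → ℕ} {run : ℕ → Config S A}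

/-- Fairness is one almost sure condition for each path, state, policy, move and threshold 1/(j+1).
These are countably many because the bounds enter only through the policy. -/
theorem ae_fairRun (hS : Setting M F one zero) (hk : ∀ i, 3 ≤ k i) :
    ∀ᵐ run ∂(runMeasure M F one zero ε k),
      (∀ n, (run n).IsSound M F one zero ε k) ∧
      ((∀ n, (run n).halted = false) → FairRun M F one zero ε k run) := by
  have hfair : ∀ᵐ run ∂(runMeasure M F one zero ε k),
      ∀ (p : List (Move S A)) (s : S) (ρ : S → Finset A) (a : A) (t : S) (j : ℕ),
      (∃ᶠ n in atTop, ((run n).path = p ∧ (run n).last = s ∧ (run n).policy = ρ) ∧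
        ((j : ℝ≥0∞) + 1)⁻¹ ≤ (run n).next F one zero ε k ((run n).advance F one zero ε k a t)) →
      ∃ᶠ n in atTop, ((run n).path = p ∧ (run n).last = s ∧ (run n).policy = ρ) ∧
        run (n + 1) = (run n).advance F one zero ε k a t := by
    simp only [ae_all_iff]
    intro p s ρ a t j
    exact ae_frequently_advance M F one zero ε k
      (fun c => c.path = p ∧ c.last = s ∧ c.policy = ρ) a t
      (ENNReal.inv_pos.2 (by finiteness))
  filter_upwards [hfair, ae_reachable M F one zero ε k] with run h1 h2
  have hsound : ∀ n, (run n).IsSound M F one zero ε k := by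
    intro n
    induction n with
    | zero =>
      rw [h2.1]
      exact Config.IsSound.begin hk hS (isSound_first hS) _ _ (by simp)
    | succ n ih => exact ih.next hS hk (h2.2 n).2
  refine ⟨hsound, fun hh => ⟨hsound, hh, fun n => ?_, h1⟩⟩
  exact (Config.mem_support_next (hh n)
    ((hsound n).bestActions_nonempty (hsound n).last_mem)).1 (h2.2 n).2

theorem FairRun.shift (h : FairRun M F one zero ε k run) (N : ℕ) :
    FairRun M F one zero ε k fun n => run (n + N) where
  sound := fun n => h.sound _
  halted := fun n => h.halted _
  step := fun n => by
    have := h.step (n + N)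
    rwa [show n + N + 1 = n + 1 + N by omega] at this
  fair := by
    intro p s ρ a t j hfreq
    have hmap : ∀ Q : ℕ → Prop, (∃ᶠ n in atTop, Q (n + N)) ↔ ∃ᶠ n in atTop, Q n := by
      intro Q
      conv_rhs => rw [← map_add_atTop_eq_nat N]
      rw [frequently_map]
    have := h.fair p s ρ a t j ((hmap fun n => ((run n).path = p ∧ (run n).last = s ∧
      (run n).policy = ρ) ∧ ((j : ℝ≥0∞) + 1)⁻¹ ≤
        (run n).next F one zero ε k ((run n).advance F one zero ε k a t)).1 hfreq)
    rw [← hmap] at this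
    refine this.mono fun n hn => ⟨hn.1, ?_⟩
    rw [show n + 1 + N = n + N + 1 by omega]
    exact hn.2

theorem FairRun.exists_step (h : FairRun M F one zero ε k run) (n : ℕ) :
    ∃ a ∈ (run n).policy (run n).last, ∃ t, (run n).bounds.mdp.trans (run n).last a t ≠ 0 ∧
      (run n).Step F one zero ε k a t (run (n + 1)) := by
  obtain ⟨a, ha, t, ht, hn⟩ := h.step n
  refine ⟨a, ha, t, ht, ?_⟩
  rw [hn]
  exact Config.step_advance (h.sound n).length a t

theorem FairRun.iter_succ (h : FairRun M F one zero ε k run) (n : ℕ) :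
    (run n).iter ≤ (run (n + 1)).iter := by
  obtain ⟨a, -, t, -, hstep⟩ := h.exists_step n
  generalize run (n + 1) = d at hstep
  cases hstep with
  | extend => exact le_rfl
  | timeout => exact Nat.le_succ _
  | update => exact Nat.le_succ _

theorem FairRun.exists_begin (h : FairRun M F one zero ε k run) (n : ℕ) :
    ∃ m, n < m ∧ (run m).path = [] ∧ (run n).iter < (run m).iter := by
  -- Induction on the number of steps left before the path has its full length.
  suffices H : ∀ j n, k (run n).iter - (run n).path.length ≤ j →
      ∃ m, n < m ∧ (run m).path = [] ∧ (run n).iter < (run m).iter from H _ n le_rfl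
  intro j
  induction j with
  | zero =>
    intro n hn
    have := (h.sound n).length
    omega
  | succ j ih =>
    intro n hn
    obtain ⟨a, -, t, -, hstep⟩ := h.exists_step n
    generalize hd : run (n + 1) = d at hstep
    cases hstep with
    | extend =>
      obtain ⟨m, hm, hp, hi⟩ := ih (n + 1) (by
        rw [hd]
        simp only [List.length_cons]
        omega)
      rw [hd] at hi
      exact ⟨m, by omega, hp, hi⟩
    | timeout => exact ⟨n + 1, by omega, by rw [hd]; rfl, by rw [hd]; exact Nat.lt_succ_self _⟩
    | update => exact ⟨n + 1, by omega, by rw [hd]; rfl, by rw [hd]; exact Nat.lt_succ_self _⟩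

theorem FairRun.card_actions (hS : Setting M F one zero) (hk : ∀ i, 3 ≤ k i)
    (h : FairRun M F one zero ε k run) (n : ℕ) :
    ((run (n + 1)).bounds.mdp = (run n).bounds.mdp ∧
      ((run n).path.length + 2 = k (run n).iter →
        (run n).bounds.mdp.identifyECs ((run n).last :: (run n).path.map Move.state).toFinset = ∅ ∧
        run (n + 1) = Config.begin (run n).bounds ((run n).iter + 1) false)) ∨
    (run (n + 1)).bounds.mdp.actions.card < (run n).bounds.mdp.actions.card := by
  obtain ⟨a, ha, t, -, hstep⟩ := h.exists_step n
  obtain ⟨proj, hb⟩ := (h.sound n).bounds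
  generalize run (n + 1) = d at hstep
  cases hstep with
  | extend hlen => exact Or.inl ⟨rfl, fun h => by omega⟩
  | timeout hlen =>
    obtain ⟨hT, h1, h0⟩ := (h.sound n).explored hk a hlen
    rcases (hb.onTheFlyEC hS hT h1 h0).2 with hcase | hcase
    · refine Or.inl ⟨?_, fun _ => ⟨hcase.1, ?_⟩⟩
      · simp only [Config.begin]
        rw [hcase.2]
      · rw [hcase.2]
    · exact Or.inr hcase
  | update hlen =>
    exact Or.inl ⟨(hb.foldl_update hS _ ((h.sound n).mem_path_cons ha)).1, fun h => by omega⟩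

/-- The number of actions never increases, so it is constant from some time on, and then nothing is
collapsed. Every iteration ends, so the iteration counter also passes the point where `k i` is
large. -/
theorem FairRun.exists_stableRun (hS : Setting M F one zero) (hk : ∀ i, 3 ≤ k i)
    (hlarge : ∀ᶠ i in atTop, M.states.card ^ 2 ≤ k i) (h : FairRun M F one zero ε k run) :
    ∃ run' M', StableRun M F one zero ε k run' M' := by
  have hanti : Antitone fun n => (run n).bounds.mdp.actions.card :=
    antitone_nat_of_succ_le fun n => by
      rcases h.card_actions hS hk n with h' | h'
      · rw [h'.1]
      · exact h'.le
  have hmono : Monotone fun n => (run n).iter := monotone_nat_of_le_succ h.iter_succ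
  obtain ⟨N, hN⟩ : ∃ N, ∀ n, (run N).bounds.mdp.actions.card ≤ (run n).bounds.mdp.actions.card :=
    ⟨_, fun n => Function.argmin_le (fun n => (run n).bounds.mdp.actions.card) n⟩
  obtain ⟨i₀, hi₀⟩ := eventually_atTop.1 hlarge
  have hiter : ∀ i, ∃ n, i ≤ (run n).iter := by
    intro i
    induction i with
    | zero => exact ⟨0, Nat.zero_le _⟩
    | succ i ih =>
      obtain ⟨n, hn⟩ := ih
      obtain ⟨m, -, -, hm⟩ := h.exists_begin n
      exact ⟨m, by omega⟩
  obtain ⟨N₂, hN₂⟩ := hiter i₀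
  have hstable : ∀ n, N ≤ n → ((run (n + 1)).bounds.mdp = (run n).bounds.mdp ∧
      ((run n).path.length + 2 = k (run n).iter →
        (run n).bounds.mdp.identifyECs ((run n).last :: (run n).path.map Move.state).toFinset = ∅ ∧
        run (n + 1) = Config.begin (run n).bounds ((run n).iter + 1) false)) := by
    intro n hn
    rcases h.card_actions hS hk n with h' | h'
    · exact h'
    · have := hN (n + 1)
      have h2 : (run n).bounds.mdp.actions.card ≤ (run N).bounds.mdp.actions.card := hanti hn
      omega
  have hmdp : ∀ n, (run (n + (N + N₂))).bounds.mdp = (run (N + N₂)).bounds.mdp := by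
    intro n
    induction n with
    | zero => rw [Nat.zero_add]
    | succ n ih =>
      rw [← ih, show n + 1 + (N + N₂) = n + (N + N₂) + 1 by omega]
      exact (hstable _ (by omega)).1
  refine ⟨fun n => run (n + (N + N₂)), (run (N + N₂)).bounds.mdp,
    { toFairRun := h.shift _, mdp := hmdp, long := ?_, quiet := ?_ }⟩
  · intro n
    exact hi₀ _ (hN₂.trans (hmono (by omega)))
  · intro n hn
    have := (hstable (n + (N + N₂)) (by omega)).2 hn
    rw [hmdp n] at this
    refine ⟨this.1, ?_⟩
    rw [← this.2]
    congr 1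
    omega

namespace StableRun

theorem isQuotient (h : StableRun M F one zero ε k run M') :
    ∃ proj, IsQuotient M F one zero M' proj := by
  obtain ⟨proj, hb⟩ := (h.sound 0).bounds
  exact ⟨proj, h.mdp 0 ▸ hb.quot⟩

theorem isValid (hS : Setting M F one zero) (h : StableRun M F one zero ε k run M') :
    M'.IsValid := by
  obtain ⟨proj, hq⟩ := h.isQuotient
  exact hq.isValid hS

theorem policy_subset (h : StableRun M F one zero ε k run M') (n : ℕ) (s : S) :
    (run n).policy s ⊆ M'.enabled s := by
  intro a ha
  rw [← h.mdp n]
  exact (MDP.mem_bestActions.1 ha).1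

theorem policy_nonempty (h : StableRun M F one zero ε k run M') (n : ℕ) {s : S}
    (hs : s ∈ M'.states) : ((run n).policy s).Nonempty :=
  (h.sound n).bestActions_nonempty (by rw [h.mdp n]; exact hs)

theorem frequently_begin (h : StableRun M F one zero ε k run M') :
    ∃ᶠ n in atTop, (run n).path = [] := by
  rw [frequently_atTop]
  intro n
  obtain ⟨m, hm, hp, -⟩ := h.exists_begin n
  exact ⟨m, hm.le, hp⟩

/-- Pigeonhole: there are only finitely many policies, although the bounds behind them may keep
changing. -/
theorem exists_policy (h : StableRun M F one zero ε k run M') :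
    ∃ ρ, ∃ᶠ n in atTop, (run n).path = [] ∧ (run n).policy = ρ := by
  by_contra hcon
  push Not at hcon
  have hall : ∀ᶠ n in atTop, ∀ ρ, ¬ ((run n).path = [] ∧ (run n).policy = ρ) :=
    eventually_all.2 fun ρ => by
      have := hcon ρ
      simpa using this
  obtain ⟨n, hn, hn'⟩ := (h.frequently_begin.and_eventually hall).exists
  exact hn' _ ⟨hn, rfl⟩

/-- Moves of positive probability are made infinitely often. -/
theorem frequently_move (h : StableRun M F one zero ε k run M') {p : List (Move S A)} {s : S}
    {ρ : S → Finset A}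
    (hf : ∃ᶠ n in atTop, (run n).path = p ∧ (run n).last = s ∧ (run n).policy = ρ) {a : A}
    (ha : a ∈ ρ s) {t : S} (ht : M'.trans s a t ≠ 0) :
    ∃ᶠ n in atTop, ((run n).path = p ∧ (run n).last = s ∧ (run n).policy = ρ) ∧
      run (n + 1) = (run n).advance F one zero ε k a t := by
  have hpos : ((ρ s).card : ℝ≥0∞)⁻¹ * M'.trans s a t ≠ 0 :=
    mul_ne_zero (ENNReal.inv_ne_zero.2 (ENNReal.natCast_ne_top _)) ht
  obtain ⟨j, hj⟩ := ENNReal.exists_inv_nat_lt hpos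
  refine h.fair p s ρ a t j (hf.mono fun n hn => ⟨hn, ?_⟩)
  refine le_trans ?_ (Config.le_next_advance (h.halted n) (a := a) ?_ t)
  · have e : (run n).bounds.mdp.bestActions (run n).bounds.U (run n).last = ρ s := by
      rw [← hn.2.2, ← hn.2.1]
      rfl
    rw [e, h.mdp n, hn.2.1]
    refine le_trans ?_ hj.le
    exact ENNReal.inv_le_inv.2 le_self_add
  · change a ∈ (run n).policy (run n).last
    rw [hn.2.2, hn.2.1]
    exact ha

end StableRun

/-! ### Paths of a policy -/

/-- One step of the exploration with the policy `ρ`. -/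
def PolicyEdge (M' : MDP S A) (one zero : S) (ρ : S → Finset A) (s t : S) : Prop :=
  s ≠ one ∧ s ≠ zero ∧ ∃ a ∈ ρ s, M'.trans s a t ≠ 0

/-- The paths, most recent letter first, that the exploration with the policy `ρ` can produce. -/
inductive PolicyPath (M' : MDP S A) (one zero : S) (ρ : S → Finset A) :
    List (Move S A) → S → Prop
  | nil : PolicyPath M' one zero ρ [] M'.start
  | cons {p : List (Move S A)} {s : S} {a : A} {t : S} (hp : PolicyPath M' one zero ρ p s)
      (h1 : s ≠ one) (h0 : s ≠ zero) (ha : a ∈ ρ s) (ht : M'.trans s a t ≠ 0) :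
      PolicyPath M' one zero ρ (⟨s, a⟩ :: p) t

/-- `n` steps of a relation. -/
def StepsTo (r : S → S → Prop) : ℕ → S → S → Prop
  | 0, x, y => x = y
  | n + 1, x, y => ∃ z, StepsTo r n x z ∧ r z y

omit [Finite S] in
/-- What can be reached can be reached in fewer steps than there are states. -/
theorem exists_stepsTo_lt {r : S → S → Prop} {X : Finset S} {x y : S} (hx : x ∈ X)
    (hX : ∀ s ∈ X, ∀ t, r s t → t ∈ X) (h : Relation.ReflTransGen r x y) :
    ∃ n, n < X.card ∧ StepsTo r n x y := by
  have hex : ∀ y, Relation.ReflTransGen r x y → ∃ n, StepsTo r n x y := by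
    intro y hy
    induction hy with
    | refl => exact ⟨0, rfl⟩
    | tail _ hstep ih =>
      obtain ⟨n, hn⟩ := ih
      exact ⟨n + 1, _, hn, hstep⟩
  have hmem : ∀ n y, StepsTo r n x y → y ∈ X := by
    intro n
    induction n with
    | zero => rintro y rfl; exact hx
    | succ n ih =>
      rintro y ⟨z, hz, hzy⟩
      exact hX z (ih z hz) y hzy
  -- Along a shortest path, the state `g i` has distance exactly `i` from `x`, so the states are
  -- distinct.
  have hlevels : ∀ n y, StepsTo r n x y → (∀ m < n, ¬ StepsTo r m x y) →
      ∃ g : ℕ → S, ∀ i ≤ n, StepsTo r i x (g i) ∧ ∀ m < i, ¬ StepsTo r m x (g i) := by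
    intro n
    induction n with
    | zero =>
      intro y hy hmin
      exact ⟨fun _ => y, fun i hi => by
        obtain rfl := Nat.le_zero.1 hi
        exact ⟨hy, hmin⟩⟩
    | succ n ih =>
      rintro y ⟨z, hz, hzy⟩ hmin
      obtain ⟨g, hg⟩ := ih z hz fun m hm hzm => hmin (m + 1) (by omega) ⟨z, hzm, hzy⟩
      refine ⟨fun i => if i ≤ n then g i else y, fun i hi => ?_⟩
      by_cases hin : i ≤ n
      · simp only [if_pos hin]
        exact hg i hin
      · obtain rfl : i = n + 1 := by omega
        simp only [if_neg hin]
        exact ⟨⟨z, hz, hzy⟩, hmin⟩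
  refine ⟨Nat.find (hex y h), ?_, Nat.find_spec (hex y h)⟩
  obtain ⟨g, hg⟩ := hlevels _ y (Nat.find_spec (hex y h)) fun m hm => Nat.find_min (hex y h) hm
  have hinj : Set.InjOn g (Finset.range (Nat.find (hex y h) + 1)) := by
    intro i hi j hj hij
    rw [Finset.coe_range, Set.mem_Iio] at hi hj
    by_contra hne
    rcases Nat.lt_or_gt_of_ne hne with hlt | hlt
    · exact (hg j (by omega)).2 i hlt (hij ▸ (hg i (by omega)).1)
    · exact (hg i (by omega)).2 j hlt (hij ▸ (hg j (by omega)).1)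
  have := Finset.card_le_card_of_injOn g (t := X)
    (fun i hi => hmem i _ (hg i (by
      have := Finset.mem_range.1 (Finset.mem_coe.1 hi)
      omega)).1) hinj
  rw [Finset.card_range] at this
  omega

omit [Finite S] [Finite A] in
-- The last clause records the old endpoint `s`, which is not yet a letter of `p`; it is needed to
-- count the states that a path has visited.
theorem PolicyPath.extend {ρ : S → Finset A} {p : List (Move S A)} {s : S}
    (hp : PolicyPath M' one zero ρ p s) {n : ℕ} {t : S}
    (h : StepsTo (PolicyEdge M' one zero ρ) n s t) :
    ∃ q, PolicyPath M' one zero ρ q t ∧ q.length = p.length + n ∧ p ⊆ q ∧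
      (t = s ∨ s ∈ q.map Move.state) := by
  induction n generalizing t with
  | zero =>
    obtain rfl : s = t := h
    exact ⟨p, hp, rfl, fun _ h => h, Or.inl rfl⟩
  | succ n ih =>
    obtain ⟨z, hz, h1, h0, a, ha, hzt⟩ := h
    obtain ⟨q, hq, hlen, hsub, hs⟩ := ih hz
    refine ⟨⟨z, a⟩ :: q, PolicyPath.cons hq h1 h0 ha hzt, ?_,
      fun m hm => List.mem_cons_of_mem _ (hsub hm), Or.inr ?_⟩
    · rw [List.length_cons, hlen]
      omega
    · rcases hs with rfl | hs
      · simp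
      · rw [List.map_cons]
        exact List.mem_cons_of_mem _ hs

end Runs

/-! ### Reaching terminal states and updating every reachable pair -/

section Convergence

open Filter Topology
open scoped ENNReal

universe u v
variable {S : Type u} {A : Type v} [Finite S] [Finite A]
variable {M M' : MDP S A} {F : Set S} {one zero : S} {ε : ℝ} {k : ℕ → ℕ} {run : ℕ → Config S A}
  {ρ : S → Finset A}

namespace StableRun

theorem best_start_terminal (hS : Setting M F one zero) {b : Bounds S A} {proj : S → S}
    (hb : b.IsSound M F one zero proj) {z : S} (hz : z = one ∨ z = zero) :
    b.mdp.best b.U z = b.mdp.best b.L z := by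
  rcases hz with rfl | rfl
  · rw [hb.best_lower_one]
    refine le_antisymm (hb.best_upper_le_one hb.quot.one_mem) ?_
    rw [← IsQuotient.value_one hS]
    exact hb.value_le_best hS hb.quot.one_mem
  · rw [hb.best_upper_zero]
    refine le_antisymm (hb.best_lower_nonneg hb.quot.zero_mem) ?_
    rw [← IsQuotient.value_zero hS]
    exact hb.best_le_value hS hb.quot.zero_mem

theorem step_cases (h : StableRun M F one zero ε k run M') (n : ℕ) :
    ∃ a ∈ (run n).policy (run n).last, ∃ t, M'.trans (run n).last a t ≠ 0 ∧
      run (n + 1) = (run n).advance F one zero ε k a t ∧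
      (run n).Step F one zero ε k a t (run (n + 1)) := by
  obtain ⟨a, ha, t, ht, hn⟩ := h.step n
  refine ⟨a, ha, t, h.mdp n ▸ ht, hn, ?_⟩
  rw [hn]
  exact Config.step_advance (h.sound n).length a t

theorem gap_of_update (h : StableRun M F one zero ε k run M') {n : ℕ} {b : Bounds S A}
    {i : ℕ} (hn : run (n + 1) = Config.begin b i (decide (b.gap < ε))) : ε ≤ b.gap := by
  have := h.halted (n + 1)
  rw [hn] at this
  by_contra hc
  push Not at hc
  simp [Config.begin, hc] at this

/-- From a terminal initial state the first step is already followed by an update, as `k` is at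
least 3. The bounds agree there, so the algorithm would halt. -/
theorem start_not_terminal (hS : Setting M F one zero) (hk : ∀ i, 3 ≤ k i) (hε : 0 < ε)
    (h : StableRun M F one zero ε k run M') : M'.start ≠ one ∧ M'.start ≠ zero := by
  rw [← not_or]
  intro hz
  obtain ⟨n, hn⟩ := h.frequently_begin.exists
  have hlast : (run n).last = M'.start := by
    rcases (h.sound n).last with h' | h'
    · rw [h'.2, h.mdp n]
    · exact absurd hn h'.1
  obtain ⟨a, ha, t, ht, -, hstep⟩ := h.step_cases n
  obtain ⟨proj, hq⟩ := h.isQuotient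
  have hterm : t = M'.start := by
    rw [hlast] at ha ht
    exact trans_terminal_eq_zero hS hq hz (h.policy_subset n _ ha) ht
  have hk' := hk (run n).iter
  obtain ⟨proj', hb⟩ := (h.sound n).bounds
  generalize hd : run (n + 1) = d at hstep
  cases hstep with
  | extend hlen h1 h0 => exact absurd (hterm ▸ hz) (not_or.2 ⟨h1, h0⟩)
  | timeout hlen =>
    rw [hn, List.length_nil] at hlen
    omega
  | update hlen ht' =>
    obtain ⟨hmdp, hb', -⟩ := hb.foldl_update hS _ ((h.sound n).mem_path_cons ha)
    have hgap := h.gap_of_update hd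
    rw [Bounds.gap, hmdp, h.mdp n] at hgap
    have := best_start_terminal hS hb' hz
    rw [hmdp, h.mdp n] at this
    linarith

theorem three_le_card (hS : Setting M F one zero) (hk : ∀ i, 3 ≤ k i) (hε : 0 < ε)
    (h : StableRun M F one zero ε k run M') : 3 ≤ M.states.card := by
  obtain ⟨h1, h0⟩ := h.start_not_terminal hS hk hε
  obtain ⟨proj, hq⟩ := h.isQuotient
  have hsub : ({M'.start, one, zero} : Finset S) ⊆ M.states := by
    intro s hs
    simp only [Finset.mem_insert, Finset.mem_singleton] at hs
    rcases hs with rfl | rfl | rfl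
    · exact hq.states_subset (h.isValid hS).start_mem
    · exact hS.one_mem
    · exact hS.zero_mem
  have := Finset.card_le_card hsub
  rwa [Finset.card_eq_three.2 ⟨_, _, _, h1, h0, hS.ne, rfl⟩] at this

/-- Used to get |R|·|S| < |S|² for the length of a path that covers `R`. -/
theorem card_nonterminal (hS : Setting M F one zero) (h : StableRun M F one zero ε k run M')
    {R : Finset S} (hR : R ⊆ M'.states) (h1 : one ∉ R) (h0 : zero ∉ R) :
    R.card + 2 ≤ M.states.card := by
  obtain ⟨proj, hq⟩ := h.isQuotient
  have hsub : insert one (insert zero R) ⊆ M.states := by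
    intro s hs
    simp only [Finset.mem_insert] at hs
    rcases hs with rfl | rfl | hs
    · exact hS.one_mem
    · exact hS.zero_mem
    · exact hq.states_subset (hR hs)
  have := Finset.card_le_card hsub
  rw [Finset.card_insert_of_notMem, Finset.card_insert_of_notMem h0] at this
  · exact this
  · simp [h1, hS.ne]

/-- Short paths of a policy that is used infinitely often are produced infinitely often. -/
theorem frequently_path (h : StableRun M F one zero ε k run M')
    (hρ : ∃ᶠ n in atTop, (run n).path = [] ∧ (run n).policy = ρ) {p : List (Move S A)} {s : S}
    (hp : PolicyPath M' one zero ρ p s) (hlen : p.length + 1 < M.states.card ^ 2)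
    (hs : p = [] ∨ (s ≠ one ∧ s ≠ zero)) :
    ∃ᶠ n in atTop, (run n).path = p ∧ (run n).last = s ∧ (run n).policy = ρ := by
  induction hp with
  | nil =>
    refine hρ.mono fun n hn => ⟨hn.1, ?_, hn.2⟩
    rcases (h.sound n).last with h' | h'
    · rw [h'.2, h.mdp n]
    · exact absurd hn.1 h'.1
  | @cons p s a t hp h1 h0 ha ht ih =>
    rw [List.length_cons] at hlen
    have hmove := h.frequently_move (ih (by omega) (Or.inr ⟨h1, h0⟩)) ha ht
    rw [frequently_atTop] at hmove ⊢
    intro N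
    obtain ⟨n, hn, ⟨hnp, hns, hnρ⟩, hadv⟩ := hmove N
    refine ⟨n + 1, by omega, ?_⟩
    have hstep := Config.step_advance (F := F) (one := one) (zero := zero) (ε := ε)
      (h.sound n).length a t
    have hlong := h.long n
    rw [← hadv] at hstep
    have hts : t ≠ one ∧ t ≠ zero := by
      rcases hs with hs | hs
      · exact absurd hs (List.cons_ne_nil _ _)
      · exact hs
    generalize run (n + 1) = d at hstep
    cases hstep with
    | extend =>
      refine ⟨?_, rfl, hnρ⟩
      simp only
      rw [hnp, hns]
    | timeout hlen' =>
      rw [hnp] at hlen'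
      omega
    | update hlen' ht' => exact absurd ht' (not_or.2 hts)

/-- A path of a policy that ends in a terminal state leads to an update infinitely often. -/
theorem frequently_update (h : StableRun M F one zero ε k run M')
    (hρ : ∃ᶠ n in atTop, (run n).path = [] ∧ (run n).policy = ρ) {p : List (Move S A)} {z : S}
    (hp : PolicyPath M' one zero ρ p z) (hlen : p.length + 1 < M.states.card ^ 2)
    (hz : z = one ∨ z = zero) (hne : p ≠ []) :
    ∃ᶠ n in atTop, (∀ m ∈ p, m.state ∈ (run n).bounds.mdp.states ∧
        m.action ∈ (run n).bounds.mdp.enabled m.state) ∧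
      (run (n + 1)).bounds = p.foldl Bounds.update (run n).bounds ∧
      ε ≤ (run (n + 1)).bounds.gap := by
  cases hp with
  | nil => exact absurd rfl hne
  | @cons p s a t hp h1 h0 ha ht =>
    rw [List.length_cons] at hlen
    have hmove := h.frequently_move (h.frequently_path hρ hp (by omega) (Or.inr ⟨h1, h0⟩)) ha ht
    refine hmove.mono fun n hn => ?_
    obtain ⟨⟨hnp, hns, hnρ⟩, hadv⟩ := hn
    have hstep := Config.step_advance (F := F) (one := one) (zero := zero) (ε := ε)
      (h.sound n).length a z
    have hlong := h.long n
    rw [← hadv] at hstep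
    have haρ : a ∈ (run n).policy (run n).last := by rw [hnρ, hns]; exact ha
    have hpath := (h.sound n).mem_path_cons haρ
    rw [hnp, hns] at hpath
    refine ⟨hpath, ?_⟩
    generalize hd : run (n + 1) = d at hstep
    cases hstep with
    | extend hlen' h1' h0' => exact absurd hz (not_or.2 ⟨h1', h0'⟩)
    | timeout hlen' =>
      rw [hnp] at hlen'
      omega
    | update hlen' ht' =>
      rw [hnp, hns] at hd ⊢
      exact ⟨rfl, h.gap_of_update hd⟩

/-- The states that can be reached with the policy `ρ`. -/
def reachFrom (M' : MDP S A) (one zero : S) (ρ : S → Finset A) (x : S) : Finset S :=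
  M'.states.filter fun y => Relation.ReflTransGen (PolicyEdge M' one zero ρ) x y

theorem edge_mem (hS : Setting M F one zero) (h : StableRun M F one zero ε k run M')
    (hsub : ∀ s, ρ s ⊆ M'.enabled s) {s t : S} (hs : s ∈ M'.states)
    (hst : PolicyEdge M' one zero ρ s t) : t ∈ M'.states := by
  obtain ⟨-, -, a, ha, ht⟩ := hst
  exact (h.isValid hS).mem_states hs (hsub s ha) ht

theorem reach_mem (hS : Setting M F one zero) (h : StableRun M F one zero ε k run M')
    (hsub : ∀ s, ρ s ⊆ M'.enabled s) {s t : S} (hs : s ∈ M'.states)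
    (hst : Relation.ReflTransGen (PolicyEdge M' one zero ρ) s t) : t ∈ M'.states := by
  induction hst with
  | refl => exact hs
  | tail _ hstep ih => exact h.edge_mem hS hsub ih hstep

theorem exists_steps (hS : Setting M F one zero) (h : StableRun M F one zero ε k run M')
    (hsub : ∀ s, ρ s ⊆ M'.enabled s) {s t : S} (hs : s ∈ M'.states)
    (hst : Relation.ReflTransGen (PolicyEdge M' one zero ρ) s t) :
    ∃ n, n + 1 ≤ M.states.card ∧ StepsTo (PolicyEdge M' one zero ρ) n s t := by
  obtain ⟨n, hn, hsteps⟩ := exists_stepsTo_lt hs (fun x hx y hxy => h.edge_mem hS hsub hx hxy) hst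
  obtain ⟨proj, hq⟩ := h.isQuotient
  exact ⟨n, hn.trans_le (Finset.card_le_card hq.states_subset), hsteps⟩

/-- While the exploration stays in a set `R` of nonterminal states that the policy does not leave,
no update takes place; when the path is long enough, it contains `R`. -/
theorem exists_timeout (h : StableRun M F one zero ε k run M') {R : Finset S} (h1 : one ∉ R)
    (h0 : zero ∉ R) (hclosed : ∀ s ∈ R, ∀ a ∈ ρ s, ∀ t, M'.trans s a t ≠ 0 → t ∈ R) {n : ℕ}
    (hpol : (run n).policy = ρ) (hlast : (run n).last ∈ R)
    (hR : R ⊆ ((run n).last :: (run n).path.map Move.state).toFinset) :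
    ∃ m, (run m).path.length + 2 = k (run m).iter ∧
      R ⊆ ((run m).last :: (run m).path.map Move.state).toFinset := by
  suffices H : ∀ j n, k (run n).iter - (run n).path.length ≤ j → (run n).policy = ρ →
      (run n).last ∈ R → R ⊆ ((run n).last :: (run n).path.map Move.state).toFinset →
      ∃ m, (run m).path.length + 2 = k (run m).iter ∧
        R ⊆ ((run m).last :: (run m).path.map Move.state).toFinset from H _ n le_rfl hpol hlast hR
  intro j
  induction j with
  | zero =>
    intro n hn
    have := (h.sound n).length
    omega
  | succ j ih =>
    intro n hn hpol hlast hR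
    by_cases hlen : (run n).path.length + 2 = k (run n).iter
    · exact ⟨n, hlen, hR⟩
    obtain ⟨a, ha, t, ht, -, hstep⟩ := h.step_cases n
    have htR : t ∈ R := hclosed _ hlast a (hpol ▸ ha) t ht
    generalize hd : run (n + 1) = d at hstep
    cases hstep with
    | extend =>
      refine ih (n + 1) ?_ ?_ ?_ ?_ <;> rw [hd]
      · simp only [List.length_cons]
        omega
      · exact hpol
      · exact htR
      · intro s hs
        have := hR hs
        simp only [List.map_cons, List.toFinset_cons, Finset.mem_insert] at this ⊢
        exact Or.inr this
    | timeout hlen' => exact absurd hlen' hlen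
    | update hlen' ht' =>
      rcases ht' with rfl | rfl
      · exact absurd htR h1
      · exact absurd htR h0

/-- From every state that a policy used infinitely often can reach, it can reach a terminal
state. -/
theorem exists_reach_terminal (hS : Setting M F one zero)
    (h : StableRun M F one zero ε k run M')
    (hρ : ∃ᶠ n in atTop, (run n).path = [] ∧ (run n).policy = ρ) {x : S}
    (hx : Relation.ReflTransGen (PolicyEdge M' one zero ρ) M'.start x) :
    ∃ z, (z = one ∨ z = zero) ∧ Relation.ReflTransGen (PolicyEdge M' one zero ρ) x z := by
  by_contra hcon
  push Not at hcon
  have hV := h.isValid hS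
  obtain ⟨n₀, -, hn₀⟩ := hρ.exists
  have hsub : ∀ s, ρ s ⊆ M'.enabled s := fun s => hn₀ ▸ h.policy_subset n₀ s
  have hne : ∀ s ∈ M'.states, (ρ s).Nonempty := fun s hs => hn₀ ▸ h.policy_nonempty n₀ hs
  have hxs := h.reach_mem hS hsub hV.start_mem hx
  -- A state with the fewest reachable states: everything reachable from it reaches the same set, so
  -- this set `R` is strongly connected and closed.
  obtain ⟨y, hy, hmin⟩ := (reachFrom M' one zero ρ x).exists_min_image
    (fun y => (reachFrom M' one zero ρ y).card)
    ⟨x, Finset.mem_filter.2 ⟨hxs, Relation.ReflTransGen.refl⟩⟩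
  obtain ⟨hys, hxy⟩ := Finset.mem_filter.1 hy
  have hyR : y ∈ reachFrom M' one zero ρ y :=
    Finset.mem_filter.2 ⟨hys, Relation.ReflTransGen.refl⟩
  set R := reachFrom M' one zero ρ y with hRdef
  have hRs : R ⊆ M'.states := Finset.filter_subset _ _
  have hconn : ∀ z ∈ R, ∀ w ∈ R, Relation.ReflTransGen (PolicyEdge M' one zero ρ) z w := by
    intro z hz w hw
    obtain ⟨hzs, hyz⟩ := Finset.mem_filter.1 hz
    have hle := hmin z (Finset.mem_filter.2 ⟨hzs, hxy.trans hyz⟩)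
    have hsubset : reachFrom M' one zero ρ z ⊆ R := fun w hw =>
      Finset.mem_filter.2 ⟨(Finset.mem_filter.1 hw).1, hyz.trans (Finset.mem_filter.1 hw).2⟩
    rw [← Finset.eq_of_subset_of_card_le hsubset hle] at hw
    exact (Finset.mem_filter.1 hw).2
  have h1R : one ∉ R := fun h' => hcon one (Or.inl rfl) (hxy.trans (Finset.mem_filter.1 h').2)
  have h0R : zero ∉ R := fun h' => hcon zero (Or.inr rfl) (hxy.trans (Finset.mem_filter.1 h').2)
  have hnt : ∀ s ∈ R, s ≠ one ∧ s ≠ zero := fun s hs =>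
    ⟨fun h' => h1R (h' ▸ hs), fun h' => h0R (h' ▸ hs)⟩
  have hclosed : ∀ s ∈ R, ∀ a ∈ ρ s, ∀ t, M'.trans s a t ≠ 0 → t ∈ R := by
    intro s hs a ha t ht
    have hedge : PolicyEdge M' one zero ρ s t := ⟨(hnt s hs).1, (hnt s hs).2, a, ha, ht⟩
    exact Finset.mem_filter.2 ⟨h.edge_mem hS hsub (hRs hs) hedge,
      (Finset.mem_filter.1 hs).2.tail hedge⟩
  have hEC : M'.IsEC R (R.biUnion ρ) := by
    refine ⟨hRs, ?_, ?_, ?_, ?_⟩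
    · intro a ha
      obtain ⟨s, hs, hsa⟩ := Finset.mem_biUnion.1 ha
      exact Finset.mem_biUnion.2 ⟨s, hs, hsub s hsa⟩
    · obtain ⟨a, ha⟩ := hne y hys
      exact ⟨a, Finset.mem_biUnion.2 ⟨y, hyR, ha⟩⟩
    · intro s hs a haB ha t ht
      obtain ⟨s', hs', has'⟩ := Finset.mem_biUnion.1 haB
      have : s = s' := hV.eq_of_mem_enabled (hRs hs) (hRs hs') ha (hsub s' has')
      exact hclosed s hs a (this ▸ has') t ((PMF.mem_support_iff _ _).1 ht)
    · intro s hs t ht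
      have key : ∀ t, Relation.ReflTransGen (PolicyEdge M' one zero ρ) s t → t ∈ R ∧
          Relation.ReflTransGen (fun x y => ∃ a ∈ R.biUnion ρ, a ∈ M'.enabled x ∧
            0 < M'.trans x a y) s t := by
        intro t ht
        induction ht with
        | refl => exact ⟨hs, Relation.ReflTransGen.refl⟩
        | tail _ hstep ih =>
          obtain ⟨-, -, a, ha, hpos⟩ := hstep
          exact ⟨hclosed _ ih.1 a ha _ hpos, ih.2.tail
            ⟨a, Finset.mem_biUnion.2 ⟨_, ih.1, ha⟩, hsub _ ha, pos_iff_ne_zero.2 hpos⟩⟩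
      exact (key t (hconn s hs t ht)).2
  -- Each leg to a new state of `R` takes at most |S| - 1 steps, so `j + 1` states of `R` are
  -- covered within `(j + 1) * (|S| - 1)` steps.
  have hvisit : ∀ j, ∃ p z, PolicyPath M' one zero ρ p z ∧ z ∈ R ∧
      p.length + (j + 1) ≤ (j + 1) * M.states.card ∧
      (R ⊆ (z :: p.map Move.state).toFinset ∨
        j + 1 ≤ (R ∩ (z :: p.map Move.state).toFinset).card) := by
    intro j
    induction j with
    | zero =>
      obtain ⟨n, hn, hsteps⟩ := h.exists_steps hS hsub hV.start_mem (hx.trans hxy)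
      obtain ⟨q, hq, hlen, -, -⟩ := PolicyPath.nil.extend hsteps
      refine ⟨q, y, hq, hyR, ?_, Or.inr ?_⟩
      · rw [hlen, List.length_nil]
        omega
      · refine Finset.card_pos.2 ⟨y, Finset.mem_inter.2 ⟨hyR, ?_⟩⟩
        simp
    | succ j ih =>
      obtain ⟨p, z, hp, hz, hlen, hcov⟩ := ih
      have hN : 1 ≤ M.states.card := Finset.card_pos.2 ⟨one, hS.one_mem⟩
      have hmul : (j + 1 + 1) * M.states.card = (j + 1) * M.states.card + M.states.card := by ring
      by_cases hall : R ⊆ (z :: p.map Move.state).toFinset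
      · exact ⟨p, z, hp, hz, by omega, Or.inl hall⟩
      · obtain ⟨w, hw, hwp⟩ := Finset.not_subset.1 hall
        obtain ⟨n, hn, hsteps⟩ := h.exists_steps hS hsub (hRs hz) (hconn z hz w hw)
        obtain ⟨q, hq, hqlen, hpq, hzq⟩ := hp.extend hsteps
        refine ⟨q, w, hq, hw, by omega, Or.inr ?_⟩
        have hcard := hcov.resolve_left hall
        have hss : insert w (R ∩ (z :: p.map Move.state).toFinset) ⊆
            R ∩ (w :: q.map Move.state).toFinset := by
          intro s hs
          rcases Finset.mem_insert.1 hs with rfl | hs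
          · exact Finset.mem_inter.2 ⟨hw, by simp⟩
          · obtain ⟨hsR, hsp⟩ := Finset.mem_inter.1 hs
            refine Finset.mem_inter.2 ⟨hsR, ?_⟩
            rw [List.mem_toFinset] at hsp ⊢
            rcases List.mem_cons.1 hsp with rfl | hsp
            · rcases hzq with rfl | hzq
              · exact List.mem_cons_self
              · exact List.mem_cons_of_mem _ hzq
            · exact List.mem_cons_of_mem _ (List.map_subset _ hpq hsp)
        have := Finset.card_le_card hss
        rw [Finset.card_insert_of_notMem (fun h' => hwp (Finset.mem_inter.1 h').2)] at this
        omega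
  have hRcard := h.card_nonterminal hS hRs h1R h0R
  have hRpos : 0 < R.card := Finset.card_pos.2 ⟨y, hyR⟩
  obtain ⟨p, z, hp, hz, hlen, hcov⟩ := hvisit (R.card - 1)
  have hsubR : R ⊆ (z :: p.map Move.state).toFinset := by
    rcases hcov with hcov | hcov
    · exact hcov
    · rw [← Finset.eq_of_subset_of_card_le Finset.inter_subset_left
        (show R.card ≤ (R ∩ (z :: p.map Move.state).toFinset).card by omega)]
      exact Finset.inter_subset_right
  have hplen : p.length + 1 < M.states.card ^ 2 := by
    rw [Nat.sub_add_cancel hRpos] at hlen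
    have : R.card * M.states.card < M.states.card ^ 2 := by
      rw [sq]
      exact Nat.mul_lt_mul_of_pos_right (by omega) (by omega)
    omega
  -- Once the covering path has been produced, the simulation stays in `R` until the timeout. The
  -- explored set then contains the end component `R`, and `quiet` is violated.
  obtain ⟨n, hnp, hnz, hnρ⟩ := (h.frequently_path hρ hp hplen (Or.inr (hnt z hz))).exists
  obtain ⟨m, hm, hmR⟩ := h.exists_timeout h1R h0R hclosed hnρ (hnz.symm ▸ hz)
    (by rw [hnp, hnz]; exact hsubR)
  have hnon := hEC.identifyECs_nonempty hmR
  rw [(h.quiet m hm).1] at hnon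
  exact Finset.not_nonempty_empty hnon

/-- Every pair that a policy used infinitely often can reach is updated infinitely often. -/
theorem frequently_update_pair (hS : Setting M F one zero) (hk : ∀ i, 3 ≤ k i) (hε : 0 < ε)
    (h : StableRun M F one zero ε k run M')
    (hρ : ∃ᶠ n in atTop, (run n).path = [] ∧ (run n).policy = ρ) {s : S}
    (hs : Relation.ReflTransGen (PolicyEdge M' one zero ρ) M'.start s) (h1 : s ≠ one)
    (h0 : s ≠ zero) {a : A} (ha : a ∈ ρ s) :
    ∃ᶠ n in atTop,
      (run (n + 1)).bounds.U s a ≤ M'.mean s a (M'.best (run n).bounds.U) ∧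
      M'.mean s a (M'.best (run n).bounds.L) ≤ (run (n + 1)).bounds.L s a ∧
      ε ≤ (run (n + 1)).bounds.gap := by
  have hV := h.isValid hS
  obtain ⟨n₀, -, hn₀⟩ := hρ.exists
  have hsub : ∀ s, ρ s ⊆ M'.enabled s := fun s => hn₀ ▸ h.policy_subset n₀ s
  obtain ⟨t, ht⟩ := (M'.trans s a).support_nonempty
  have ht := (PMF.mem_support_iff _ _).1 ht
  have hedge : PolicyEdge M' one zero ρ s t := ⟨h1, h0, a, ha, ht⟩
  obtain ⟨z, hz, htz⟩ := h.exists_reach_terminal hS hρ (hs.tail hedge)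
  have hss := h.reach_mem hS hsub hV.start_mem hs
  obtain ⟨n, hn, hsteps⟩ := h.exists_steps hS hsub hV.start_mem hs
  obtain ⟨n', hn', hsteps'⟩ := h.exists_steps hS hsub (h.edge_mem hS hsub hss hedge) htz
  obtain ⟨q, hq, hqlen, -, -⟩ := PolicyPath.nil.extend hsteps
  obtain ⟨q', hq', hq'len, hqq', -⟩ := (PolicyPath.cons hq h1 h0 ha ht).extend hsteps'
  have hmem : (⟨s, a⟩ : Move S A) ∈ q' := hqq' List.mem_cons_self
  have h3 := h.three_le_card hS hk hε
  -- At most |S| - 1 steps lead to `s`, one step is the pair itself, and |S| - 1 more lead to a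
  -- terminal state. Since |S| is at least 3, `2 * |S| < |S|²`.
  have hlen : q'.length + 1 < M.states.card ^ 2 := by
    rw [hq'len, List.length_cons, hqlen, List.length_nil]
    have : 3 * M.states.card ≤ M.states.card ^ 2 := by
      rw [sq]
      exact Nat.mul_le_mul_right _ h3
    omega
  refine (h.frequently_update hρ hq' hlen hz (List.ne_nil_of_mem hmem)).mono fun m hm => ?_
  obtain ⟨hpath, hb, hgap⟩ := hm
  obtain ⟨proj, hsound⟩ := (h.sound m).bounds
  obtain ⟨-, -, -, -, hU, hL⟩ := hsound.foldl_update hS q' hpath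
  rw [h.mdp m] at hU hL
  refine ⟨?_, ?_, hgap⟩
  · rw [hb]
    exact hU _ hmem
  · rw [hb]
    exact hL _ hmem

end StableRun

end Convergence

/-! ### Limits of the bounds and the maximum principle -/

section Limit

open Filter Topology

universe u v
variable {S : Type u} {A : Type v}

theorem MDP.tendsto_best (M : MDP S A) {f : ℕ → S → A → ℝ} {g : S → A → ℝ} {s : S}
    (h : ∀ a ∈ M.enabled s, Tendsto (fun n => f n s a) atTop (𝓝 (g s a))) :
    Tendsto (fun n => M.best (f n) s) atTop (𝓝 (M.best g s)) := by
  by_cases hE : (M.enabled s).Nonempty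
  · simp only [MDP.best, dif_pos hE]
    exact Filter.Tendsto.finset_sup'_nhds_apply hE h
  · simp only [MDP.best, dif_neg hE]
    exact tendsto_const_nhds

theorem MDP.tendsto_mean (M : MDP S A) {f : ℕ → S → ℝ} {g : S → ℝ} (s : S) (a : A)
    (h : ∀ t ∈ M.states, Tendsto (fun n => f n t) atTop (𝓝 (g t))) :
    Tendsto (fun n => M.mean s a (f n)) atTop (𝓝 (M.mean s a g)) :=
  tendsto_finsetSum _ fun t ht => (h t ht).const_mul _

variable [Finite S] [Finite A]
variable {M M' : MDP S A} {F : Set S} {one zero : S} {ε : ℝ} {k : ℕ → ℕ} {run : ℕ → Config S A}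
  {ρ : S → Finset A}

namespace StableRun

theorem bounds_succ (hS : Setting M F one zero) (h : StableRun M F one zero ε k run M') (n : ℕ)
    {s : S} (hs : s ∈ M'.states) {a : A} (ha : a ∈ M'.enabled s) :
    (run (n + 1)).bounds.U s a ≤ (run n).bounds.U s a ∧
      (run n).bounds.L s a ≤ (run (n + 1)).bounds.L s a := by
  obtain ⟨b, hb, t, -, -, hstep⟩ := h.step_cases n
  generalize hd : run (n + 1) = d at hstep
  cases hstep with
  | extend => exact ⟨le_rfl, le_rfl⟩
  | timeout hlen =>
    rw [← hd, (h.quiet n hlen).2]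
    exact ⟨le_rfl, le_rfl⟩
  | update =>
    obtain ⟨proj, hb'⟩ := (h.sound n).bounds
    obtain ⟨-, -, hU, hL, -⟩ := hb'.foldl_update hS _ ((h.sound n).mem_path_cons hb)
    rw [h.mdp n] at hU hL
    exact ⟨hU s hs a ha, hL s hs a ha⟩

theorem exists_limit (hS : Setting M F one zero) (h : StableRun M F one zero ε k run M') :
    ∃ f g : S → A → ℝ, ∀ s ∈ M'.states, ∀ a ∈ M'.enabled s,
      Tendsto (fun n => (run n).bounds.U s a) atTop (𝓝 (f s a)) ∧
      Tendsto (fun n => (run n).bounds.L s a) atTop (𝓝 (g s a)) := by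
  refine ⟨fun s a => ⨅ n, (run n).bounds.U s a, fun s a => ⨆ n, (run n).bounds.L s a,
    fun s hs a ha => ?_⟩
  have hbound : ∀ n, 0 ≤ (run n).bounds.L s a ∧ (run n).bounds.L s a ≤ (run n).bounds.U s a ∧
      (run n).bounds.U s a ≤ 1 := by
    intro n
    obtain ⟨proj, hb⟩ := (h.sound n).bounds
    have hs' : s ∈ (run n).bounds.mdp.states := h.mdp n ▸ hs
    have ha' : a ∈ (run n).bounds.mdp.enabled s := h.mdp n ▸ ha
    exact ⟨hb.lower_nonneg s hs' a ha', (hb.lower s hs' a ha').trans (hb.upper s hs' a ha'),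
      hb.upper_le_one s hs' a ha'⟩
  constructor
  · refine tendsto_atTop_ciInf (antitone_nat_of_succ_le fun n => (h.bounds_succ hS n hs ha).1)
      ⟨0, ?_⟩
    rintro _ ⟨n, rfl⟩
    exact (hbound n).1.trans (hbound n).2.1
  · refine tendsto_atTop_ciSup (monotone_nat_of_le_succ fun n => (h.bounds_succ hS n hs ha).2)
      ⟨1, ?_⟩
    rintro _ ⟨n, rfl⟩
    exact (hbound n).2.1.trans (hbound n).2.2

/-- The bounds of a stable run converge to each other at the initial state, by the maximum
principle for the difference of their limits on the states that a policy used infinitely often can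
reach. Hence the algorithm would have terminated. -/
theorem false (hS : Setting M F one zero) (hk : ∀ i, 3 ≤ k i) (hε : 0 < ε)
    (h : StableRun M F one zero ε k run M') : False := by
  have hV := h.isValid hS
  obtain ⟨ρ, hρ⟩ := h.exists_policy
  have hsub : ∀ s, ρ s ⊆ M'.enabled s := by
    obtain ⟨n, -, hn⟩ := hρ.exists
    exact fun s => hn ▸ h.policy_subset n s
  have hne : ∀ s ∈ M'.states, (ρ s).Nonempty := by
    obtain ⟨n, -, hn⟩ := hρ.exists
    exact fun s hs => hn ▸ h.policy_nonempty n hs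
  obtain ⟨f, g, hfg⟩ := h.exists_limit hS
  have hf : ∀ s ∈ M'.states,
      Tendsto (fun n => M'.best (run n).bounds.U s) atTop (𝓝 (M'.best f s)) :=
    fun s hs => M'.tendsto_best fun a ha => (hfg s hs a ha).1
  have hg : ∀ s ∈ M'.states,
      Tendsto (fun n => M'.best (run n).bounds.L s) atTop (𝓝 (M'.best g s)) :=
    fun s hs => M'.tendsto_best fun a ha => (hfg s hs a ha).2
  set D : S → ℝ := fun s => M'.best f s - M'.best g s with hD
  have hterm : ∀ z, (z = one ∨ z = zero) → z ∈ M'.states → D z = 0 := by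
    intro z hz hzs
    have heq : ∀ n, M'.best (run n).bounds.U z = M'.best (run n).bounds.L z := by
      intro n
      obtain ⟨proj, hb⟩ := (h.sound n).bounds
      have := best_start_terminal hS hb hz
      rwa [h.mdp n] at this
    have hf' := hf z hzs
    simp only [heq] at hf'
    exact sub_eq_zero.2 (tendsto_nhds_unique hf' (hg z hzs))
  have hmean : ∀ s, Relation.ReflTransGen (PolicyEdge M' one zero ρ) M'.start s →
      s ≠ one → s ≠ zero → ∀ a ∈ ρ s, D s ≤ M'.mean s a D := by
    intro s hs h1 h0 a ha
    have hss := h.reach_mem hS hsub hV.start_mem hs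
    have hup := h.frequently_update_pair hS hk hε hρ hs h1 h0 ha
    -- `a` maximises U at the infinitely many times when the policy is ρ, so it also maximises the
    -- limit. No eventually constant policy is required.
    have hbest : M'.best f s ≤ f s a := by
      refine le_of_tendsto_of_tendsto_of_frequently (hf s hss) (hfg s hss a (hsub s ha)).1
        (hρ.mono fun n hn => ?_)
      have := (MDP.mem_bestActions.1 (show a ∈ (run n).policy s from hn.2 ▸ ha)).2
      rw [h.mdp n] at this
      exact this.ge
    have hU : f s a ≤ M'.mean s a (M'.best f) :=
      le_of_tendsto_of_tendsto_of_frequently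
        ((tendsto_add_atTop_iff_nat 1).2 (hfg s hss a (hsub s ha)).1)
        (M'.tendsto_mean s a hf) (hup.mono fun n hn => hn.1)
    have hL : M'.mean s a (M'.best g) ≤ g s a :=
      le_of_tendsto_of_tendsto_of_frequently (M'.tendsto_mean s a hg)
        ((tendsto_add_atTop_iff_nat 1).2 (hfg s hss a (hsub s ha)).2)
        (hup.mono fun n hn => hn.2.1)
    have := M'.le_best g (hsub s ha)
    rw [hD, M'.mean_sub]
    linarith
  obtain ⟨x, hx, hmax⟩ := (reachFrom M' one zero ρ M'.start).exists_max_image D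
    ⟨M'.start, Finset.mem_filter.2 ⟨hV.start_mem, Relation.ReflTransGen.refl⟩⟩
  have hxreach := (Finset.mem_filter.1 hx).2
  -- A maximum of D over the reachable states is inherited by all successors under ρ, since D is at
  -- most its mean there.
  have hconst : ∀ y, Relation.ReflTransGen (PolicyEdge M' one zero ρ) x y → D y = D x := by
    intro y hy
    induction hy with
    | refl => rfl
    | @tail y z hxy hyz ih =>
      have hreach := hxreach.trans hxy
      obtain ⟨h1, h0, a, ha, hz⟩ := hyz
      have hys := h.reach_mem hS hsub hV.start_mem hreach
      refine hV.eq_of_le_mean hys (hsub y ha) (fun t ht ht0 => ?_)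
        (ih ▸ hmean y hreach h1 h0 a ha) hz
      exact hmax t (Finset.mem_filter.2 ⟨ht, hreach.tail ⟨h1, h0, a, ha, ht0⟩⟩)
  obtain ⟨z, hz, hxz⟩ := h.exists_reach_terminal hS hρ hxreach
  have hDx : D x = 0 :=
    (hconst z hxz).symm.trans (hterm z hz (h.reach_mem hS hsub hV.start_mem (hxreach.trans hxz)))
  have hstart : D M'.start ≤ 0 :=
    hDx ▸ hmax _ (Finset.mem_filter.2 ⟨hV.start_mem, Relation.ReflTransGen.refl⟩)
  obtain ⟨h1, h0⟩ := h.start_not_terminal hS hk hε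
  obtain ⟨a, ha⟩ := hne _ hV.start_mem
  -- Updates recur and each of them fails the termination test, so the gap is at least ε infinitely
  -- often, hence in the limit.
  have hgap : ε ≤ D M'.start := by
    refine ge_of_tendsto_of_frequently ((tendsto_add_atTop_iff_nat 1).2
      ((hf _ hV.start_mem).sub (hg _ hV.start_mem)))
      ((h.frequently_update_pair hS hk hε hρ Relation.ReflTransGen.refl h1 h0 ha).mono
        fun n hn => ?_)
    have := hn.2.2
    rwa [Bounds.gap, h.mdp (n + 1)] at this
  linarith

end StableRun

end Limit

end

end OBRTDP

theorem mainTheorem1 {S A : Type*} [Finite S] [Finite A]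
    (M : OBRTDP.MDP S A) (hM : M.IsValid)
    (one zero : S) (hone : one ∈ M.states) (hzero : zero ∈ M.states) (hne : one ≠ zero)
    (hone_terminal : M.IsTerminal one) (hzero_terminal : M.IsTerminal zero)
    (F : Set S) (hone_target : one ∈ F) (hzero_target : zero ∉ F)
    (hF : ∀ s ∈ M.states, s ∈ F → ∃ a ∈ M.enabled s, OBRTDP.actionValue M F s a = 1)
    (k : ℕ → ℕ) (hk : ∀ i, 3 ≤ k i) (hk_large : ∀ᶠ i in Filter.atTop, M.states.card ^ 2 ≤ k i)
    (ε : ℝ) (hε : 0 < ε) :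
    ∀ᵐ run ∂(OBRTDP.runMeasure M F one zero ε k),
      ∃ n, (run n).halted = true ∧ (run n).bounds.IsCorrect M F ε := by
  have hS : OBRTDP.Setting M F one zero := ⟨hM, hone, hzero, hne, hone_terminal, hzero_terminal,
    hone_target, hzero_target, hF⟩
  filter_upwards [OBRTDP.ae_fairRun hS hk] with run hrun
  by_contra hcon
  push Not at hcon
  -- Soundness makes every halting configuration correct, so a run without a correct halt never
  -- halts.
  have hhalt : ∀ n, (run n).halted = false := fun n =>
    Bool.eq_false_iff.2 fun hn => hcon n hn ((hrun.1 n).isCorrect hS hn)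
  obtain ⟨run', M', hstable⟩ := (hrun.2 hhalt).exists_stableRun hS hk hk_large
  exact hstable.false hS hk hε
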